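/- Let $R$ be a commutative ring, let $0\le n\le s$, $x=(x_1,\dots,x_n)$, and $f_1,\dots,f_s\in R[x]$. Let $C=R[x]\otimes_R\Lambda(\hat f_1,\dots,\hat f_s)$ be the Koszul complex, graded by exterior degree $|\cdot|$, with the $R[x]$-linear antiderivation $\partial$, $\partial\hat f_i=f_i$, as boundary. Let $C^*=\mathrm{Hom}_R(C,R)$ be the dual complex, where functionals on $C_r$ have degree $-r$ and $\partial[c](a)=-(-1)^{|c|}c(\partial a)$. For an $R$-linear map $a$ between two of these complexes put $\partial[a]=\partial\circ a-(-1)^{|a|}a\circ\partial$ (extended additively to inhomogeneous $a$); $a$ is a morphism of complexes if $\partial[a]=0$. Let $\nabla^kf_i\in R[x,y]$ ($1\le i\le s$, $1\le k\le n$) be any polynomials with $\sum_k(x_k-y_k)\nabla^kf_i(x,y)=f_i(x)-f_i(y)$ for all $i$. Let $\hat f_{i,x},\hat f_{i,y},\hat u_k$ be anticommuting generators, and let $\hat u_*^k$ denote left contraction with the generator dual to $\hat u_k$. The difference Jacobian is $$J=(-\hat u_*^n)\cdots(-\hat u_*^1)\,.\,\prod_{i=1}^s\Bigl(\hat f_{i,x}-\hat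 f_{i,y}-\sum_{k=1}^n\hat u_k\nabla^kf_i(x,y)\Bigr)\in R[x,y]\otimes_R\Lambda(\hat f_x,\hat f_y).$$ Write $J=\sum J'(x,\hat f_x)\,J''(y,\hat f_y)$ with $J''$ homogeneous. The $J$-map is $$\mathcal J:C^*\to C,\qquad \mathcal J(c)=\sum(-1)^{|J''|}J'\,c(J'').$$ For $e\in C^*$ and $c\in C$ let $e\cdot c\in C^*$ be the functional $b\mapsto e(cb)$. For $L\in\mathrm{End}_R(C)$ and $c\in C^*$ let $L^\vee c=(-1)^{|L||c|}c\circ L$ for homogeneous $L,c$, extended biadditively. **Theorem.** Suppose that $R[x]/(f_1,\dots,f_s)$ is a finitely generated $R$-module. Then there are $e\in C^*$ with $\partial[e]=0$ and $t\in C$ such that $\mathcal J(e)=1+\partial t$. Moreover, for every $e\in C^*$ with $\partial[e]=0$ and $\mathcal J(e)\in 1+\partial C$, the maps $\mathcal J:C^*\to C$ and $c\mapsto e\cdot c$, $C\to C^*$, are morphisms of complexes that are homotopy inverse to each other; precisely: 1. there is $H\in\mathrm{End}_R(C)$ with $c-\mathcal J(e\cdot c)=\partial[H](c)$ for all $c\in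 C$, and with $c-\mathcal J(e\cdot c)=\partial(H(c))$ whenever $\partial c=0$; 2. there is $L\in\mathrm{End}_R(C)$ with $c-e\cdot\mathcal J(c)=(\partial[L])^\vee c$ for all $c\in C^*$, and with $c-e\cdot\mathcal J(c)=\partial[L^\vee c]$ whenever $\partial[c]=0$; 3. the homology modules $H_0(C)$ and $H_{-(s-n)}(C^*)$ are finitely generated over $R$. -/

import Mathlib

open scoped TensorProduct

noncomputable section

namespace KoszulDuality

/-! ### Complexes with a parity involution -/

section General

variable {R : Type*} [CommRing R]
variable {M N : Type*} [AddCommGroup M] [Module R M] [AddCommGroup N] [Module R N]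

/-- The boundary of an `R`-linear map `a : M → N` in the complex of linear maps. Here `dM`, `dN` are
the boundary operators of `M`, `N`, and `sM`, `sN` act as `(-1) ^ r` on elements of degree `r`.
For homogeneous `a` one has `sN ∘ a ∘ sM = (-1) ^ |a| a`, so that this is
`∂[a].c = ∂[a.c] - (-1) ^ |a| a.∂[c]`, extended additively to all `a`. -/
def homBoundary (dM sM : M →ₗ[R] M) (dN sN : N →ₗ[R] N) (a : M →ₗ[R] N) : M →ₗ[R] N :=
  dN ∘ₗ a - sN ∘ₗ a ∘ₗ sM ∘ₗ dM

/-- The part of the homology of `(M, d)` inside a graded piece `G` of `M`: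
cycles in `G` modulo the boundaries lying in `G`. -/
abbrev Homology (d : M →ₗ[R] M) (G : Submodule R M) : Type _ :=
  ↥(LinearMap.ker d ⊓ G) ⧸
    Submodule.comap (LinearMap.ker d ⊓ G).subtype (LinearMap.range d)

end General

/-! ### Koszul complexes -/

variable (R : Type*) [CommRing R]

/-- The underlying algebra `R[x] ⊗ Λ(f̂)` of a Koszul complex: the variables `x` are indexed by `σ`,
the exterior generators `f̂` by `ι`. -/
abbrev Kos (σ ι : Type*) : Type _ := MvPolynomial σ R ⊗[R] ExteriorAlgebra R (ι → R)

variable {R} {σ ι : Type*}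

/-- A polynomial, as an element of degree zero. -/
def pol (p : MvPolynomial σ R) : Kos R σ ι := p ⊗ₜ[R] 1

/-- The exterior generator with index `i`. -/
def gen [DecidableEq ι] (i : ι) : Kos R σ ι :=
  1 ⊗ₜ[R] ExteriorAlgebra.ι R (Pi.single i 1)

/-- Contraction from the left with the generator dual to the generator with index `i`
(an `R[x]`-linear antiderivation). -/
def contract (i : ι) : Kos R σ ι →ₗ[R] Kos R σ ι :=
  LinearMap.lTensor (MvPolynomial σ R)
    (CliffordAlgebra.contractLeft (LinearMap.proj i : Module.Dual R (ι → R)))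

/-- The boundary operator of the Koszul complex of the polynomials `f i`: the `R[x]`-linear
antiderivation with `f̂ i ↦ f i`, that is, contraction with `∑ i, f i f̂_*^i`. -/
def boundary [Fintype ι] (f : ι → MvPolynomial σ R) : Kos R σ ι →ₗ[R] Kos R σ ι :=
  ∑ i, LinearMap.mulLeft R (pol (f i)) ∘ₗ contract i

/-- The parity operator: multiplication by `(-1) ^ r` in degree `r`. -/
def parity : Kos R σ ι →ₗ[R] Kos R σ ι :=
  LinearMap.lTensor (MvPolynomial σ R)
    (CliffordAlgebra.involute (Q := (0 : QuadraticForm R (ι → R)))).toLinearMap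

/-- The projection to the part of even (`i = 0`) or odd (`i = 1`) degree. -/
def parityProj (i : ZMod 2) : Kos R σ ι →ₗ[R] Kos R σ ι :=
  LinearMap.lTensor (MvPolynomial σ R)
    (GradedAlgebra.proj (CliffordAlgebra.evenOdd (0 : QuadraticForm R (ι → R))) i)

variable (R σ ι) in
/-- The elements of degree `r`. -/
def degreePart (r : ℕ) : Submodule R (Kos R σ ι) :=
  LinearMap.range (LinearMap.lTensor (MvPolynomial σ R) (⋀[R]^r (ι → R)).subtype)

/-! ### The dual complex -/

/-- The parity operator of the dual complex: multiplication by `(-1) ^ |c|`. -/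
def dualParity : Module.Dual R (Kos R σ ι) →ₗ[R] Module.Dual R (Kos R σ ι) :=
  LinearMap.lcomp R R parity

/-- The boundary operator of the dual complex, `∂[c].a = -(-1) ^ |c| c.∂[a]`. -/
def dualBoundary [Fintype ι] (f : ι → MvPolynomial σ R) :
    Module.Dual R (Kos R σ ι) →ₗ[R] Module.Dual R (Kos R σ ι) :=
  -(LinearMap.lcomp R R (parity ∘ₗ boundary f))

variable (R σ ι) in
/-- The elements of degree `-r` of the dual complex: the functionals that vanish on all elements
of degree different from `r`. -/
def dualDegreePart (r : ℕ) : Submodule R (Module.Dual R (Kos R σ ι)) :=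
  (⨆ r' : {k : ℕ // k ≠ r}, degreePart R σ ι r').dualAnnihilator

/-- For a functional `e`, the map `c ↦ (b ↦ e (c * b))` from the Koszul complex to its dual. -/
def cap (e : Module.Dual R (Kos R σ ι)) : Kos R σ ι →ₗ[R] Module.Dual R (Kos R σ ι) :=
  LinearMap.compr₂ (LinearMap.mul R (Kos R σ ι)) e

/-- The operator on the dual complex contragredient to `a : Kos → Kos`: for homogeneous `a`, `c`
it sends `c` to `(-1) ^ (|a| |c|) c ∘ a`. On the even part of `c` this is `c ∘ a`, on the odd part
it is `c ∘ (parity ∘ a ∘ parity)`. -/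
def contragredient (a : Kos R σ ι →ₗ[R] Kos R σ ι) :
    Module.Dual R (Kos R σ ι) →ₗ[R] Module.Dual R (Kos R σ ι) :=
  LinearMap.lcomp R R (parityProj 0 ∘ₗ a) +
    LinearMap.lcomp R R (parityProj 1 ∘ₗ parity ∘ₗ a ∘ₗ parity)

/-! ### The difference Jacobian -/

/-- `D i k` are coefficients of a difference gradient of `f`:
`∑ k, (x_k - y_k) D i k (x, y) = f_i(x) - f_i(y)` for every `i`. The variables `x` are indexed
by `Sum.inl`, the variables `y` by `Sum.inr`. -/
def IsDifferenceGradient {n s : ℕ} (f : Fin s → MvPolynomial (Fin n) R)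
    (D : Fin s → Fin n → MvPolynomial (Fin n ⊕ Fin n) R) : Prop :=
  ∀ i, ∑ k, (MvPolynomial.X (Sum.inl k) - MvPolynomial.X (Sum.inr k)) * D i k =
    MvPolynomial.rename Sum.inl (f i) - MvPolynomial.rename Sum.inr (f i)

/-- The product `∏ i, (f̂_{i,x} - f̂_{i,y} - ∑ k, û_k D i k)` in the order of increasing `i`.
The generators `f̂_x`, `f̂_y`, `û` are indexed by `inl (inl i)`, `inl (inr i)`, `inr k`. -/
def jacobianProd {n s : ℕ} (D : Fin s → Fin n → MvPolynomial (Fin n ⊕ Fin n) R) :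
    Kos R (Fin n ⊕ Fin n) ((Fin s ⊕ Fin s) ⊕ Fin n) :=
  (List.ofFn fun i : Fin s =>
    gen (Sum.inl (Sum.inl i)) - gen (Sum.inl (Sum.inr i)) -
      ∑ k, gen (Sum.inr k) * pol (D i k)).prod

/-- Setting to zero the generators indexed by `κ`. -/
def forget (κ : Type*) : Kos R σ (ι ⊕ κ) →ₗ[R] Kos R σ ι :=
  LinearMap.lTensor (MvPolynomial σ R)
    (ExteriorAlgebra.map (LinearMap.funLeft R R (Sum.inl : ι → ι ⊕ κ))).toLinearMap

/-- The difference Jacobian: `(-û_*^n) ⋯ (-û_*^1)` applied to `jacobianProd D`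
(the factor `-û_*^1` acts first). The result of the contractions contains no `û`, so that `forget`
only changes the type. -/
def jacobian {n s : ℕ} (D : Fin s → Fin n → MvPolynomial (Fin n ⊕ Fin n) R) :
    Kos R (Fin n ⊕ Fin n) (Fin s ⊕ Fin s) :=
  forget (Fin n)
    ((List.finRange n).foldl (fun w k => -contract (Sum.inr k) w) (jacobianProd D))

/-- The algebra map `R[x, y] → R[x] ⊗ R[y]` with `x ↦ x ⊗ 1`, `y ↦ 1 ⊗ y`. -/
def splitPoly (σ τ : Type*) :
    MvPolynomial (σ ⊕ τ) R →ₐ[R] MvPolynomial σ R ⊗[R] MvPolynomial τ R :=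
  MvPolynomial.aeval
    (Sum.elim (fun i => MvPolynomial.X i ⊗ₜ[R] 1) (fun j => 1 ⊗ₜ[R] MvPolynomial.X j))

/-- The linear map `Λ(f̂, ĝ) → Λ(f̂) ⊗ Λ(ĝ)` with `a(f̂) b(ĝ) ↦ a ⊗ b`. It is an algebra
homomorphism for the graded (signed) product on the tensor product. -/
def splitExt (ι κ : Type*) :
    ExteriorAlgebra R (ι ⊕ κ → R) →ₗ[R]
      ExteriorAlgebra R (ι → R) ⊗[R] ExteriorAlgebra R (κ → R) :=
  (GradedTensorProduct.of R
      (CliffordAlgebra.evenOdd (0 : QuadraticForm R (ι → R)))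
      (CliffordAlgebra.evenOdd (0 : QuadraticForm R (κ → R)))).symm.toLinearMap ∘ₗ
    (CliffordAlgebra.ofProd
      (0 : QuadraticForm R (ι → R)) (0 : QuadraticForm R (κ → R))).toLinearMap ∘ₗ
    (CliffordAlgebra.map
      { toLinearMap := (LinearEquiv.sumArrowLequivProdArrow ι κ R R).toLinearMap
        map_app' := by intro m; simp } :
      CliffordAlgebra (0 : QuadraticForm R (ι ⊕ κ → R)) →ₐ[R] _).toLinearMap

/-- The linear map `R[x, y] ⊗ Λ(f̂, ĝ) → (R[x] ⊗ Λ(f̂)) ⊗ (R[y] ⊗ Λ(ĝ))` with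
`a(x, f̂) b(y, ĝ) ↦ a ⊗ b`. -/
def split (σ τ ι κ : Type*) : Kos R (σ ⊕ τ) (ι ⊕ κ) →ₗ[R] Kos R σ ι ⊗[R] Kos R τ κ :=
  (TensorProduct.tensorTensorTensorComm R _ _ _ _).toLinearMap ∘ₗ
    TensorProduct.map (splitPoly σ τ).toLinearMap (splitExt ι κ)

/-- The `J`-map. If `J(p_x, p_y) = ∑ J'(p_x) J''(p_y)` is the difference Jacobian, with `J''`
homogeneous, it sends a functional `c` to `∑ (-1) ^ |J''| J' (c.J'')`; the sign is the one for
interchanging `J''` and `c` (only `|c| = -|J''|` contributes). -/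
def jMap {n s : ℕ} (D : Fin s → Fin n → MvPolynomial (Fin n ⊕ Fin n) R) :
    Module.Dual R (Kos R (Fin n) (Fin s)) →ₗ[R] Kos R (Fin n) (Fin s) where
  toFun c := TensorProduct.rid R _
    (LinearMap.lTensor _ (dualParity c)
      (split (Fin n) (Fin n) (Fin s) (Fin s) (jacobian D)))
  map_add' := by intro a b; simp [LinearMap.lTensor_add]
  map_smul' := by intro r a; simp [LinearMap.lTensor_smul]

/-- `jMap D` and `cap e` are morphisms of complexes, mutually inverse up to homotopy and on
homology, and the homology in degree `0` of the Koszul complex and the homology in degree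
`-(s - n)` of its dual are finitely generated. -/
structure IsDuality {n s : ℕ} (f : Fin s → MvPolynomial (Fin n) R)
    (D : Fin s → Fin n → MvPolynomial (Fin n ⊕ Fin n) R)
    (e : Module.Dual R (Kos R (Fin n) (Fin s))) : Prop where
  jMap_morphism :
    homBoundary (dualBoundary f) dualParity (boundary f) parity (jMap D) = 0
  cap_morphism :
    homBoundary (boundary f) parity (dualBoundary f) dualParity (cap e) = 0
  left_homotopy : ∃ H : Kos R (Fin n) (Fin s) →ₗ[R] Kos R (Fin n) (Fin s),
    (∀ c, c - jMap D (cap e c) =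
      homBoundary (boundary f) parity (boundary f) parity H c) ∧
    (∀ c, boundary f c = 0 → c - jMap D (cap e c) = boundary f (H c))
  right_homotopy : ∃ L : Kos R (Fin n) (Fin s) →ₗ[R] Kos R (Fin n) (Fin s),
    (∀ c, c - cap e (jMap D c) =
      contragredient (homBoundary (boundary f) parity (boundary f) parity L) c) ∧
    (∀ c, dualBoundary f c = 0 →
      c - cap e (jMap D c) = dualBoundary f (contragredient L c))
  finite_homology_zero :
    Module.Finite R (Homology (boundary f) (degreePart R (Fin n) (Fin s) 0))
  finite_dual_homology :
    Module.Finite R (Homology (dualBoundary f) (dualDegreePart R (Fin n) (Fin s) (s - n)))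

end KoszulDuality

end

open scoped TensorProduct

noncomputable section

/-! The difference Jacobian `J` is a cycle of the tensor product of two copies `C_x`, `C_y` of the
Koszul complex, and everything follows from one fact: multiplying `J` by `c(x)` or by `c(y)` gives
chain homotopic maps of `c` (`exists_mul_jacobian_homotopy`). Let `Π` be the product of the factors
`f̂_{i,x} - f̂_{i,y} - ∑ û_k ∇^k f_i`, with boundary `û_k ↦ x_k - y_k`. Each factor is a cycle with
square zero, so `Π` is a cycle and annihilates each factor: next to `Π`, `f̂_{i,y}` may be replaced
by `f̂_{i,x} - ∑ û_k ∇^k f_i`. This turns `c(y)` into `gradHom D c`, which no longer contains `f̂_y`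
and becomes `c(x)` when `y = x`, `û = 0`. That substitution is homotopic to the identity, since the
Koszul complex of the `x_k - y_k` contracts by divided differences (`exists_homotopy_diagHom`).
Contracting all `û` ("fibre integration") turns `Π` into `J`.

Let `e` be a cocycle. Evaluating `e` in the `y`-copy, the fact above shows that `𝒥(e·c)` is
homotopic to `𝒥(e) c` (`exists_jMap_cap_homotopy`), hence to `c` if `𝒥(e) = 1 + ∂t`. Evaluating `e`
in the `x`-copy, `c ↦ e·𝒥(c)` is, up to homotopy, contragredient to multiplication by `k`, the value
of `e` on the `x`-part of `J` (`exists_cap_jMap_homotopy`). That `k` is homologous to `1` as well is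
not a second hypothesis: it comes from applying `𝒥` to `e·𝒥(e)` (`exists_slantX_jacobian_eq`).
Finiteness then holds because both homology modules are quotients of `R[x]/(f)`, the second one
through `p ↦ e·p`.

Existence of `e` (`exists_cocycle_jMap_eq`): modulo `(f)` each `x_k` is integral, so there are monic
`p_k` with `p_k(x_k) = ∑ a_{k,i} f_i`. With `w = ∏_k ∑_i a_{k,i} f̂_i`, let `e(c)` be, up to sign,
the residue modulo the `p_k` of the top exterior coefficient of `c w`. In `𝒥(e)` the Jacobian of `f`
can be exchanged, up to boundaries, for that of the `p_k(x_k)`, the product of the one-variable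
difference quotients, whose residue in `y` is `1`. -/

namespace KoszulDuality


/-! ### The Koszul algebra: parity, Leibniz rules and graded commutativity. -/

section Basic

set_option linter.unusedSectionVars false

variable {R : Type*} [CommRing R] {σ τ υ ι κ μ : Type}

/-! ### The algebra structure of a Koszul complex -/

/-- `pol` as an algebra homomorphism. -/
def polHom (R : Type*) [CommRing R] (σ ι : Type) : MvPolynomial σ R →ₐ[R] Kos R σ ι :=
  Algebra.TensorProduct.includeLeft

lemma pol_zero : (pol 0 : Kos R σ ι) = 0 := map_zero (polHom R σ ι)

lemma pol_one : (pol 1 : Kos R σ ι) = 1 := map_one (polHom R σ ι)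

lemma pol_add (p q : MvPolynomial σ R) : (pol (p + q) : Kos R σ ι) = pol p + pol q :=
  map_add (polHom R σ ι) p q

lemma pol_sub (p q : MvPolynomial σ R) : (pol (p - q) : Kos R σ ι) = pol p - pol q :=
  map_sub (polHom R σ ι) p q

lemma pol_neg (p : MvPolynomial σ R) : (pol (-p) : Kos R σ ι) = -pol p :=
  map_neg (polHom R σ ι) p

lemma pol_mul (p q : MvPolynomial σ R) : (pol (p * q) : Kos R σ ι) = pol p * pol q :=
  map_mul (polHom R σ ι) p q

lemma pol_smul (r : R) (p : MvPolynomial σ R) : (pol (r • p) : Kos R σ ι) = r • pol p :=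
  map_smul (polHom R σ ι) r p

lemma pol_sum {α : Type*} (s : Finset α) (p : α → MvPolynomial σ R) :
    (pol (∑ a ∈ s, p a) : Kos R σ ι) = ∑ a ∈ s, pol (p a) :=
  map_sum (polHom R σ ι) p s

lemma pol_mul_tmul (p q : MvPolynomial σ R) (a : ExteriorAlgebra R (ι → R)) :
    pol p * (q ⊗ₜ[R] a) = (p * q) ⊗ₜ[R] a := by
  simp [pol]

lemma pol_mul_comm (p : MvPolynomial σ R) (x : Kos R σ ι) : pol p * x = x * pol p := by
  induction x using TensorProduct.induction_on with
  | zero => simp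
  | tmul q a => simp [pol, mul_comm]
  | add x y hx hy => rw [mul_add, add_mul, hx, hy]

lemma pol_mul_left_comm (p : MvPolynomial σ R) (x y : Kos R σ ι) :
    x * (pol p * y) = pol p * (x * y) := by
  rw [← mul_assoc, ← pol_mul_comm, mul_assoc]

lemma kos_mul_neg (x y : Kos R σ ι) : x * -y = -(x * y) := mul_neg x y

lemma kos_neg_mul (x y : Kos R σ ι) : -x * y = -(x * y) := neg_mul x y

lemma kos_neg_smul (r : R) (x : Kos R σ ι) : -r • x = -(r • x) := neg_smul r x

lemma kos_smul_neg (r : R) (x : Kos R σ ι) : r • -x = -(r • x) := smul_neg r x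

/-- The element `∑ k, w k * gen k` of degree one. -/
def vec [Fintype ι] [DecidableEq ι] (w : ι → MvPolynomial σ R) : Kos R σ ι :=
  ∑ k, pol (w k) * gen k

variable [Fintype ι] [DecidableEq ι] [Fintype κ] [DecidableEq κ] [Fintype μ] [DecidableEq μ]

lemma gen_mul_gen_self (i : ι) : (gen i : Kos R σ ι) * gen i = 0 := by
  simp [gen]

lemma gen_mul_gen (i j : ι) : (gen i : Kos R σ ι) * gen j = -(gen j * gen i) := by
  rw [eq_neg_iff_add_eq_zero]
  simp only [gen, Algebra.TensorProduct.tmul_mul_tmul, mul_one, ← TensorProduct.tmul_add,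
    ExteriorAlgebra.ι_add_mul_swap, TensorProduct.tmul_zero]

lemma tmul_ι_mul (p : MvPolynomial σ R) (m : ι → R) (a : ExteriorAlgebra R (ι → R)) :
    p ⊗ₜ[R] (ExteriorAlgebra.ι R m * a) = ∑ i, gen i * ((m i • p) ⊗ₜ[R] a) := by
  have hm : m = ∑ i, m i • Pi.single i (1 : R) := by
    ext j
    simp [Finset.sum_apply, Pi.single_apply]
  conv_lhs => rw [hm]
  simp only [gen, map_sum, map_smul, Finset.sum_mul, TensorProduct.tmul_sum,
    Algebra.TensorProduct.tmul_mul_tmul, one_mul, smul_mul_assoc, TensorProduct.tmul_smul,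
    TensorProduct.smul_tmul']

/-- Every element is a sum of products of generators and a polynomial. -/
theorem kos_induction {P : Kos R σ ι → Prop} (h_pol : ∀ p, P (pol p))
    (h_add : ∀ x y, P x → P y → P (x + y)) (h_gen : ∀ i x, P x → P (gen i * x))
    (x : Kos R σ ι) : P x := by
  have h0 : P 0 := by simpa [pol_zero] using h_pol 0
  have key : ∀ a : ExteriorAlgebra R (ι → R), ∀ p : MvPolynomial σ R, P (p ⊗ₜ[R] a) := by
    intro a
    induction a using CliffordAlgebra.left_induction with
    | algebraMap r =>
      intro p
      have : p ⊗ₜ[R] (algebraMap R (ExteriorAlgebra R (ι → R)) r) = pol (r • p) := by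
        rw [pol, Algebra.algebraMap_eq_smul_one, TensorProduct.tmul_smul, TensorProduct.smul_tmul']
      exact this ▸ h_pol _
    | add a b ha hb =>
      intro p
      rw [TensorProduct.tmul_add]
      exact h_add _ _ (ha p) (hb p)
    | ι_mul a m ha =>
      intro p
      have := tmul_ι_mul p m a
      refine this ▸ Finset.sum_induction _ P h_add h0 fun i _ => h_gen i _ (ha _)
  induction x using TensorProduct.induction_on with
  | zero => exact h0
  | tmul p a => exact key a p
  | add x y hx hy => exact h_add x y hx hy

/-! ### Polynomial-linear operators -/

lemma lTensor_pol_mul (g : ExteriorAlgebra R (ι → R) →ₗ[R] ExteriorAlgebra R (κ → R))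
    (p : MvPolynomial σ R) (x : Kos R σ ι) :
    LinearMap.lTensor (MvPolynomial σ R) g (pol p * x) =
      pol p * LinearMap.lTensor (MvPolynomial σ R) g x := by
  induction x using TensorProduct.induction_on with
  | zero => simp
  | tmul q a => simp [pol]
  | add x y hx hy => rw [mul_add, map_add, map_add, mul_add, hx, hy]

lemma gen_mul_tmul (i : ι) (q : MvPolynomial σ R) (a : ExteriorAlgebra R (ι → R)) :
    gen i * (q ⊗ₜ[R] a) = q ⊗ₜ[R] (ExteriorAlgebra.ι R (Pi.single i 1) * a) := by
  simp [gen]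

/-! ### Parity -/

/-- `parity` as an algebra homomorphism. -/
def parityHom (R : Type*) [CommRing R] (σ ι : Type) : Kos R σ ι →ₐ[R] Kos R σ ι :=
  Algebra.TensorProduct.map (AlgHom.id R _)
    (CliffordAlgebra.involute (Q := (0 : QuadraticForm R (ι → R))))

lemma parity_mul (x y : Kos R σ ι) : parity (x * y) = parity x * parity y :=
  map_mul (parityHom R σ ι) x y

lemma parity_one : parity (1 : Kos R σ ι) = 1 := map_one (parityHom R σ ι)

lemma parity_pol (p : MvPolynomial σ R) : parity (pol p : Kos R σ ι) = pol p := by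
  rw [pol, parity, LinearMap.lTensor_tmul]
  exact congrArg _ (map_one (CliffordAlgebra.involute (Q := (0 : QuadraticForm R (ι → R)))))

lemma parity_gen (i : ι) : parity (gen i : Kos R σ ι) = -gen i := by
  rw [gen, parity, LinearMap.lTensor_tmul, ← TensorProduct.tmul_neg]
  exact congrArg _ (CliffordAlgebra.involute_ι _)

lemma parity_vec (w : ι → MvPolynomial σ R) : parity (vec w) = -vec w := by
  simp only [vec, map_sum, parity_mul, parity_pol, parity_gen, kos_mul_neg, Finset.sum_neg_distrib]

lemma parity_parity (x : Kos R σ ι) : parity (parity x) = x := by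
  induction x using kos_induction with
  | h_pol p => rw [parity_pol, parity_pol]
  | h_add x y hx hy => rw [map_add, map_add, hx, hy]
  | h_gen i x hx => rw [parity_mul, parity_mul, parity_gen, map_neg, parity_gen, hx, neg_neg]

/-! ### Contractions and boundaries -/

lemma contract_pol_mul (i : ι) (p : MvPolynomial σ R) (x : Kos R σ ι) :
    contract i (pol p * x) = pol p * contract i x := lTensor_pol_mul _ p x

lemma contract_pol (i : ι) (p : MvPolynomial σ R) : contract i (pol p : Kos R σ ι) = 0 := by
  rw [pol, contract, LinearMap.lTensor_tmul]
  simp only [CliffordAlgebra.contractLeft_one, TensorProduct.tmul_zero]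

lemma contract_gen_mul (i j : ι) (x : Kos R σ ι) :
    contract i (gen j * x) = (if i = j then x else 0) - gen j * contract i x := by
  induction x using TensorProduct.induction_on with
  | zero => simp
  | add x y hx hy => rw [mul_add, map_add, hx, hy, map_add, mul_add]; split_ifs <;> abel
  | tmul q a =>
    have h := CliffordAlgebra.contractLeft_ι_mul (Q := (0 : QuadraticForm R (ι → R)))
      (d := LinearMap.proj i) (Pi.single j 1) a
    rw [gen_mul_tmul, contract, LinearMap.lTensor_tmul, LinearMap.lTensor_tmul, gen_mul_tmul]
    refine (congrArg (TensorProduct.tmul R q) h).trans ?_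
    rw [TensorProduct.tmul_sub]
    congr 1
    by_cases hij : i = j
    · subst hij; simp
    · simp [hij]

lemma boundary_apply (w : ι → MvPolynomial σ R) (x : Kos R σ ι) :
    boundary w x = ∑ i, pol (w i) * contract i x := by
  simp [boundary]

/-- A contraction is a boundary operator with constant coefficients, so the rules for `boundary`
need no separate proofs for `contract`. -/
lemma boundary_single (i : ι) : boundary (R := R) (Pi.single i (1 : MvPolynomial σ R)) =
    contract i := by
  refine LinearMap.ext fun x => ?_
  rw [boundary_apply, Finset.sum_eq_single i]
  · rw [Pi.single_eq_same, pol_one, one_mul]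
  · intro j _ hj
    rw [Pi.single_eq_of_ne hj, pol_zero, zero_mul]
  · simp

lemma boundary_pol_mul (w : ι → MvPolynomial σ R) (p : MvPolynomial σ R) (x : Kos R σ ι) :
    boundary w (pol p * x) = pol p * boundary w x := by
  rw [boundary_apply, boundary_apply, Finset.mul_sum]
  refine Finset.sum_congr rfl fun k _ => ?_
  rw [contract_pol_mul, pol_mul_left_comm]

lemma boundary_pol (w : ι → MvPolynomial σ R) (p : MvPolynomial σ R) :
    boundary w (pol p) = 0 := by
  simp only [boundary_apply, contract_pol, mul_zero, Finset.sum_const_zero]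

lemma boundary_one (w : ι → MvPolynomial σ R) : boundary w 1 = 0 := by
  rw [← pol_one, boundary_pol]

lemma boundary_gen_mul (w : ι → MvPolynomial σ R) (i : ι) (x : Kos R σ ι) :
    boundary w (gen i * x) = pol (w i) * x - gen i * boundary w x := by
  rw [boundary_apply, boundary_apply, Finset.mul_sum]
  simp only [contract_gen_mul, mul_sub, Finset.sum_sub_distrib, mul_ite, mul_zero,
    Finset.sum_ite_eq', Finset.mem_univ, if_true]
  congr 1
  exact Finset.sum_congr rfl fun k _ => (pol_mul_left_comm _ _ _).symm

lemma boundary_gen (w : ι → MvPolynomial σ R) (i : ι) : boundary w (gen i) = pol (w i) := by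
  simpa [boundary_one] using boundary_gen_mul w i 1

lemma boundary_parity (w : ι → MvPolynomial σ R) (x : Kos R σ ι) :
    boundary w (parity x) = -parity (boundary w x) := by
  induction x using kos_induction with
  | h_pol p => rw [parity_pol, boundary_pol, map_zero, neg_zero]
  | h_add x y hx hy => simp only [map_add, hx, hy, neg_add]
  | h_gen i x hx =>
    rw [parity_mul, parity_gen, kos_neg_mul, map_neg, boundary_gen_mul, boundary_gen_mul, hx,
      map_sub, parity_mul, parity_mul, parity_pol, parity_gen, kos_mul_neg, kos_neg_mul]

lemma boundary_mul (w : ι → MvPolynomial σ R) (x y : Kos R σ ι) :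
    boundary w (x * y) = boundary w x * y + parity x * boundary w y := by
  induction x using kos_induction with
  | h_pol p => rw [boundary_pol_mul, boundary_pol, parity_pol, zero_mul, zero_add]
  | h_add x x' hx hx' => simp only [map_add, add_mul, hx, hx']; abel
  | h_gen i x hx =>
    rw [mul_assoc, boundary_gen_mul, hx, boundary_gen_mul, parity_mul, parity_gen, kos_neg_mul,
      kos_neg_mul, mul_add, sub_mul, mul_assoc, mul_assoc, mul_assoc]
    abel

lemma boundary_anticomm (v w : ι → MvPolynomial σ R) (x : Kos R σ ι) :
    boundary v (boundary w x) = -boundary w (boundary v x) := by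
  induction x using kos_induction with
  | h_pol p => simp only [boundary_pol, map_zero, neg_zero]
  | h_add x y hx hy => simp only [map_add, hx, hy, neg_add]
  | h_gen i x hx =>
    simp only [boundary_gen_mul, map_sub, boundary_pol_mul, hx, kos_mul_neg]
    abel

/-- Anticommutation of boundaries with equal coefficients gives only `2 ∂² = 0`; as `2` may be a
zero divisor, the square needs its own induction. -/
lemma boundary_boundary (w : ι → MvPolynomial σ R) (x : Kos R σ ι) :
    boundary w (boundary w x) = 0 := by
  induction x using kos_induction with
  | h_pol p => simp only [boundary_pol, map_zero]
  | h_add x y hx hy => simp only [map_add, hx, hy, add_zero]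
  | h_gen i x hx =>
    simp only [boundary_gen_mul, map_sub, boundary_pol_mul, hx, mul_zero, sub_zero, sub_self]

lemma boundary_zero_left (x : Kos R σ ι) : boundary (0 : ι → MvPolynomial σ R) x = 0 := by
  simp only [boundary_apply, Pi.zero_apply, pol_zero, zero_mul, Finset.sum_const_zero]

lemma contract_mul (i : ι) (x y : Kos R σ ι) :
    contract i (x * y) = contract i x * y + parity x * contract i y := by
  rw [← boundary_single, boundary_mul]

lemma boundary_vec (w v : ι → MvPolynomial σ R) :
    boundary w (vec v) = pol (∑ i, v i * w i) := by
  simp only [vec, map_sum, boundary_pol_mul, boundary_gen, pol_sum, pol_mul]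

/-! ### Even and odd parts -/

lemma parityProj_pol_mul (i : ZMod 2) (p : MvPolynomial σ R) (x : Kos R σ ι) :
    parityProj i (pol p * x) = pol p * parityProj i x := lTensor_pol_mul _ p x

lemma parityProj_gen_mul (i : ZMod 2) (j : ι) (x : Kos R σ ι) :
    parityProj (1 + i) (gen j * x) = gen j * parityProj i x := by
  induction x using TensorProduct.induction_on with
  | zero => simp
  | add x y hx hy => rw [mul_add, map_add, hx, hy, map_add, mul_add]
  | tmul q a =>
    rw [gen_mul_tmul, parityProj, parityProj, LinearMap.lTensor_tmul, LinearMap.lTensor_tmul,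
      gen_mul_tmul]
    exact congrArg _ (DirectSum.coe_decompose_mul_add_of_left_mem
      (CliffordAlgebra.evenOdd (0 : QuadraticForm R (ι → R)))
      (CliffordAlgebra.ι_mem_evenOdd_one _ _))

lemma parityProj_zero_gen_mul (j : ι) (x : Kos R σ ι) :
    parityProj 0 (gen j * x) = gen j * parityProj 1 x := parityProj_gen_mul 1 j x

lemma parityProj_one_gen_mul (j : ι) (x : Kos R σ ι) :
    parityProj 1 (gen j * x) = gen j * parityProj 0 x := parityProj_gen_mul 0 j x

lemma parityProj_zero_pol (p : MvPolynomial σ R) : parityProj 0 (pol p : Kos R σ ι) = pol p := by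
  rw [pol, parityProj, LinearMap.lTensor_tmul]
  exact congrArg _ (DirectSum.decompose_of_mem_same
    (CliffordAlgebra.evenOdd (0 : QuadraticForm R (ι → R))) SetLike.GradedOne.one_mem)

lemma parityProj_one_pol (p : MvPolynomial σ R) : parityProj 1 (pol p : Kos R σ ι) = 0 := by
  rw [pol, parityProj, LinearMap.lTensor_tmul, ← TensorProduct.tmul_zero _ p]
  exact congrArg _ (DirectSum.decompose_of_mem_ne
    (CliffordAlgebra.evenOdd (0 : QuadraticForm R (ι → R))) SetLike.GradedOne.one_mem zero_ne_one)

lemma parityProj_zero_one : parityProj 0 (1 : Kos R σ ι) = 1 := by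
  rw [← pol_one, parityProj_zero_pol]

lemma parityProj_one_one : parityProj 1 (1 : Kos R σ ι) = 0 := by
  rw [← pol_one, parityProj_one_pol]

lemma parityProj_add (x : Kos R σ ι) : parityProj 0 x + parityProj 1 x = x := by
  induction x using kos_induction with
  | h_pol p => rw [parityProj_zero_pol, parityProj_one_pol, add_zero]
  | h_add x y hx hy => nth_rw 3 [← hx, ← hy]; simp only [map_add]; abel
  | h_gen i x hx =>
    rw [parityProj_zero_gen_mul, parityProj_one_gen_mul, ← mul_add, add_comm, hx]

lemma parity_parityProj (x : Kos R σ ι) :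
    parity (parityProj 0 x) = parityProj 0 x ∧ parity (parityProj 1 x) = -parityProj 1 x := by
  induction x using kos_induction with
  | h_pol p =>
    rw [parityProj_zero_pol, parityProj_one_pol, map_zero, neg_zero, parity_pol]
    exact ⟨rfl, rfl⟩
  | h_add x y hx hy =>
    simp only [map_add, hx.1, hx.2, hy.1, hy.2, neg_add, and_self]
  | h_gen i x hx =>
    rw [parityProj_zero_gen_mul, parityProj_one_gen_mul, parity_mul, parity_mul, hx.1, hx.2,
      parity_gen, kos_mul_neg, kos_neg_mul, neg_neg, kos_neg_mul]
    exact ⟨rfl, rfl⟩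

lemma parity_parityProj_zero (x : Kos R σ ι) : parity (parityProj 0 x) = parityProj 0 x :=
  (parity_parityProj x).1

lemma parity_parityProj_one (x : Kos R σ ι) : parity (parityProj 1 x) = -parityProj 1 x :=
  (parity_parityProj x).2

lemma parity_eq (x : Kos R σ ι) : parity x = parityProj 0 x - parityProj 1 x := by
  nth_rw 1 [← parityProj_add x]
  rw [map_add, parity_parityProj_zero, parity_parityProj_one, sub_eq_add_neg]

lemma parityProj_parityProj (x : Kos R σ ι) :
    (parityProj 0 (parityProj 0 x) = parityProj 0 x ∧ parityProj 1 (parityProj 1 x) = parityProj 1 x)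
    ∧ parityProj 1 (parityProj 0 x) = 0 ∧ parityProj 0 (parityProj 1 x) = 0 := by
  induction x using kos_induction with
  | h_pol p =>
    simp only [parityProj_zero_pol, parityProj_one_pol, map_zero, and_self]
  | h_add x y hx hy =>
    simp only [map_add, hx.1.1, hx.1.2, hx.2.1, hx.2.2, hy.1.1, hy.1.2, hy.2.1, hy.2.2, add_zero,
      and_self]
  | h_gen i x hx =>
    simp only [parityProj_zero_gen_mul, parityProj_one_gen_mul, hx.1.1, hx.1.2, hx.2.1, hx.2.2,
      mul_zero, and_self]

lemma parityProj_zero_zero (x : Kos R σ ι) : parityProj 0 (parityProj 0 x) = parityProj 0 x :=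
  (parityProj_parityProj x).1.1

lemma parityProj_one_one' (x : Kos R σ ι) : parityProj 1 (parityProj 1 x) = parityProj 1 x :=
  (parityProj_parityProj x).1.2

lemma parityProj_one_zero (x : Kos R σ ι) : parityProj 1 (parityProj 0 x) = 0 :=
  (parityProj_parityProj x).2.1

lemma parityProj_zero_one' (x : Kos R σ ι) : parityProj 0 (parityProj 1 x) = 0 :=
  (parityProj_parityProj x).2.2

lemma parityProj_zero_parity (x : Kos R σ ι) : parityProj 0 (parity x) = parityProj 0 x := by
  rw [parity_eq, map_sub, parityProj_zero_zero, parityProj_zero_one', sub_zero]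

lemma parityProj_one_parity (x : Kos R σ ι) : parityProj 1 (parity x) = -parityProj 1 x := by
  rw [parity_eq, map_sub, parityProj_one_one', parityProj_one_zero, zero_sub]

lemma boundary_parityProj (w : ι → MvPolynomial σ R) (x : Kos R σ ι) :
    boundary w (parityProj 0 x) = parityProj 1 (boundary w x) ∧
      boundary w (parityProj 1 x) = parityProj 0 (boundary w x) := by
  induction x using kos_induction with
  | h_pol p =>
    simp only [parityProj_zero_pol, parityProj_one_pol, boundary_pol, map_zero, and_self]
  | h_add x y hx hy =>
    simp only [map_add, hx.1, hx.2, hy.1, hy.2, and_self]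
  | h_gen i x hx =>
    simp only [parityProj_zero_gen_mul, parityProj_one_gen_mul, boundary_gen_mul, hx.1, hx.2,
      map_sub, parityProj_pol_mul, and_self]

lemma boundary_parityProj_zero (w : ι → MvPolynomial σ R) (x : Kos R σ ι) :
    boundary w (parityProj 0 x) = parityProj 1 (boundary w x) := (boundary_parityProj w x).1

lemma boundary_parityProj_one (w : ι → MvPolynomial σ R) (x : Kos R σ ι) :
    boundary w (parityProj 1 x) = parityProj 0 (boundary w x) := (boundary_parityProj w x).2

lemma mul_gen (i : ι) (x : Kos R σ ι) : x * gen i = gen i * parity x := by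
  induction x using kos_induction with
  | h_pol p => rw [parity_pol, pol_mul_comm]
  | h_add x y hx hy => rw [add_mul, hx, hy, map_add, mul_add]
  | h_gen j x hx =>
    rw [mul_assoc, hx, parity_mul, parity_gen, ← mul_assoc, gen_mul_gen, kos_neg_mul, kos_neg_mul,
      kos_mul_neg, mul_assoc]

/-- Graded commutativity. Elements are not homogeneous here, so the sign is expressed by the even
and odd parts of one factor and `parity` on the other. -/
lemma parityProj_mul_comm (x y : Kos R σ ι) :
    parityProj 0 x * y = y * parityProj 0 x ∧ parityProj 1 x * y = parity y * parityProj 1 x := by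
  induction x using kos_induction generalizing y with
  | h_pol p =>
    rw [parityProj_zero_pol, parityProj_one_pol, zero_mul, mul_zero, pol_mul_comm]
    exact ⟨rfl, rfl⟩
  | h_add x x' hx hx' =>
    simp only [map_add, add_mul, mul_add, (hx y).1, (hx y).2, (hx' y).1, (hx' y).2, and_self]
  | h_gen i x hx =>
    rw [parityProj_zero_gen_mul, parityProj_one_gen_mul, mul_assoc, mul_assoc, (hx y).1, (hx y).2,
      ← mul_assoc, ← mul_assoc, ← mul_assoc, ← mul_assoc, mul_gen, mul_gen, parity_parity]
    exact ⟨rfl, rfl⟩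

lemma parityProj_zero_mul_comm (x y : Kos R σ ι) : parityProj 0 x * y = y * parityProj 0 x :=
  (parityProj_mul_comm x y).1

lemma parityProj_one_mul_comm (x y : Kos R σ ι) :
    parityProj 1 x * y = parity y * parityProj 1 x :=
  (parityProj_mul_comm x y).2

end Basic


/-! ### Homomorphisms of Koszul algebras and the exterior grading. -/

section Hom

set_option linter.unusedSectionVars false

variable {R : Type*} [CommRing R] {σ τ υ ι κ μ : Type}
variable [Fintype ι] [DecidableEq ι] [Fintype κ] [DecidableEq κ] [Fintype μ] [DecidableEq μ]

/-! ### Elements of degree one -/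

lemma vec_single (i : ι) : vec (Pi.single i (1 : MvPolynomial σ R)) = gen i := by
  rw [vec, Finset.sum_eq_single i]
  · rw [Pi.single_eq_same, pol_one, one_mul]
  · intro j _ hj
    rw [Pi.single_eq_of_ne hj, pol_zero, zero_mul]
  · simp

lemma vec_zero : (vec (0 : ι → MvPolynomial σ R)) = 0 := by
  simp only [vec, Pi.zero_apply, pol_zero, zero_mul, Finset.sum_const_zero]

lemma vec_mul_swap (w : ι → MvPolynomial σ R) (x : Kos R σ ι) :
    x * vec w = vec w * parity x := by
  rw [vec, Finset.mul_sum, Finset.sum_mul]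
  refine Finset.sum_congr rfl fun k _ => ?_
  rw [pol_mul_left_comm, mul_gen, mul_assoc]

lemma vec_mul_vec (v w : ι → MvPolynomial σ R) : vec v * vec w = -(vec w * vec v) := by
  rw [vec_mul_swap, parity_vec, kos_mul_neg]

/-- The squares are a separate hypothesis since anticommutation alone does not make them vanish in
characteristic two. This is the condition that the universal property of the exterior algebra
requires in `hom`. -/
lemma sum_mul_self_eq_zero {α : Type*} (s : Finset α) (v : α → Kos R σ ι)
    (h0 : ∀ a, v a * v a = 0) (h1 : ∀ a b, v a * v b = -(v b * v a)) :
    (∑ a ∈ s, v a) * (∑ a ∈ s, v a) = 0 := by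
  classical
  induction s using Finset.induction_on with
  | empty => simp
  | insert a s ha ih =>
    have h2 : v a * ∑ b ∈ s, v b = -((∑ b ∈ s, v b) * v a) := by
      rw [Finset.mul_sum, Finset.sum_mul, ← Finset.sum_neg_distrib]
      exact Finset.sum_congr rfl fun b _ => h1 a b
    rw [Finset.sum_insert ha, add_mul, mul_add, mul_add, ih, h0, h2]
    abel

lemma vec_mul_self (w : ι → MvPolynomial σ R) : vec w * vec w = 0 := by
  refine sum_mul_self_eq_zero _ _ (fun a => ?_) fun a b => ?_
  · rw [mul_assoc, pol_mul_left_comm, gen_mul_gen_self, mul_zero, mul_zero]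
  · rw [mul_assoc, mul_assoc, pol_mul_left_comm, pol_mul_left_comm, gen_mul_gen a b, kos_mul_neg,
      kos_mul_neg, ← mul_assoc, ← pol_mul, pol_mul, mul_assoc,
      pol_mul_left_comm (w a) (gen b)]

/-! ### Homomorphisms of Koszul algebras -/

lemma commute_polHom_comp (u : MvPolynomial σ R →ₐ[R] MvPolynomial τ R) (p : MvPolynomial σ R)
    (x : Kos R τ κ) : Commute ((polHom R τ κ).comp u p) x := pol_mul_comm (u p) x

/-- The algebra homomorphism that is `u` on polynomials and sends the generator with index `i`
to `∑ k, A i k * gen k`. -/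
def hom (u : MvPolynomial σ R →ₐ[R] MvPolynomial τ R) (A : ι → κ → MvPolynomial τ R) :
    Kos R σ ι →ₐ[R] Kos R τ κ :=
  Algebra.TensorProduct.lift ((polHom R τ κ).comp u)
    (ExteriorAlgebra.lift R
      ⟨∑ i, (LinearMap.proj i : (ι → R) →ₗ[R] R).smulRight (vec (A i)), fun m => by
        simp only [LinearMap.sum_apply, LinearMap.smulRight_apply, LinearMap.proj_apply]
        refine sum_mul_self_eq_zero _ _ (fun a => ?_) fun a b => ?_
        · rw [smul_mul_smul_comm, vec_mul_self, smul_zero]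
        · rw [smul_mul_smul_comm, smul_mul_smul_comm, vec_mul_vec, smul_neg, mul_comm (m a)]⟩)
    fun p _ => commute_polHom_comp u p _

lemma hom_pol (u : MvPolynomial σ R →ₐ[R] MvPolynomial τ R) (A : ι → κ → MvPolynomial τ R)
    (p : MvPolynomial σ R) : hom u A (pol p) = pol (u p) := by
  rw [hom, pol, Algebra.TensorProduct.lift_tmul, map_one, mul_one]
  rfl

lemma hom_gen (u : MvPolynomial σ R →ₐ[R] MvPolynomial τ R) (A : ι → κ → MvPolynomial τ R)
    (i : ι) : hom u A (gen i) = vec (A i) := by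
  rw [hom, gen, Algebra.TensorProduct.lift_tmul, map_one, one_mul, ExteriorAlgebra.lift_ι_apply,
    LinearMap.sum_apply, Finset.sum_eq_single i]
  · simp
  · intro j _ hj
    rw [LinearMap.smulRight_apply, LinearMap.proj_apply, Pi.single_eq_of_ne hj, zero_smul]
  · simp

lemma hom_gen_of_eq_single {u : MvPolynomial σ R →ₐ[R] MvPolynomial τ R}
    {A : ι → κ → MvPolynomial τ R} {i : ι} {k : κ} (h : A i = Pi.single k 1) :
    hom u A (gen i) = gen k := by
  rw [hom_gen, h, vec_single]

theorem kos_algHom_ext {B : Type*} [Ring B] [Algebra R B] {F G : Kos R σ ι →ₐ[R] B}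
    (h_pol : ∀ j, F (pol (MvPolynomial.X j)) = G (pol (MvPolynomial.X j)))
    (h_gen : ∀ i, F (gen i) = G (gen i)) : F = G := by
  have h1 : F.comp (polHom R σ ι) = G.comp (polHom R σ ι) := MvPolynomial.algHom_ext h_pol
  refine AlgHom.ext fun x => ?_
  induction x using kos_induction with
  | h_pol p => exact AlgHom.congr_fun h1 p
  | h_add x y hx hy => rw [map_add, map_add, hx, hy]
  | h_gen i x hx => rw [map_mul, map_mul, hx, h_gen]

lemma hom_parity (u : MvPolynomial σ R →ₐ[R] MvPolynomial τ R) (A : ι → κ → MvPolynomial τ R)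
    (x : Kos R σ ι) : hom u A (parity x) = parity (hom u A x) := by
  induction x using kos_induction with
  | h_pol p => rw [parity_pol, hom_pol, parity_pol]
  | h_add x y hx hy => simp only [map_add, hx, hy]
  | h_gen i x hx =>
    rw [parity_mul, map_mul, map_mul, parity_mul, hx, parity_gen, map_neg, hom_gen, parity_vec]

/-- A homomorphism is compatible with boundaries as soon as it is on the generators. -/
theorem boundary_hom {u : MvPolynomial σ R →ₐ[R] MvPolynomial τ R} {A : ι → κ → MvPolynomial τ R}
    {v : κ → MvPolynomial τ R} {w : ι → MvPolynomial σ R}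
    (h : ∀ i, ∑ k, A i k * v k = u (w i)) (x : Kos R σ ι) :
    boundary v (hom u A x) = hom u A (boundary w x) := by
  induction x using kos_induction with
  | h_pol p => rw [hom_pol, boundary_pol, boundary_pol, map_zero]
  | h_add x y hx hy => simp only [map_add, hx, hy]
  | h_gen i x hx =>
    rw [map_mul, hom_gen, boundary_mul, boundary_vec, h, hx, parity_vec, boundary_gen_mul, map_sub,
      map_mul, map_mul, hom_pol, hom_gen, kos_neg_mul, ← sub_eq_add_neg]

/-- Contraction with `gen k` is the boundary with coefficients `Pi.single k 1`. It vanishes on the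
image of every generator, so the homomorphism intertwines it with the zero boundary. -/
theorem contract_hom_eq_zero {u : MvPolynomial σ R →ₐ[R] MvPolynomial τ R}
    {A : ι → κ → MvPolynomial τ R} {k : κ} (h : ∀ i, A i k = 0) (x : Kos R σ ι) :
    contract k (hom u A x) = 0 := by
  rw [← boundary_single, boundary_hom (w := 0), boundary_zero_left, map_zero]
  intro i
  rw [Finset.sum_eq_single k, h, zero_mul, Pi.zero_apply, map_zero]
  · intro j _ hj
    rw [Pi.single_eq_of_ne hj, mul_zero]
  · simp

/-- The homomorphism induced by maps of the index sets. -/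
def incl (R : Type*) [CommRing R] (a : σ → τ) (b : ι → κ) : Kos R σ ι →ₐ[R] Kos R τ κ :=
  hom (MvPolynomial.rename a) fun i => Pi.single (b i) 1

lemma incl_pol (a : σ → τ) (b : ι → κ) (p : MvPolynomial σ R) :
    incl R a b (pol p : Kos R σ ι) = pol (MvPolynomial.rename a p) := hom_pol _ _ _

lemma incl_gen (a : σ → τ) (b : ι → κ) (i : ι) :
    incl R a b (gen i : Kos R σ ι) = gen (b i) := hom_gen_of_eq_single rfl

lemma incl_parity (a : σ → τ) (b : ι → κ) (x : Kos R σ ι) :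
    incl R a b (parity x) = parity (incl R a b x) := hom_parity _ _ _

lemma boundary_incl (a : σ → τ) (b : ι → κ) (v : κ → MvPolynomial τ R) (w : ι → MvPolynomial σ R)
    (h : ∀ i, v (b i) = MvPolynomial.rename a (w i)) (x : Kos R σ ι) :
    boundary v (incl R a b x) = incl R a b (boundary w x) := by
  refine boundary_hom (fun i => ?_) x
  rw [Finset.sum_eq_single (b i), Pi.single_eq_same, one_mul, h]
  · intro j _ hj
    rw [Pi.single_eq_of_ne hj, zero_mul]
  · simp

lemma contract_incl_of_notMem (a : σ → τ) (b : ι → κ) (k : κ) (h : ∀ i, b i ≠ k) (x : Kos R σ ι) :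
    contract k (incl R a b x) = 0 :=
  contract_hom_eq_zero (fun i => Pi.single_eq_of_ne (h i).symm 1) x

lemma contract_incl (a : σ → τ) (b : ι → κ) (hb : Function.Injective b) (i : ι) (x : Kos R σ ι) :
    contract (b i) (incl R a b x) = incl R a b (contract i x) := by
  rw [← boundary_single, ← boundary_single]
  refine boundary_incl a b _ _ (fun j => ?_) x
  by_cases hij : j = i
  · subst hij; simp
  · rw [Pi.single_eq_of_ne hij, Pi.single_eq_of_ne (hb.ne hij), map_zero]

/-! ### Degrees -/

/-- The projection to the part of degree `r`. -/
def degProj (r : ℕ) : Kos R σ ι →ₗ[R] Kos R σ ι :=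
  LinearMap.lTensor (MvPolynomial σ R)
    (GradedAlgebra.proj (fun i : ℕ => ⋀[R]^i (ι → R)) r)

lemma degProj_pol_mul (r : ℕ) (p : MvPolynomial σ R) (x : Kos R σ ι) :
    degProj r (pol p * x) = pol p * degProj r x := lTensor_pol_mul _ p x

lemma degProj_succ_gen_mul (r : ℕ) (j : ι) (x : Kos R σ ι) :
    degProj (r + 1) (gen j * x) = gen j * degProj r x := by
  induction x using TensorProduct.induction_on with
  | zero => simp
  | add x y hx hy => rw [mul_add, map_add, hx, hy, map_add, mul_add]
  | tmul q a =>
    rw [gen_mul_tmul, degProj, degProj, LinearMap.lTensor_tmul, LinearMap.lTensor_tmul,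
      gen_mul_tmul, add_comm]
    refine congrArg _ (DirectSum.coe_decompose_mul_add_of_left_mem
      (fun i : ℕ => ⋀[R]^i (ι → R)) ?_)
    simp

lemma degProj_zero_gen_mul (j : ι) (x : Kos R σ ι) : degProj 0 (gen j * x) = 0 := by
  induction x using TensorProduct.induction_on with
  | zero => simp
  | add x y hx hy => rw [mul_add, map_add, hx, hy, add_zero]
  | tmul q a =>
    rw [gen_mul_tmul, degProj, LinearMap.lTensor_tmul, ← TensorProduct.tmul_zero _ q]
    refine congrArg _ (DirectSum.coe_decompose_mul_of_left_mem_of_not_le (i := 1)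
      (fun i : ℕ => ⋀[R]^i (ι → R)) ?_ (by simp))
    simp

lemma degProj_zero_pol (p : MvPolynomial σ R) : degProj 0 (pol p : Kos R σ ι) = pol p := by
  rw [pol, degProj, LinearMap.lTensor_tmul]
  exact congrArg _ (DirectSum.decompose_of_mem_same
    (fun i : ℕ => ⋀[R]^i (ι → R)) SetLike.GradedOne.one_mem)

lemma degProj_succ_pol (r : ℕ) (p : MvPolynomial σ R) :
    degProj (r + 1) (pol p : Kos R σ ι) = 0 := by
  rw [pol, degProj, LinearMap.lTensor_tmul, ← TensorProduct.tmul_zero _ p]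
  exact congrArg _ (DirectSum.decompose_of_mem_ne
    (fun i : ℕ => ⋀[R]^i (ι → R)) SetLike.GradedOne.one_mem (Nat.succ_ne_zero r).symm)

lemma boundary_degProj (w : ι → MvPolynomial σ R) (r : ℕ) (x : Kos R σ ι) :
    boundary w (degProj (r + 1) x) = degProj r (boundary w x) := by
  induction x using kos_induction generalizing r with
  | h_pol p => simp only [degProj_succ_pol, boundary_pol, map_zero]
  | h_add x y hx hy => simp only [map_add, hx, hy]
  | h_gen i x hx =>
    cases r with
    | zero =>
      rw [degProj_succ_gen_mul, boundary_gen_mul, boundary_gen_mul, map_sub, degProj_zero_gen_mul,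
        degProj_pol_mul, sub_zero, sub_eq_self]
      -- Degree zero consists of polynomials, and these are cycles.
      have h0 : boundary w (degProj 0 x) = 0 := by
        clear hx
        induction x using kos_induction with
        | h_pol p => rw [degProj_zero_pol, boundary_pol]
        | h_add x y hx hy => simp only [map_add, hx, hy, add_zero]
        | h_gen i x hx => rw [degProj_zero_gen_mul, map_zero]
      rw [h0, mul_zero]
    | succ r =>
      rw [degProj_succ_gen_mul, boundary_gen_mul, boundary_gen_mul, map_sub, degProj_succ_gen_mul,
        degProj_pol_mul, hx]

lemma contract_degProj (i : ι) (r : ℕ) (x : Kos R σ ι) :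
    contract i (degProj (r + 1) x) = degProj r (contract i x) := by
  rw [← boundary_single, boundary_degProj]

lemma degProj_parity (r : ℕ) (x : Kos R σ ι) : degProj r (parity x) = (-1 : R) ^ r • degProj r x := by
  induction x using kos_induction generalizing r with
  | h_pol p =>
    cases r with
    | zero => rw [parity_pol, pow_zero, one_smul]
    | succ r => rw [parity_pol, degProj_succ_pol, smul_zero]
  | h_add x y hx hy => simp only [map_add, hx, hy, smul_add]
  | h_gen i x hx =>
    rw [parity_mul, parity_gen, kos_neg_mul, map_neg]
    cases r with
    | zero => rw [degProj_zero_gen_mul, degProj_zero_gen_mul, neg_zero, smul_zero]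
    | succ r =>
      rw [degProj_succ_gen_mul, degProj_succ_gen_mul, hx, pow_succ, mul_neg_one, kos_neg_smul,
        mul_smul_comm]

lemma parity_degProj (r : ℕ) (x : Kos R σ ι) : parity (degProj r x) = (-1 : R) ^ r • degProj r x := by
  induction x using kos_induction generalizing r with
  | h_pol p =>
    cases r with
    | zero => rw [degProj_zero_pol, parity_pol, pow_zero, one_smul]
    | succ r => rw [degProj_succ_pol, map_zero, smul_zero]
  | h_add x y hx hy => simp only [map_add, hx, hy, smul_add]
  | h_gen i x hx =>
    cases r with
    | zero => rw [degProj_zero_gen_mul, map_zero, smul_zero]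
    | succ r =>
      rw [degProj_succ_gen_mul, parity_mul, hx, parity_gen, pow_succ, mul_neg_one, kos_neg_smul,
        kos_neg_mul, mul_smul_comm]

lemma degProj_hom (u : MvPolynomial σ R →ₐ[R] MvPolynomial τ R) (A : ι → κ → MvPolynomial τ R)
    (r : ℕ) (x : Kos R σ ι) : degProj r (hom u A x) = hom u A (degProj r x) := by
  have hv : ∀ (v : κ → MvPolynomial τ R) (r : ℕ) (x : Kos R τ κ),
      degProj (r + 1) (vec v * x) = vec v * degProj r x := by
    intro v r x
    simp only [vec, Finset.sum_mul, map_sum, mul_assoc, degProj_pol_mul, degProj_succ_gen_mul]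
  have hv0 : ∀ (v : κ → MvPolynomial τ R) (x : Kos R τ κ), degProj 0 (vec v * x) = 0 := by
    intro v x
    simp only [vec, Finset.sum_mul, map_sum, mul_assoc, degProj_pol_mul, degProj_zero_gen_mul,
      mul_zero, Finset.sum_const_zero]
  induction x using kos_induction generalizing r with
  | h_pol p =>
    cases r with
    | zero => rw [hom_pol, degProj_zero_pol, degProj_zero_pol, hom_pol]
    | succ r => rw [hom_pol, degProj_succ_pol, degProj_succ_pol, map_zero]
  | h_add x y hx hy => simp only [map_add, hx, hy]
  | h_gen i x hx =>
    cases r with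
    | zero => rw [map_mul, hom_gen, hv0, degProj_zero_gen_mul, map_zero]
    | succ r => rw [map_mul, hom_gen, hv, hx, degProj_succ_gen_mul, map_mul, hom_gen]

lemma degProj_vec_mul (v : ι → MvPolynomial σ R) (r : ℕ) (x : Kos R σ ι) :
    degProj (r + 1) (vec v * x) = vec v * degProj r x := by
  simp only [vec, Finset.sum_mul, map_sum, mul_assoc, degProj_pol_mul, degProj_succ_gen_mul]

lemma degProj_mem (r : ℕ) (x : Kos R σ ι) : degProj r x ∈ degreePart R σ ι r := by
  induction x using TensorProduct.induction_on with
  | zero => rw [map_zero]; exact Submodule.zero_mem _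
  | add x y hx hy => rw [map_add]; exact Submodule.add_mem _ hx hy
  | tmul q a =>
    exact ⟨q ⊗ₜ DirectSum.decompose (fun i : ℕ => ⋀[R]^i (ι → R)) a r, rfl⟩

lemma degProj_of_mem {r : ℕ} {x : Kos R σ ι} (hx : x ∈ degreePart R σ ι r) (k : ℕ) :
    degProj k x = if k = r then x else 0 := by
  obtain ⟨y, rfl⟩ := hx
  induction y using TensorProduct.induction_on with
  | zero => simp
  | add x y hx hy => rw [map_add, map_add, hx, hy]; split_ifs <;> simp
  | tmul q a =>
    rw [LinearMap.lTensor_tmul, degProj, LinearMap.lTensor_tmul]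
    split_ifs with h
    · subst h
      exact congrArg _ (DirectSum.decompose_of_mem_same (fun i : ℕ => ⋀[R]^i (ι → R)) a.2)
    · rw [← TensorProduct.tmul_zero _ q]
      exact congrArg _ (DirectSum.decompose_of_mem_ne (fun i : ℕ => ⋀[R]^i (ι → R)) a.2 (Ne.symm h))

/-- The dual grading is defined by annihilators. This makes it accessible through projections: a
functional lies in `dualDegreePart R σ ι r` exactly when it factors through `degProj r`
(`apply_degProj_of_mem`, `comp_degProj_mem`). -/
lemma sub_degProj_mem (r : ℕ) (x : Kos R σ ι) :
    x - degProj r x ∈ ⨆ r' : {k : ℕ // k ≠ r}, degreePart R σ ι r' := by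
  induction x using TensorProduct.induction_on with
  | zero => rw [map_zero, sub_zero]; exact Submodule.zero_mem _
  | add x y hx hy => rw [map_add, add_sub_add_comm]; exact Submodule.add_mem _ hx hy
  | tmul q a =>
    induction a using DirectSum.Decomposition.inductionOn (fun i : ℕ => ⋀[R]^i (ι → R)) with
    | zero => rw [TensorProduct.tmul_zero, map_zero, sub_zero]; exact Submodule.zero_mem _
    | add x y hx hy =>
      rw [TensorProduct.tmul_add, map_add, add_sub_add_comm]; exact Submodule.add_mem _ hx hy
    | @homogeneous i a =>
      have ha : q ⊗ₜ[R] (a : ExteriorAlgebra R (ι → R)) ∈ degreePart R σ ι i := ⟨q ⊗ₜ a, rfl⟩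
      rw [degProj_of_mem ha]
      split_ifs with h
      · rw [sub_self]; exact Submodule.zero_mem _
      · rw [sub_zero]
        exact Submodule.mem_iSup_of_mem (⟨i, Ne.symm h⟩ : {k : ℕ // k ≠ r}) ha

lemma apply_degProj_of_mem {r : ℕ} {c : Module.Dual R (Kos R σ ι)}
    (hc : c ∈ dualDegreePart R σ ι r) (x : Kos R σ ι) : c (degProj r x) = c x := by
  have := (Submodule.mem_dualAnnihilator _).mp hc _ (sub_degProj_mem r x)
  rw [map_sub, sub_eq_zero] at this
  exact this.symm

lemma comp_degProj_mem (r : ℕ) (c : Module.Dual R (Kos R σ ι)) :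
    c ∘ₗ degProj r ∈ dualDegreePart R σ ι r := by
  refine (Submodule.mem_dualAnnihilator _).mpr fun x hx => ?_
  have : (⨆ r' : {k : ℕ // k ≠ r}, degreePart R σ ι r') ≤ LinearMap.ker (c ∘ₗ degProj r) := by
    refine iSup_le fun k x hx => ?_
    rw [LinearMap.mem_ker, LinearMap.comp_apply, degProj_of_mem hx, if_neg k.2.symm, map_zero]
  exact this hx

end Hom


/-! ### Splitting the algebra in two sets of variables into a tensor product. -/

section Split

set_option linter.unusedSectionVars false

variable {R : Type*} [CommRing R] {σ τ ι κ : Type}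
variable [Fintype ι] [DecidableEq ι] [Fintype κ] [DecidableEq κ]

/-! ### Splitting the variables -/

lemma tensorTensorTensorComm_map {M N P Q : Type*} [AddCommGroup M] [AddCommGroup N]
    [AddCommGroup P] [AddCommGroup Q] [Module R M] [Module R N] [Module R P] [Module R Q]
    (f : M →ₗ[R] M) (f' : N →ₗ[R] N) (g : P →ₗ[R] P) (g' : Q →ₗ[R] Q)
    (x : M ⊗[R] N) (y : P ⊗[R] Q) :
    TensorProduct.tensorTensorTensorComm R M N P Q
      (TensorProduct.map f f' x ⊗ₜ TensorProduct.map g g' y) =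
    TensorProduct.map (TensorProduct.map f g) (TensorProduct.map f' g')
      (TensorProduct.tensorTensorTensorComm R M N P Q (x ⊗ₜ y)) := by
  induction x using TensorProduct.induction_on with
  | zero => simp only [TensorProduct.zero_tmul, map_zero]
  | add x y hx hy => simp only [TensorProduct.add_tmul, map_add, hx, hy]
  | tmul p q =>
    induction y using TensorProduct.induction_on with
    | zero => simp only [TensorProduct.tmul_zero, map_zero]
    | add x y hx hy => simp only [TensorProduct.tmul_add, map_add, hx, hy]
    | tmul x y => simp only [TensorProduct.map_tmul, TensorProduct.tensorTensorTensorComm_tmul]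

lemma map_id_mulLeft_ι (i : ι) :
    TensorProduct.map LinearMap.id (LinearMap.mulLeft R (ExteriorAlgebra.ι R (Pi.single i 1))) =
      LinearMap.mulLeft R (gen i : Kos R σ ι) :=
  TensorProduct.ext' fun q a => (gen_mul_tmul i q a).symm

lemma map_mulLeft_id (p : MvPolynomial σ R) :
    TensorProduct.map (LinearMap.mulLeft R p) LinearMap.id =
      LinearMap.mulLeft R (pol p : Kos R σ ι) :=
  TensorProduct.ext' fun q a => (pol_mul_tmul p q a).symm

lemma gradedTensor_tmul_one_mul (a : ExteriorAlgebra R (ι → R))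
    (X : ExteriorAlgebra R (ι → R) ⊗[R] ExteriorAlgebra R (κ → R)) :
    (GradedTensorProduct.of R (CliffordAlgebra.evenOdd (0 : QuadraticForm R (ι → R)))
      (CliffordAlgebra.evenOdd (0 : QuadraticForm R (κ → R)))).symm
      (GradedTensorProduct.of R _ _ (a ⊗ₜ 1) * GradedTensorProduct.of R _ _ X) =
    LinearMap.rTensor _ (LinearMap.mulLeft R a) X := by
  induction X using TensorProduct.induction_on with
  | zero => rw [map_zero, mul_zero, map_zero, map_zero]
  | add x y hx hy => rw [map_add, mul_add, map_add, hx, hy, map_add]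
  | tmul x y =>
    induction x using DirectSum.Decomposition.inductionOn
      (CliffordAlgebra.evenOdd (0 : QuadraticForm R (ι → R))) with
    | zero => rw [TensorProduct.zero_tmul, map_zero, mul_zero, map_zero, map_zero]
    | add x y hx hy => rw [TensorProduct.add_tmul, map_add, mul_add, map_add, hx, hy, map_add]
    | homogeneous x =>
      exact congrArg (GradedTensorProduct.of R _ _).symm
        (GradedTensorProduct.tmul_one_mul_coe_tmul _ _ _ _ _)

/-- An odd generator of the right factor has to cross the left factor, which costs the sign
`involute`; a left factor, as in `gradedTensor_tmul_one_mul`, crosses nothing. -/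
lemma gradedTensor_one_tmul_ι_mul (m : κ → R)
    (X : ExteriorAlgebra R (ι → R) ⊗[R] ExteriorAlgebra R (κ → R)) :
    (GradedTensorProduct.of R (CliffordAlgebra.evenOdd (0 : QuadraticForm R (ι → R)))
      (CliffordAlgebra.evenOdd (0 : QuadraticForm R (κ → R)))).symm
      (GradedTensorProduct.of R _ _ (1 ⊗ₜ CliffordAlgebra.ι _ m) *
        GradedTensorProduct.of R _ _ X) =
    TensorProduct.map
      (CliffordAlgebra.involute (Q := (0 : QuadraticForm R (ι → R)))).toLinearMap
      (LinearMap.mulLeft R (ExteriorAlgebra.ι R m)) X := by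
  induction X using TensorProduct.induction_on with
  | zero => rw [map_zero, mul_zero, map_zero, map_zero]
  | add x y hx hy => rw [map_add, mul_add, map_add, hx, hy, map_add]
  | tmul x y =>
    induction x using DirectSum.Decomposition.inductionOn
      (CliffordAlgebra.evenOdd (0 : QuadraticForm R (ι → R))) with
    | zero => rw [TensorProduct.zero_tmul, map_zero, mul_zero, map_zero, map_zero]
    | add x y hx hy => rw [TensorProduct.add_tmul, map_add, mul_add, map_add, hx, hy, map_add]
    | @homogeneous i x =>
      have hi : ∀ i : ZMod 2, i = 0 ∨ i = 1 := by decide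
      rcases hi i with rfl | rfl
      · have h := GradedTensorProduct.tmul_coe_mul_zero_coe_tmul
          (CliffordAlgebra.evenOdd (0 : QuadraticForm R (ι → R)))
          (CliffordAlgebra.evenOdd (0 : QuadraticForm R (κ → R))) 1
          (⟨CliffordAlgebra.ι _ m, CliffordAlgebra.ι_mem_evenOdd_one _ m⟩ :
            CliffordAlgebra.evenOdd (0 : QuadraticForm R (κ → R)) 1) x y
        rw [one_mul] at h
        refine (congrArg (GradedTensorProduct.of R _ _).symm h).trans ?_
        rw [TensorProduct.map_tmul]
        exact congrArg (fun z => z ⊗ₜ[R] _)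
          (CliffordAlgebra.involute_eq_of_mem_even x.2).symm
      · have h := GradedTensorProduct.tmul_coe_mul_coe_tmul
          (CliffordAlgebra.evenOdd (0 : QuadraticForm R (ι → R)))
          (CliffordAlgebra.evenOdd (0 : QuadraticForm R (κ → R))) 1
          (⟨CliffordAlgebra.ι _ m, CliffordAlgebra.ι_mem_evenOdd_one _ m⟩ :
            CliffordAlgebra.evenOdd (0 : QuadraticForm R (κ → R)) 1) x y
        rw [one_mul, one_mul, uzpow_one, Units.neg_smul, one_smul] at h
        refine (congrArg (GradedTensorProduct.of R _ _).symm h).trans ?_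
        rw [TensorProduct.map_tmul, map_neg]
        refine (TensorProduct.neg_tmul _ _).symm.trans ?_
        exact congrArg (fun z => z ⊗ₜ[R] _)
          (CliffordAlgebra.involute_eq_of_mem_odd x.2).symm

lemma splitExt_one : splitExt (R := R) ι κ 1 = 1 ⊗ₜ 1 := by
  simp only [splitExt, LinearMap.comp_apply, AlgHom.toLinearMap_apply, map_one]
  rfl

lemma splitExt_ι_inl_mul (i : ι) (a : ExteriorAlgebra R (ι ⊕ κ → R)) :
    splitExt ι κ (ExteriorAlgebra.ι R (Pi.single (Sum.inl i) 1) * a) =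
      LinearMap.rTensor _ (LinearMap.mulLeft R (ExteriorAlgebra.ι R (Pi.single i 1)))
        (splitExt ι κ a) := by
  rw [← gradedTensor_tmul_one_mul]
  simp only [splitExt, LinearMap.comp_apply, AlgHom.toLinearMap_apply, map_mul,
    LinearEquiv.coe_coe, GradedTensorProduct.symm_of_of]
  congr 2
  refine (congrArg _ (CliffordAlgebra.map_apply_ι _ _)).trans ?_
  have h : (LinearEquiv.sumArrowLequivProdArrow ι κ R R) (Pi.single (Sum.inl i) 1) =
      (Pi.single i 1, 0) := by
    ext j
    · by_cases hj : j = i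
      · subst hj; simp
      · simp [hj]
    · simp
  refine (congrArg (fun z => CliffordAlgebra.ofProd _ _ (CliffordAlgebra.ι _ z)) h).trans ?_
  rw [CliffordAlgebra.ofProd_ι_mk, map_zero, GradedTensorProduct.tmul, GradedTensorProduct.tmul,
    TensorProduct.tmul_zero, map_zero, add_zero]

lemma splitExt_ι_inr_mul (i : κ) (a : ExteriorAlgebra R (ι ⊕ κ → R)) :
    splitExt ι κ (ExteriorAlgebra.ι R (Pi.single (Sum.inr i) 1) * a) =
      TensorProduct.map
        (CliffordAlgebra.involute (Q := (0 : QuadraticForm R (ι → R)))).toLinearMap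
        (LinearMap.mulLeft R (ExteriorAlgebra.ι R (Pi.single i 1))) (splitExt ι κ a) := by
  rw [← gradedTensor_one_tmul_ι_mul]
  simp only [splitExt, LinearMap.comp_apply, AlgHom.toLinearMap_apply, map_mul,
    LinearEquiv.coe_coe, GradedTensorProduct.symm_of_of]
  congr 2
  refine (congrArg _ (CliffordAlgebra.map_apply_ι _ _)).trans ?_
  have h : (LinearEquiv.sumArrowLequivProdArrow ι κ R R) (Pi.single (Sum.inr i) 1) =
      (0, Pi.single i 1) := by
    ext j
    · simp
    · by_cases hj : j = i
      · subst hj; simp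
      · simp [hj]
  refine (congrArg (fun z => CliffordAlgebra.ofProd _ _ (CliffordAlgebra.ι _ z)) h).trans ?_
  rw [CliffordAlgebra.ofProd_ι_mk, map_zero, GradedTensorProduct.tmul, GradedTensorProduct.tmul,
    TensorProduct.zero_tmul, map_zero, zero_add]

lemma split_tmul (p : MvPolynomial (σ ⊕ τ) R) (a : ExteriorAlgebra R (ι ⊕ κ → R)) :
    split σ τ ι κ (p ⊗ₜ a) =
      TensorProduct.tensorTensorTensorComm R _ _ _ _ (splitPoly (R := R) σ τ p ⊗ₜ splitExt ι κ a) := rfl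

lemma split_gen_inl_mul (i : ι) (w : Kos R (σ ⊕ τ) (ι ⊕ κ)) :
    split σ τ ι κ (gen (Sum.inl i) * w) =
      LinearMap.rTensor _ (LinearMap.mulLeft R (gen i : Kos R σ ι)) (split σ τ ι κ w) := by
  induction w using TensorProduct.induction_on with
  | zero => simp
  | add x y hx hy => rw [mul_add, map_add, hx, hy, map_add, map_add]
  | tmul q a =>
    rw [gen_mul_tmul, split_tmul, split_tmul, splitExt_ι_inl_mul]
    have h := tensorTensorTensorComm_map LinearMap.id LinearMap.id
      (LinearMap.mulLeft R (ExteriorAlgebra.ι R (Pi.single i 1))) LinearMap.id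
      (splitPoly (R := R) σ τ q) (splitExt ι κ a)
    rw [map_id_mulLeft_ι, TensorProduct.map_id, TensorProduct.map_id, LinearMap.id_apply] at h
    exact h

lemma split_gen_inr_mul (i : κ) (w : Kos R (σ ⊕ τ) (ι ⊕ κ)) :
    split σ τ ι κ (gen (Sum.inr i) * w) =
      TensorProduct.map parity (LinearMap.mulLeft R (gen i : Kos R τ κ)) (split σ τ ι κ w) := by
  induction w using TensorProduct.induction_on with
  | zero => simp
  | add x y hx hy => rw [mul_add, map_add, hx, hy, map_add, map_add]
  | tmul q a =>
    rw [gen_mul_tmul, split_tmul, split_tmul, splitExt_ι_inr_mul]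
    have h := tensorTensorTensorComm_map LinearMap.id LinearMap.id
      (CliffordAlgebra.involute (Q := (0 : QuadraticForm R (ι → R)))).toLinearMap
      (LinearMap.mulLeft R (ExteriorAlgebra.ι R (Pi.single i 1)))
      (splitPoly (R := R) σ τ q) (splitExt ι κ a)
    rw [map_id_mulLeft_ι, TensorProduct.map_id, LinearMap.id_apply] at h
    exact h

lemma splitPoly_rename_inl (p : MvPolynomial σ R) :
    splitPoly (R := R) σ τ (MvPolynomial.rename Sum.inl p) = p ⊗ₜ[R] 1 := by
  have : (splitPoly (R := R) σ τ).comp (MvPolynomial.rename Sum.inl) =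
      Algebra.TensorProduct.includeLeft := by
    ext i; simp [splitPoly]
  exact AlgHom.congr_fun this p

lemma splitPoly_rename_inr (p : MvPolynomial τ R) :
    splitPoly (R := R) σ τ (MvPolynomial.rename Sum.inr p) = 1 ⊗ₜ[R] p := by
  have : (splitPoly (R := R) σ τ).comp (MvPolynomial.rename Sum.inr) =
      Algebra.TensorProduct.includeRight := by
    ext i; simp [splitPoly]
  exact AlgHom.congr_fun this p

lemma split_pol_inl_mul (p : MvPolynomial σ R) (w : Kos R (σ ⊕ τ) (ι ⊕ κ)) :
    split σ τ ι κ (pol (MvPolynomial.rename Sum.inl p) * w) =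
      LinearMap.rTensor _ (LinearMap.mulLeft R (pol p : Kos R σ ι)) (split σ τ ι κ w) := by
  induction w using TensorProduct.induction_on with
  | zero => simp
  | add x y hx hy => rw [mul_add, map_add, hx, hy, map_add, map_add]
  | tmul q a =>
    rw [pol_mul_tmul, split_tmul, split_tmul, map_mul, splitPoly_rename_inl]
    have h := tensorTensorTensorComm_map (LinearMap.mulLeft R p) LinearMap.id LinearMap.id
      LinearMap.id (splitPoly (R := R) σ τ q) (splitExt ι κ a)
    rw [map_mulLeft_id, TensorProduct.map_id, TensorProduct.map_id, LinearMap.id_apply] at h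
    rw [← LinearMap.rTensor_def] at h
    refine Eq.trans ?_ h
    congr 2
    generalize splitPoly (R := R) σ τ q = Q
    induction Q using TensorProduct.induction_on with
    | zero => simp
    | add x y hx hy => simp only [mul_add, map_add, hx, hy]
    | tmul p q => simp

lemma split_pol_inr (p : MvPolynomial τ R) :
    split σ τ ι κ (pol (MvPolynomial.rename Sum.inr p)) = 1 ⊗ₜ pol p := by
  rw [pol, split_tmul, splitExt_one, splitPoly_rename_inr]
  rfl

variable (R σ τ ι κ) in
/-- The embedding of the Koszul algebra in the first set of variables. -/
def inclX : Kos R σ ι →ₐ[R] Kos R (σ ⊕ τ) (ι ⊕ κ) := incl R Sum.inl Sum.inl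

variable (R σ τ ι κ) in
/-- The embedding of the Koszul algebra in the second set of variables. -/
def inclY : Kos R τ κ →ₐ[R] Kos R (σ ⊕ τ) (ι ⊕ κ) := incl R Sum.inr Sum.inr

lemma split_inclX_mul (x : Kos R σ ι) (w : Kos R (σ ⊕ τ) (ι ⊕ κ)) :
    split σ τ ι κ (inclX R σ τ ι κ x * w) =
      LinearMap.rTensor _ (LinearMap.mulLeft R x) (split σ τ ι κ w) := by
  induction x using kos_induction generalizing w with
  | h_pol p => rw [inclX, incl_pol, split_pol_inl_mul]
  | h_add x y hx hy =>
    have h : LinearMap.mulLeft R (x + y) = LinearMap.mulLeft R x + LinearMap.mulLeft R y :=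
      LinearMap.ext fun z => by simp only [LinearMap.mulLeft_apply, LinearMap.add_apply, add_mul]
    rw [map_add, add_mul, map_add, hx, hy, h, LinearMap.rTensor_add, LinearMap.add_apply]
  | h_gen i x hx =>
    rw [map_mul (inclX R σ τ ι κ), mul_assoc, inclX, incl_gen, split_gen_inl_mul, ← inclX, hx,
      LinearMap.mulLeft_mul, LinearMap.rTensor_comp, LinearMap.comp_apply]

lemma split_inclY (y : Kos R τ κ) : split σ τ ι κ (inclY R σ τ ι κ y) = 1 ⊗ₜ y := by
  induction y using kos_induction with
  | h_pol p => rw [inclY, incl_pol, split_pol_inr]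
  | h_add x y hx hy => rw [map_add, map_add, hx, hy, TensorProduct.tmul_add]
  | h_gen i x hx =>
    rw [map_mul (inclY R σ τ ι κ), inclY, incl_gen, split_gen_inr_mul, ← inclY, hx, TensorProduct.map_tmul,
      parity_one]
    rfl

/-- Together with `kos_sum_induction` this determines `split`; the rules for slant products are
derived from these two alone, without returning to the graded tensor product. -/
lemma split_inclX_mul_inclY (x : Kos R σ ι) (y : Kos R τ κ) :
    split σ τ ι κ (inclX R σ τ ι κ x * inclY R σ τ ι κ y) = x ⊗ₜ y := by
  rw [split_inclX_mul, split_inclY, LinearMap.rTensor_tmul, LinearMap.mulLeft_apply, mul_one]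

lemma gen_mul_eq (i : ι) (x : Kos R σ ι) : gen i * x = parity x * gen i := by
  rw [mul_gen, parity_parity]

/-- The Koszul algebra in two sets of variables is spanned by the products. -/
theorem kos_sum_induction {P : Kos R (σ ⊕ τ) (ι ⊕ κ) → Prop}
    (h_mul : ∀ x y, P (inclX R σ τ ι κ x * inclY R σ τ ι κ y))
    (h_add : ∀ x y, P x → P y → P (x + y)) (w : Kos R (σ ⊕ τ) (ι ⊕ κ)) : P w := by
  let S : Submodule R (Kos R (σ ⊕ τ) (ι ⊕ κ)) := Submodule.span R
    (Set.range fun z : Kos R σ ι × Kos R τ κ => inclX R σ τ ι κ z.1 * inclY R σ τ ι κ z.2)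
  have hS : ∀ x y, inclX R σ τ ι κ x * inclY R σ τ ι κ y ∈ S := fun x y =>
    Submodule.subset_span ⟨(x, y), rfl⟩
  have h_left : ∀ (x : Kos R σ ι) (w), w ∈ S → inclX R σ τ ι κ x * w ∈ S := by
    intro x w hw
    induction hw using Submodule.span_induction with
    | mem w hw =>
      obtain ⟨z, rfl⟩ := hw
      rw [← mul_assoc, ← map_mul]
      exact hS _ _
    | zero => rw [mul_zero]; exact S.zero_mem
    | add x y _ _ hx hy => rw [mul_add]; exact S.add_mem hx hy
    | smul r x _ hx => rw [mul_smul_comm]; exact S.smul_mem r hx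
  have h_pol_right : ∀ (p : MvPolynomial τ R) (w), w ∈ S → inclY R σ τ ι κ (pol p) * w ∈ S := by
    intro p w hw
    induction hw using Submodule.span_induction with
    | mem w hw =>
      obtain ⟨z, rfl⟩ := hw
      rw [inclY, incl_pol, ← pol_mul_left_comm, ← incl_pol Sum.inr Sum.inr, ← map_mul]
      exact hS _ _
    | zero => rw [mul_zero]; exact S.zero_mem
    | add x y _ _ hx hy => rw [mul_add]; exact S.add_mem hx hy
    | smul r x _ hx => rw [mul_smul_comm]; exact S.smul_mem r hx
  have h_gen_right : ∀ (i : κ) (w), w ∈ S → gen (Sum.inr i) * w ∈ S := by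
    intro p w hw
    induction hw using Submodule.span_induction with
    | mem w hw =>
      obtain ⟨z, rfl⟩ := hw
      rw [← mul_assoc, gen_mul_eq, inclX, ← incl_parity, mul_assoc, inclY,
        ← incl_gen Sum.inr Sum.inr, ← map_mul]
      exact hS _ _
    | zero => rw [mul_zero]; exact S.zero_mem
    | add x y _ _ hx hy => rw [mul_add]; exact S.add_mem hx hy
    | smul r x _ hx => rw [mul_smul_comm]; exact S.smul_mem r hx
  have hw : w ∈ S := by
    induction w using kos_induction with
    | h_pol p =>
      induction p using MvPolynomial.induction_on with
      | C r =>
        have : (pol (MvPolynomial.C r) : Kos R (σ ⊕ τ) (ι ⊕ κ)) =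
            inclX R σ τ ι κ (pol (MvPolynomial.C r)) * inclY R σ τ ι κ 1 := by
          rw [map_one, mul_one, inclX, incl_pol, MvPolynomial.rename_C]
        rw [this]
        exact hS _ _
      | add p q hp hq => rw [pol_add]; exact S.add_mem hp hq
      | mul_X p i hp =>
        rw [mul_comm, pol_mul]
        cases i with
        | inl i =>
          have := h_left (pol (MvPolynomial.X i)) _ hp
          rwa [inclX, incl_pol, MvPolynomial.rename_X] at this
        | inr i =>
          have := h_pol_right (MvPolynomial.X i) _ hp
          rwa [inclY, incl_pol, MvPolynomial.rename_X] at this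
    | h_add x y hx hy => exact S.add_mem hx hy
    | h_gen i x hx =>
      cases i with
      | inl i =>
        have := h_left (gen i) _ hx
        rwa [inclX, incl_gen] at this
      | inr i => exact h_gen_right i _ hx
  have h0 : P 0 := by simpa using h_mul 0 0
  clear h_left h_pol_right h_gen_right hS
  -- `P` is assumed stable only under sums. A scalar is absorbed into the first factor of a product,
  -- so the induction carries `P (r • w)` along for all `r`.
  have hP : ∀ (r : R) w, w ∈ S → P w ∧ P (r • w) := by
    intro r w hw
    induction hw using Submodule.span_induction generalizing r with
    | mem w hw =>
      obtain ⟨z, rfl⟩ := hw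
      refine ⟨h_mul _ _, ?_⟩
      rw [← smul_mul_assoc, ← map_smul]
      exact h_mul _ _
    | zero => rw [smul_zero]; exact ⟨h0, h0⟩
    | add x y _ _ hx hy =>
      rw [smul_add]; exact ⟨h_add _ _ (hx r).1 (hy r).1, h_add _ _ (hx r).2 (hy r).2⟩
    | smul s x _ hx => rw [smul_smul]; exact ⟨(hx s).2, (hx (r * s)).2⟩
  exact (hP 1 w hw).1

/-! ### Slant products -/

/-- The map `a(x) b(y) ↦ g(b) a`. -/
def slantY (g : Module.Dual R (Kos R τ κ)) : Kos R (σ ⊕ τ) (ι ⊕ κ) →ₗ[R] Kos R σ ι :=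
  (TensorProduct.rid R _).toLinearMap ∘ₗ LinearMap.lTensor _ g ∘ₗ split σ τ ι κ

/-- The map `a(x) b(y) ↦ g(a) b`. -/
def slantX (g : Module.Dual R (Kos R σ ι)) : Kos R (σ ⊕ τ) (ι ⊕ κ) →ₗ[R] Kos R τ κ :=
  (TensorProduct.lid R _).toLinearMap ∘ₗ LinearMap.rTensor _ g ∘ₗ split σ τ ι κ

lemma slantY_mul (g : Module.Dual R (Kos R τ κ)) (x : Kos R σ ι) (y : Kos R τ κ) :
    slantY g (inclX R σ τ ι κ x * inclY R σ τ ι κ y) = g y • x := by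
  simp [slantY, split_inclX_mul_inclY]

lemma slantX_mul (g : Module.Dual R (Kos R σ ι)) (x : Kos R σ ι) (y : Kos R τ κ) :
    slantX g (inclX R σ τ ι κ x * inclY R σ τ ι κ y) = g x • y := by
  simp [slantX, split_inclX_mul_inclY]

end Split


/-! ### Slant products: evaluating a functional in one of the two sets of variables. -/

section Slant

set_option linter.unusedSectionVars false

variable {R : Type*} [CommRing R] {σ τ ι κ : Type}
variable [Fintype ι] [DecidableEq ι] [Fintype κ] [DecidableEq κ]

lemma hom_parityProj (u : MvPolynomial σ R →ₐ[R] MvPolynomial τ R) (A : ι → κ → MvPolynomial τ R)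
    (x : Kos R σ ι) :
    hom u A (parityProj 0 x) = parityProj 0 (hom u A x) ∧
      hom u A (parityProj 1 x) = parityProj 1 (hom u A x) := by
  have hv : ∀ (v : κ → MvPolynomial τ R) (x : Kos R τ κ),
      parityProj 0 (vec v * x) = vec v * parityProj 1 x ∧
        parityProj 1 (vec v * x) = vec v * parityProj 0 x := by
    intro v x
    simp only [vec, Finset.sum_mul, map_sum, mul_assoc, parityProj_pol_mul,
      parityProj_zero_gen_mul, parityProj_one_gen_mul, and_self]
  induction x using kos_induction with
  | h_pol p => simp only [hom_pol, parityProj_zero_pol, parityProj_one_pol, map_zero, and_self]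
  | h_add x y hx hy => simp only [map_add, hx.1, hx.2, hy.1, hy.2, and_self]
  | h_gen i x hx =>
    rw [parityProj_zero_gen_mul, parityProj_one_gen_mul, map_mul (hom u A), map_mul (hom u A),
      map_mul (hom u A), hom_gen, (hv _ _).1, (hv _ _).2, hx.1, hx.2]
    exact ⟨rfl, rfl⟩

lemma inclX_pol (p : MvPolynomial σ R) :
    inclX R σ τ ι κ (pol p) = pol (MvPolynomial.rename Sum.inl p) := incl_pol _ _ _

lemma inclY_pol (p : MvPolynomial τ R) :
    inclY R σ τ ι κ (pol p) = pol (MvPolynomial.rename Sum.inr p) := incl_pol _ _ _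

lemma inclX_gen (i : ι) : inclX R σ τ ι κ (gen i) = gen (Sum.inl i) := incl_gen _ _ _

lemma inclY_gen (i : κ) : inclY R σ τ ι κ (gen i) = gen (Sum.inr i) := incl_gen _ _ _

lemma inclX_parity (x : Kos R σ ι) :
    inclX R σ τ ι κ (parity x) = parity (inclX R σ τ ι κ x) := incl_parity _ _ _

lemma inclY_parity (x : Kos R τ κ) :
    inclY R σ τ ι κ (parity x) = parity (inclY R σ τ ι κ x) := incl_parity _ _ _

lemma inclY_parityProj_zero (x : Kos R τ κ) :
    inclY R σ τ ι κ (parityProj 0 x) = parityProj 0 (inclY R σ τ ι κ x) := (hom_parityProj _ _ x).1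

lemma inclY_parityProj_one (x : Kos R τ κ) :
    inclY R σ τ ι κ (parityProj 1 x) = parityProj 1 (inclY R σ τ ι κ x) := (hom_parityProj _ _ x).2

/-- The coefficients of the boundary operator of the tensor product of two Koszul complexes. -/
def sumCoeff (f : ι → MvPolynomial σ R) (g : κ → MvPolynomial τ R) :
    ι ⊕ κ → MvPolynomial (σ ⊕ τ) R :=
  Sum.elim (fun i => MvPolynomial.rename Sum.inl (f i)) fun i => MvPolynomial.rename Sum.inr (g i)

lemma boundary_inclX (f : ι → MvPolynomial σ R) (g : κ → MvPolynomial τ R) (x : Kos R σ ι) :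
    boundary (sumCoeff f g) (inclX R σ τ ι κ x) = inclX R σ τ ι κ (boundary f x) :=
  boundary_incl Sum.inl Sum.inl (sumCoeff f g) f (fun _ => rfl) x

lemma boundary_inclY (f : ι → MvPolynomial σ R) (g : κ → MvPolynomial τ R) (x : Kos R τ κ) :
    boundary (sumCoeff f g) (inclY R σ τ ι κ x) = inclY R σ τ ι κ (boundary g x) :=
  boundary_incl Sum.inr Sum.inr (sumCoeff f g) g (fun _ => rfl) x

/-! ### Contraction of the second set of variables -/

lemma slantY_inclX_mul (g : Module.Dual R (Kos R τ κ)) (a : Kos R σ ι)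
    (w : Kos R (σ ⊕ τ) (ι ⊕ κ)) :
    slantY g (inclX R σ τ ι κ a * w) = a * slantY g w := by
  induction w using kos_sum_induction with
  | h_add x y hx hy => rw [mul_add, map_add, map_add, mul_add, hx, hy]
  | h_mul x y => rw [← mul_assoc, ← map_mul, slantY_mul, slantY_mul, mul_smul_comm]

lemma slantY_mul_inclY (g : Module.Dual R (Kos R τ κ)) (b : Kos R τ κ)
    (w : Kos R (σ ⊕ τ) (ι ⊕ κ)) :
    slantY g (w * inclY R σ τ ι κ b) = slantY (g ∘ₗ LinearMap.mulRight R b) w := by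
  induction w using kos_sum_induction with
  | h_add x y hx hy => rw [add_mul, map_add, map_add, hx, hy]
  | h_mul x y =>
    rw [mul_assoc, ← map_mul, slantY_mul, slantY_mul]
    rfl

lemma slantY_parity (g : Module.Dual R (Kos R τ κ)) (w : Kos R (σ ⊕ τ) (ι ⊕ κ)) :
    slantY g (parity w) = parity (slantY (g ∘ₗ parity) w) := by
  induction w using kos_sum_induction with
  | h_add x y hx hy => simp only [map_add, hx, hy]
  | h_mul x y =>
    rw [parity_mul, ← inclX_parity, ← inclY_parity, slantY_mul, slantY_mul, map_smul]
    rfl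

/-- Leibniz rule for the total boundary. The boundary in the second variables passes the first
factor, whence `parity`; this term disappears when `c` vanishes on boundaries. -/
lemma boundary_slantY (f : ι → MvPolynomial σ R) (g : κ → MvPolynomial τ R)
    (c : Module.Dual R (Kos R τ κ)) (w : Kos R (σ ⊕ τ) (ι ⊕ κ)) :
    boundary f (slantY c w) =
      slantY c (boundary (sumCoeff f g) w) - parity (slantY (c ∘ₗ boundary g) w) := by
  induction w using kos_sum_induction with
  | h_add x y hx hy => simp only [map_add, hx, hy]; abel
  | h_mul x y =>
    rw [boundary_mul, boundary_inclX, boundary_inclY, ← inclX_parity, map_add, slantY_mul,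
      slantY_mul, slantY_mul, slantY_mul, map_smul, map_smul, LinearMap.comp_apply,
      add_sub_cancel_right]

lemma slantY_inclY_even_mul (g : Module.Dual R (Kos R τ κ)) (c : Kos R τ κ)
    (w : Kos R (σ ⊕ τ) (ι ⊕ κ)) :
    slantY g (inclY R σ τ ι κ (parityProj 0 c) * w) =
      slantY (g ∘ₗ LinearMap.mulLeft R (parityProj 0 c)) w := by
  induction w using kos_sum_induction with
  | h_add x y hx hy => rw [mul_add, map_add, map_add, hx, hy]
  | h_mul x y =>
    rw [← mul_assoc, inclY_parityProj_zero, parityProj_zero_mul_comm, ← inclY_parityProj_zero,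
      mul_assoc, ← map_mul, slantY_mul, slantY_mul]
    rfl

lemma slantY_inclY_odd_mul (g : Module.Dual R (Kos R τ κ)) (c : Kos R τ κ)
    (w : Kos R (σ ⊕ τ) (ι ⊕ κ)) :
    slantY g (inclY R σ τ ι κ (parityProj 1 c) * w) =
      parity (slantY (g ∘ₗ LinearMap.mulLeft R (parityProj 1 c)) w) := by
  induction w using kos_sum_induction with
  | h_add x y hx hy => simp only [mul_add, map_add, hx, hy]
  | h_mul x y =>
    rw [← mul_assoc, inclY_parityProj_one, parityProj_one_mul_comm, ← inclY_parityProj_one,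
      mul_assoc, ← map_mul, ← inclX_parity, slantY_mul, slantY_mul, map_smul]
    rfl

lemma slantY_comp_contract (g : Module.Dual R (Kos R τ κ)) (i : κ) (w : Kos R (σ ⊕ τ) (ι ⊕ κ)) :
    slantY (g ∘ₗ contract i) w = parity (slantY g (contract (Sum.inr i) w)) := by
  induction w using kos_sum_induction with
  | h_add x y hx hy => simp only [map_add, hx, hy]
  | h_mul x y =>
    rw [contract_mul, inclX, contract_incl_of_notMem _ _ _ (by simp), ← inclX, zero_mul, zero_add,
      inclY, contract_incl _ _ Sum.inr_injective, ← inclY, ← inclX_parity, slantY_mul, slantY_mul,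
      map_smul, parity_parity]
    rfl

lemma degProj_inclY (r : ℕ) (x : Kos R τ κ) :
    degProj r (inclY R σ τ ι κ x) = inclY R σ τ ι κ (degProj r x) := degProj_hom _ _ _ _

lemma degProj_degProj_of_ne {i j : ℕ} (h : i ≠ j) (x : Kos R σ ι) :
    degProj i (degProj j x) = 0 := by
  rw [degProj_of_mem (degProj_mem j x), if_neg h]

lemma degProj_degProj_self (i : ℕ) (x : Kos R σ ι) :
    degProj i (degProj i x) = degProj i x := by
  rw [degProj_of_mem (degProj_mem i x), if_pos rfl]

/-- A count of bidegrees: the functional sees only degree `m` in the second variables, so a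
component of total degree at most `m` contributes only if its total degree is `m` and its degree in
the first variables is zero. All `k ≤ m` are admitted because removing a generator of the first set
lowers `k` while `m` stays. -/
lemma slantY_degProj_mul (g : Module.Dual R (Kos R τ κ)) (m k : ℕ) (hk : k ≤ m) (x : Kos R σ ι)
    (y : Kos R τ κ) :
    slantY (g ∘ₗ degProj m) (degProj k (inclX R σ τ ι κ x * inclY R σ τ ι κ y)) =
      if k = m then g (degProj m y) • degProj 0 x else 0 := by
  induction x using kos_induction generalizing k with
  | h_pol p =>
    rw [inclX_pol, degProj_pol_mul, ← inclX_pol, degProj_inclY, slantY_mul, LinearMap.comp_apply,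
      degProj_zero_pol]
    split_ifs with h
    · rw [h, degProj_degProj_self]
    · rw [degProj_degProj_of_ne (Ne.symm h), map_zero, zero_smul]
  | h_add x x' hx hx' =>
    rw [map_add, add_mul, map_add, map_add, hx k hk, hx' k hk]
    split_ifs
    · rw [map_add, smul_add]
    · rw [add_zero]
  | h_gen i x hx =>
    rw [degProj_zero_gen_mul, smul_zero, ite_self, map_mul (inclX R σ τ ι κ), inclX_gen, mul_assoc]
    cases k with
    | zero => rw [degProj_zero_gen_mul, map_zero]
    | succ k =>
      -- What remains has total degree `k < m`, where the slant product is zero.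
      rw [degProj_succ_gen_mul, ← inclX_gen, slantY_inclX_mul, hx k (by omega),
        if_neg (by omega), mul_zero]

lemma slantY_degProj (g : Module.Dual R (Kos R τ κ)) (m : ℕ) (w : Kos R (σ ⊕ τ) (ι ⊕ κ)) :
    slantY (g ∘ₗ degProj m) (degProj m w) = degProj 0 (slantY (g ∘ₗ degProj m) w) := by
  induction w using kos_sum_induction with
  | h_add x y hx hy => simp only [map_add, hx, hy]
  | h_mul x y =>
    rw [slantY_degProj_mul g m m le_rfl, if_pos rfl, slantY_mul, map_smul, LinearMap.comp_apply]

/-! ### Contraction of the first set of variables -/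

lemma slantX_inclX_mul (g : Module.Dual R (Kos R σ ι)) (a : Kos R σ ι)
    (w : Kos R (σ ⊕ τ) (ι ⊕ κ)) :
    slantX g (inclX R σ τ ι κ a * w) = slantX (g ∘ₗ LinearMap.mulLeft R a) w := by
  induction w using kos_sum_induction with
  | h_add x y hx hy => rw [mul_add, map_add, map_add, hx, hy]
  | h_mul x y =>
    rw [← mul_assoc, ← map_mul, slantX_mul, slantX_mul]
    rfl

lemma slantX_parity (g : Module.Dual R (Kos R σ ι)) (w : Kos R (σ ⊕ τ) (ι ⊕ κ)) :
    slantX g (parity w) = parity (slantX (g ∘ₗ parity) w) := by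
  induction w using kos_sum_induction with
  | h_add x y hx hy => simp only [map_add, hx, hy]
  | h_mul x y =>
    rw [parity_mul, ← inclX_parity, ← inclY_parity, slantX_mul, slantX_mul, map_smul]
    rfl

lemma slantX_boundary (f : ι → MvPolynomial σ R) (g : κ → MvPolynomial τ R)
    (c : Module.Dual R (Kos R σ ι)) (w : Kos R (σ ⊕ τ) (ι ⊕ κ)) :
    slantX c (boundary (sumCoeff f g) w) =
      slantX (c ∘ₗ boundary f) w + boundary g (slantX (c ∘ₗ parity) w) := by
  induction w using kos_sum_induction with
  | h_add x y hx hy => simp only [map_add, hx, hy]; abel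
  | h_mul x y =>
    rw [boundary_mul, boundary_inclX, boundary_inclY, ← inclX_parity, map_add, slantX_mul,
      slantX_mul, slantX_mul, slantX_mul, map_smul, LinearMap.comp_apply, LinearMap.comp_apply]

lemma slantX_inclY_even_mul (g : Module.Dual R (Kos R σ ι)) (b : Kos R τ κ)
    (w : Kos R (σ ⊕ τ) (ι ⊕ κ)) :
    slantX g (inclY R σ τ ι κ (parityProj 0 b) * w) = parityProj 0 b * slantX g w := by
  induction w using kos_sum_induction with
  | h_add x y hx hy => simp only [mul_add, map_add, hx, hy]
  | h_mul x y =>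
    rw [← mul_assoc, inclY_parityProj_zero, parityProj_zero_mul_comm, ← inclY_parityProj_zero,
      mul_assoc, ← map_mul, slantX_mul, slantX_mul, mul_smul_comm]

lemma slantX_inclY_odd_mul (g : Module.Dual R (Kos R σ ι)) (b : Kos R τ κ)
    (w : Kos R (σ ⊕ τ) (ι ⊕ κ)) :
    slantX g (inclY R σ τ ι κ (parityProj 1 b) * w) =
      parityProj 1 b * slantX (g ∘ₗ parity) w := by
  induction w using kos_sum_induction with
  | h_add x y hx hy => simp only [mul_add, map_add, hx, hy]
  | h_mul x y =>
    rw [← mul_assoc, inclY_parityProj_one, parityProj_one_mul_comm, ← inclY_parityProj_one,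
      mul_assoc, ← map_mul, ← inclX_parity, slantX_mul, slantX_mul, mul_smul_comm]
    rfl

/-- A Fubini rule: `e` and `c` are evaluated in separate variables, so the order does not matter. It
turns `e·𝒥(c)` into `c` applied to an operator on the complex. -/
lemma apply_slantY_mul (e : Module.Dual R (Kos R σ ι)) (c : Module.Dual R (Kos R τ κ))
    (b : Kos R σ ι) (w : Kos R (σ ⊕ τ) (ι ⊕ κ)) :
    e (slantY c w * b) = c (slantX (e ∘ₗ LinearMap.mulRight R b) w) := by
  induction w using kos_sum_induction with
  | h_add x y hx hy => simp only [add_mul, map_add, hx, hy]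
  | h_mul x y =>
    rw [slantY_mul, slantX_mul, smul_mul_assoc, map_smul, map_smul, smul_eq_mul, smul_eq_mul,
      mul_comm]
    rfl

lemma jMap_apply {n s : ℕ} (D : Fin s → Fin n → MvPolynomial (Fin n ⊕ Fin n) R)
    (c : Module.Dual R (Kos R (Fin n) (Fin s))) :
    jMap D c = slantY (c ∘ₗ parity) (jacobian D) := rfl

end Slant


/-! ### Divided differences and the contraction onto the diagonal. -/

section Homotopy

set_option linter.unusedSectionVars false

variable {R : Type*} [CommRing R] {σ τ ι κ : Type}
variable [Fintype ι] [DecidableEq ι] [Fintype κ] [DecidableEq κ]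

/-! ### Divided differences -/

/-- The substitution `X b ↦ X a`. -/
def substVar [DecidableEq τ] (a b : τ) : MvPolynomial τ R →ₐ[R] MvPolynomial τ R :=
  MvPolynomial.aeval (Function.update MvPolynomial.X b (MvPolynomial.X a))

lemma substVar_X_same [DecidableEq τ] (a b : τ) :
    substVar (R := R) a b (MvPolynomial.X b) = MvPolynomial.X a := by
  rw [substVar, MvPolynomial.aeval_X, Function.update_self]

lemma substVar_X_of_ne [DecidableEq τ] {a b c : τ} (h : c ≠ b) :
    substVar (R := R) a b (MvPolynomial.X c) = MvPolynomial.X c := by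
  rw [substVar, MvPolynomial.aeval_X, Function.update_of_ne h]

/-- `φ` is an involutive automorphism exchanging `X b` and `X a - X b`, and the variable `X b` is
regular over every ring. -/
lemma X_sub_X_cancel [DecidableEq τ] {a b : τ} (h : a ≠ b) {p q : MvPolynomial τ R}
    (hpq : (MvPolynomial.X a - MvPolynomial.X b) * p = (MvPolynomial.X a - MvPolynomial.X b) * q) :
    p = q := by
  let φ : MvPolynomial τ R →ₐ[R] MvPolynomial τ R :=
    MvPolynomial.aeval (Function.update MvPolynomial.X b (MvPolynomial.X a - MvPolynomial.X b))
  have ha : φ (MvPolynomial.X a) = MvPolynomial.X a := by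
    rw [MvPolynomial.aeval_X, Function.update_of_ne h]
  have hb : φ (MvPolynomial.X b) = MvPolynomial.X a - MvPolynomial.X b := by
    rw [MvPolynomial.aeval_X, Function.update_self]
  have hφ : φ.comp φ = AlgHom.id R _ := by
    refine MvPolynomial.algHom_ext fun c => ?_
    by_cases hc : c = b
    · subst hc
      rw [AlgHom.comp_apply, hb, map_sub, ha, hb, sub_sub_cancel, AlgHom.id_apply]
    · have : φ (MvPolynomial.X c) = MvPolynomial.X c := by
        rw [MvPolynomial.aeval_X, Function.update_of_ne hc]
      rw [AlgHom.comp_apply, this, this, AlgHom.id_apply]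
  have h2 := congrArg φ hpq
  rw [map_mul, map_mul, map_sub, ha, hb, sub_sub_cancel] at h2
  have h3 := congrArg φ (MvPolynomial.isRegular_X.left h2)
  rwa [← AlgHom.comp_apply, ← AlgHom.comp_apply, hφ] at h3

lemma X_sub_X_dvd [DecidableEq τ] (a b : τ) (p : MvPolynomial τ R) :
    MvPolynomial.X a - MvPolynomial.X b ∣ substVar a b p - p := by
  induction p using MvPolynomial.induction_on with
  | C r => rw [MvPolynomial.algHom_C]; simp
  | add p q hp hq => rw [map_add, add_sub_add_comm]; exact dvd_add hp hq
  | mul_X p c hp =>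
    have hc : MvPolynomial.X a - MvPolynomial.X b ∣
        substVar (R := R) a b (MvPolynomial.X c) - MvPolynomial.X c := by
      by_cases h : c = b
      · rw [h, substVar_X_same]
      · rw [substVar_X_of_ne h, sub_self]
        exact dvd_zero _
    have : substVar a b (p * MvPolynomial.X c) - p * MvPolynomial.X c =
        (substVar a b p - p) * substVar a b (MvPolynomial.X c) +
          p * (substVar a b (MvPolynomial.X c) - MvPolynomial.X c) := by
      rw [map_mul]; ring
    rw [this]
    exact dvd_add (hp.mul_right _) (hc.mul_left _)

/-- The linear map `p ↦ (p - p|_{b = a}) / (a - b)`. -/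
lemma exists_dividedDifference [DecidableEq τ] {a b : τ} (h : a ≠ b) :
    ∃ q : MvPolynomial τ R →ₗ[R] MvPolynomial τ R,
      (∀ p, (MvPolynomial.X a - MvPolynomial.X b) * q p = p - substVar a b p) ∧
      (∀ p, q ((MvPolynomial.X a - MvPolynomial.X b) * p) = p) ∧
      ∀ r p, substVar a b r = r → q (r * p) = r * q p := by
  have hd : ∀ p : MvPolynomial τ R, ∃ c, (MvPolynomial.X a - MvPolynomial.X b) * c =
      p - substVar a b p := fun p => by
    obtain ⟨c, hc⟩ := X_sub_X_dvd a b p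
    exact ⟨-c, by rw [mul_neg, ← hc, neg_sub]⟩
  choose q hq using hd
  let Q : MvPolynomial τ R →ₗ[R] MvPolynomial τ R :=
    { toFun := q
      map_add' := fun x y => X_sub_X_cancel h (by rw [hq, mul_add, hq, hq, map_add]; ring)
      map_smul' := fun r x => X_sub_X_cancel h (by
        rw [hq, mul_smul_comm, RingHom.id_apply, hq, map_smul, smul_sub]) }
  refine ⟨Q, hq, fun p => X_sub_X_cancel h ?_, fun r p hr => X_sub_X_cancel h ?_⟩
  · rw [show Q _ = q _ from rfl, hq, map_mul, map_sub, substVar_X_same, substVar_X_of_ne h,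
      sub_self, zero_mul, sub_zero]
  · rw [show Q _ = q _ from rfl, show Q _ = q _ from rfl, hq, mul_left_comm, hq, map_mul, hr,
      mul_sub]

/-- The map of Koszul algebras that is induced by a linear map of the polynomials. -/
def coeffMap (ι : Type) (q : MvPolynomial σ R →ₗ[R] MvPolynomial τ R) :
    Kos R σ ι →ₗ[R] Kos R τ ι :=
  LinearMap.rTensor _ q

lemma coeffMap_pol (q : MvPolynomial σ R →ₗ[R] MvPolynomial τ R) (p : MvPolynomial σ R) :
    coeffMap ι q (pol p) = pol (q p) := rfl

lemma coeffMap_gen_mul (q : MvPolynomial σ R →ₗ[R] MvPolynomial τ R) (i : ι) (x : Kos R σ ι) :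
    coeffMap ι q (gen i * x) = gen i * coeffMap ι q x := by
  induction x using TensorProduct.induction_on with
  | zero => simp
  | add x y hx hy => rw [mul_add, map_add, hx, hy, map_add, mul_add]
  | tmul p a =>
    rw [gen_mul_tmul, coeffMap, LinearMap.rTensor_tmul, LinearMap.rTensor_tmul, gen_mul_tmul]

lemma coeffMap_parity (q : MvPolynomial σ R →ₗ[R] MvPolynomial τ R) (x : Kos R σ ι) :
    coeffMap ι q (parity x) = parity (coeffMap ι q x) := by
  induction x using kos_induction with
  | h_pol p => rw [parity_pol, coeffMap_pol, parity_pol]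
  | h_add x y hx hy => simp only [map_add, hx, hy]
  | h_gen i x hx =>
    rw [parity_mul, parity_gen, kos_neg_mul, map_neg, coeffMap_gen_mul, coeffMap_gen_mul, hx,
      parity_mul, parity_gen, kos_neg_mul]

lemma coeffMap_pol_mul {q : MvPolynomial σ R →ₗ[R] MvPolynomial τ R} {r : MvPolynomial σ R}
    {r' : MvPolynomial τ R} (h : ∀ p, q (r * p) = r' * q p) (x : Kos R σ ι) :
    coeffMap ι q (pol r * x) = pol r' * coeffMap ι q x := by
  induction x using TensorProduct.induction_on with
  | zero => simp
  | add x y hx hy => rw [mul_add, map_add, hx, hy, map_add, mul_add]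
  | tmul p a =>
    rw [pol_mul_tmul, coeffMap, LinearMap.rTensor_tmul, LinearMap.rTensor_tmul, pol_mul_tmul, h]

lemma coeffMap_pol_mul_eq_self {q : MvPolynomial σ R →ₗ[R] MvPolynomial σ R} {r : MvPolynomial σ R}
    (h : ∀ p, q (r * p) = p) (x : Kos R σ ι) : coeffMap ι q (pol r * x) = x := by
  induction x using TensorProduct.induction_on with
  | zero => simp
  | add x y hx hy => rw [mul_add, map_add, hx, hy]
  | tmul p a => rw [pol_mul_tmul, coeffMap, LinearMap.rTensor_tmul, h]

/-! ### The homotopy that sets `y` equal to `x` -/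

variable [Fintype σ] [DecidableEq σ]

/-- The boundary coefficients `f̂ i ↦ f i(x)`, `û k ↦ x k - y k`. -/
def diagCoeff (f : ι → MvPolynomial σ R) : ι ⊕ σ → MvPolynomial (σ ⊕ σ) R :=
  Sum.elim (fun i => MvPolynomial.rename Sum.inl (f i))
    fun k => MvPolynomial.X (Sum.inl k) - MvPolynomial.X (Sum.inr k)

variable (R ι) in
/-- The homomorphism with `y k ↦ x k` and `û k ↦ 0` for all `k ∈ S`. -/
def diagHom (S : Finset σ) : Kos R (σ ⊕ σ) (ι ⊕ σ) →ₐ[R] Kos R (σ ⊕ σ) (ι ⊕ σ) :=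
  hom (MvPolynomial.aeval (Sum.elim (fun k => MvPolynomial.X (Sum.inl k)) fun k =>
      if k ∈ S then MvPolynomial.X (Sum.inl k) else MvPolynomial.X (Sum.inr k)))
    (Sum.elim (fun i => Pi.single (Sum.inl i) 1) fun k =>
      if k ∈ S then 0 else Pi.single (Sum.inr k) 1)

lemma diagHom_X_inl (S : Finset σ) (k : σ) :
    diagHom R ι S (pol (MvPolynomial.X (Sum.inl k)) : Kos R (σ ⊕ σ) (ι ⊕ σ)) =
      pol (MvPolynomial.X (Sum.inl k)) := by
  rw [diagHom, hom_pol, MvPolynomial.aeval_X, Sum.elim_inl]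

lemma diagHom_X_inr (S : Finset σ) (k : σ) :
    diagHom R ι S (pol (MvPolynomial.X (Sum.inr k)) : Kos R (σ ⊕ σ) (ι ⊕ σ)) =
      pol (if k ∈ S then MvPolynomial.X (Sum.inl k) else MvPolynomial.X (Sum.inr k)) := by
  rw [diagHom, hom_pol, MvPolynomial.aeval_X, Sum.elim_inr]

lemma diagHom_inl (S : Finset σ) (i : ι) :
    diagHom R ι S (gen (Sum.inl i) : Kos R (σ ⊕ σ) (ι ⊕ σ)) = gen (Sum.inl i) :=
  hom_gen_of_eq_single rfl

lemma diagHom_inr (S : Finset σ) (k : σ) :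
    diagHom R ι S (gen (Sum.inr k) : Kos R (σ ⊕ σ) (ι ⊕ σ)) =
      if k ∈ S then 0 else gen (Sum.inr k) := by
  rw [diagHom, hom_gen, Sum.elim_inr]
  split_ifs
  · exact vec_zero
  · exact vec_single _

lemma diagHom_empty (x : Kos R (σ ⊕ σ) (ι ⊕ σ)) : diagHom R ι ∅ x = x := by
  have : diagHom R ι (∅ : Finset σ) = AlgHom.id R _ := by
    refine kos_algHom_ext (fun j => ?_) fun i => ?_
    · cases j with
      | inl j => rw [diagHom_X_inl, AlgHom.id_apply]
      | inr j => rw [diagHom_X_inr, if_neg (Finset.notMem_empty j), AlgHom.id_apply]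
    · cases i with
      | inl i => rw [diagHom_inl, AlgHom.id_apply]
      | inr i => rw [diagHom_inr, if_neg (Finset.notMem_empty i), AlgHom.id_apply]
  rw [this, AlgHom.id_apply]

lemma diagHom_diagHom (S T : Finset σ) (x : Kos R (σ ⊕ σ) (ι ⊕ σ)) :
    diagHom R ι S (diagHom R ι T x) = diagHom R ι (T ∪ S) x := by
  have : (diagHom R ι S).comp (diagHom R ι T) = diagHom R ι (T ∪ S) := by
    refine kos_algHom_ext (fun j => ?_) fun i => ?_
    · cases j with
      | inl j => simp only [AlgHom.comp_apply, diagHom_X_inl]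
      | inr j =>
        rw [AlgHom.comp_apply, diagHom_X_inr, diagHom_X_inr]
        by_cases h : j ∈ T
        · rw [if_pos h, diagHom_X_inl, if_pos (Finset.mem_union_left _ h)]
        · rw [if_neg h, diagHom_X_inr]
          simp [Finset.mem_union, h]
    · cases i with
      | inl i => simp only [AlgHom.comp_apply, diagHom_inl]
      | inr i =>
        rw [AlgHom.comp_apply, diagHom_inr, diagHom_inr]
        by_cases h : i ∈ T
        · rw [if_pos h, map_zero, if_pos (Finset.mem_union_left _ h)]
        · rw [if_neg h, diagHom_inr]
          simp [Finset.mem_union, h]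
  rw [← this, AlgHom.comp_apply]

lemma boundary_diagHom (f : ι → MvPolynomial σ R) (S : Finset σ) (x : Kos R (σ ⊕ σ) (ι ⊕ σ)) :
    boundary (diagCoeff f) (diagHom R ι S x) = diagHom R ι S (boundary (diagCoeff f) x) := by
  refine boundary_hom (fun i => ?_) x
  cases i with
  | inl i =>
    rw [Finset.sum_eq_single (Sum.inl i)]
    · rw [Sum.elim_inl, Pi.single_eq_same, one_mul, diagCoeff, Sum.elim_inl,
        MvPolynomial.aeval_rename]
      exact DFunLike.congr_fun (MvPolynomial.algHom_ext fun j => by simp) (f i)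
    · intro j _ hj
      rw [Sum.elim_inl, Pi.single_eq_of_ne hj, zero_mul]
    · simp
  | inr k =>
    rw [Sum.elim_inr, diagCoeff, Sum.elim_inr, map_sub, MvPolynomial.aeval_X, MvPolynomial.aeval_X,
      Sum.elim_inl, Sum.elim_inr]
    split_ifs
    · simp
    · rw [Finset.sum_eq_single (Sum.inr k)]
      · rw [Pi.single_eq_same, one_mul, Sum.elim_inr]
      · intro j _ hj
        rw [Pi.single_eq_of_ne hj, zero_mul]
      · simp

/-- The homotopy is `û_k` times the divided difference `q` in `y_k`. On a polynomial, `∂(û_k q(p)) =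
(x_k - y_k) q(p)` is `p` minus its value at `y_k = x_k`. -/
lemma exists_homotopy_diagHom_singleton (f : ι → MvPolynomial σ R) (k : σ) :
    ∃ η : Kos R (σ ⊕ σ) (ι ⊕ σ) →ₗ[R] Kos R (σ ⊕ σ) (ι ⊕ σ),
      (∀ x, η (parity x) = -parity (η x)) ∧
      ∀ x, x - diagHom R ι {k} x =
        boundary (diagCoeff f) (η x) + η (boundary (diagCoeff f) x) := by
  obtain ⟨q, hq, hqz, hqr⟩ := exists_dividedDifference (R := R)
    (a := (Sum.inl k : σ ⊕ σ)) (b := Sum.inr k) (by simp)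
  refine ⟨LinearMap.mulLeft R (gen (Sum.inr k)) ∘ₗ coeffMap _ q, fun x => ?_, fun x => ?_⟩
  · simp only [LinearMap.comp_apply, LinearMap.mulLeft_apply]
    rw [coeffMap_parity, parity_mul, parity_gen, kos_neg_mul, neg_neg]
  have hs : ∀ p, (diagHom R ι {k} (pol p) : Kos R (σ ⊕ σ) (ι ⊕ σ)) =
      pol (substVar (Sum.inl k) (Sum.inr k) p) := by
    intro p
    rw [diagHom, hom_pol]
    congr 2
    refine MvPolynomial.algHom_ext fun j => ?_
    rw [MvPolynomial.aeval_X]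
    cases j with
    | inl j => rw [Sum.elim_inl, substVar_X_of_ne (by simp)]
    | inr j =>
      rw [Sum.elim_inr]
      by_cases h : j = k
      · subst h
        rw [substVar_X_same, if_pos (Finset.mem_singleton_self _)]
      · rw [substVar_X_of_ne (by simpa using h), if_neg (by simpa using h)]
  simp only [LinearMap.comp_apply, LinearMap.mulLeft_apply]
  induction x using kos_induction with
  | h_add x y hx hy =>
    simp only [map_add, mul_add]
    rw [add_sub_add_comm, hx, hy]
    abel
  | h_pol p =>
    rw [hs, ← pol_sub, ← hq, boundary_pol, map_zero, mul_zero, add_zero, boundary_gen_mul,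
      coeffMap_pol, boundary_pol, mul_zero, sub_zero, ← pol_mul]
    rfl
  | h_gen i x hx =>
    have h1 : gen (Sum.inr k) * coeffMap _ q (gen i * x) =
        -(gen i * (gen (Sum.inr k) * coeffMap _ q x)) := by
      rw [coeffMap_gen_mul, ← mul_assoc, gen_mul_gen, kos_neg_mul, mul_assoc]
    have h2 : gen (Sum.inr k) * coeffMap _ q (boundary (diagCoeff f) (gen i * x)) =
        gen (Sum.inr k) * coeffMap _ q (pol (diagCoeff f i) * x) +
          gen i * (gen (Sum.inr k) * coeffMap _ q (boundary (diagCoeff f) x)) := by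
      rw [boundary_gen_mul, map_sub, coeffMap_gen_mul, mul_sub, ← mul_assoc _ (gen i),
        gen_mul_gen, kos_neg_mul, mul_assoc, sub_neg_eq_add]
    rw [h1, h2, map_neg, boundary_gen_mul, map_mul (diagHom R ι {k})]
    by_cases hi : i = Sum.inr k
    · subst hi
      -- Here `diagHom` kills `û_k`. The boundary produces the factor `x_k - y_k`, which `q` divides
      -- out exactly, so the homotopy term restores the element.
      have hqz' : ∀ p, q (diagCoeff f (Sum.inr k) * p) = p := hqz
      rw [coeffMap_pol_mul_eq_self hqz', diagHom_inr, if_pos (Finset.mem_singleton_self _),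
        zero_mul, sub_zero, ← mul_assoc (gen (Sum.inr k)), gen_mul_gen_self, zero_mul,
        boundary_gen_mul, mul_sub, ← mul_assoc (gen (Sum.inr k)) (gen (Sum.inr k)),
        gen_mul_gen_self, zero_mul, pol_mul_left_comm]
      abel
    · have hd : diagHom R ι {k} (gen i : Kos R (σ ⊕ σ) (ι ⊕ σ)) = gen i := by
        cases i with
        | inl i => rw [diagHom_inl]
        | inr j => rw [diagHom_inr, if_neg (by simpa using hi)]
      -- The coefficients `f_i(x)` and `x_j - y_j`, `j ≠ k`, do not contain `y_k`, so `q` is linear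
      -- over them. This is why `diagCoeff` uses `f_i(x)` and not `f_i(y)`.
      have hw : substVar (Sum.inl k) (Sum.inr k) (diagCoeff f i) = diagCoeff f i := by
        cases i with
        | inl i =>
          rw [diagCoeff, Sum.elim_inl, substVar, MvPolynomial.aeval_rename]
          exact DFunLike.congr_fun (MvPolynomial.algHom_ext fun j => by simp) (f i)
        | inr j =>
          rw [diagCoeff, Sum.elim_inr, map_sub, substVar_X_of_ne (by simp),
            substVar_X_of_ne (by simpa using hi)]
      rw [coeffMap_pol_mul (fun p => hqr _ p hw), hd, ← mul_sub, hx, mul_add, pol_mul_left_comm]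
      abel

/-- The substitutions for single `k` compose, and `1 - ba = (1 - a) + (1 - b)a` adds up their
homotopies. -/
lemma exists_homotopy_diagHom (f : ι → MvPolynomial σ R) (S : Finset σ) :
    ∃ η : Kos R (σ ⊕ σ) (ι ⊕ σ) →ₗ[R] Kos R (σ ⊕ σ) (ι ⊕ σ),
      (∀ x, η (parity x) = -parity (η x)) ∧
      ∀ x, x - diagHom R ι S x =
        boundary (diagCoeff f) (η x) + η (boundary (diagCoeff f) x) := by
  induction S using Finset.induction_on with
  | empty =>
    refine ⟨0, fun x => ?_, fun x => ?_⟩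
    · simp
    · rw [diagHom_empty, sub_self]; simp
  | insert k S _ ih =>
    obtain ⟨η, h1, h2⟩ := ih
    obtain ⟨θ, h3, h4⟩ := exists_homotopy_diagHom_singleton f k
    refine ⟨θ + η ∘ₗ (diagHom R ι {k}).toLinearMap, fun x => ?_, fun x => ?_⟩
    · simp only [LinearMap.add_apply, LinearMap.comp_apply, AlgHom.toLinearMap_apply]
      rw [h3, diagHom, hom_parity, h1, map_add, neg_add]
    · simp only [LinearMap.add_apply, LinearMap.comp_apply, AlgHom.toLinearMap_apply]
      have h5 := h2 (diagHom R ι {k} x)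
      rw [diagHom_diagHom, boundary_diagHom, ← Finset.insert_eq] at h5
      rw [← sub_add_sub_cancel x (diagHom R ι {k} x), h4, h5, map_add]
      abel

end Homotopy


/-! ### Fibre integration over the generators `û`, and products of elements of degree one. -/

section Jacobian

set_option linter.unusedSectionVars false

variable {R : Type*} [CommRing R] {σ τ ι κ : Type}
variable [Fintype ι] [DecidableEq ι] [Fintype κ] [DecidableEq κ]

/-! ### Fibre integration -/

lemma forget_eq_hom (x : Kos R τ (ι ⊕ κ)) :
    forget κ x = hom (AlgHom.id R _) (Sum.elim (fun i => Pi.single i 1) 0) x := by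
  induction x using kos_induction with
  | h_pol p =>
    rw [hom_pol, forget, pol, LinearMap.lTensor_tmul, AlgHom.toLinearMap_apply, map_one]
    rfl
  | h_add x y hx hy => rw [map_add, map_add, hx, hy]
  | h_gen i x hx =>
    have h : forget κ (gen i * x) =
        (Sum.elim (fun i => gen i) 0 i : Kos R τ ι) * forget κ x := by
      clear hx
      induction x using TensorProduct.induction_on with
      | zero => simp
      | add x y hx hy => rw [mul_add, map_add, hx, hy, map_add, mul_add]
      | tmul p a =>
        rw [gen_mul_tmul, forget, LinearMap.lTensor_tmul, AlgHom.toLinearMap_apply, map_mul,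
          LinearMap.lTensor_tmul, ExteriorAlgebra.map_apply_ι]
        cases i with
        | inl i =>
          have h1 : LinearMap.funLeft R R (Sum.inl : ι → ι ⊕ κ) (Pi.single (Sum.inl i) 1) =
              Pi.single i 1 := by
            ext j; simp [LinearMap.funLeft, Pi.single_apply]
          rw [h1, Sum.elim_inl, gen_mul_tmul]
          rfl
        | inr i =>
          have h1 : LinearMap.funLeft R R (Sum.inl : ι → ι ⊕ κ) (Pi.single (Sum.inr i) 1) = 0 := by
            ext j; simp [LinearMap.funLeft]
          rw [h1, map_zero, zero_mul, TensorProduct.tmul_zero, Sum.elim_inr, Pi.zero_apply,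
            zero_mul]
    rw [h, map_mul (hom _ _), hx, hom_gen]
    cases i with
    | inl i => rw [Sum.elim_inl, Sum.elim_inl, vec_single]
    | inr i => rw [Sum.elim_inr, Sum.elim_inr, Pi.zero_apply, Pi.zero_apply, vec_zero]

variable (R τ ι κ) in
/-- The inclusion of the elements that do not contain the generators indexed by `κ`. -/
def inclBase : Kos R τ ι →ₐ[R] Kos R τ (ι ⊕ κ) := incl R id Sum.inl

lemma forget_inclBase (x : Kos R τ ι) : forget κ (inclBase R τ ι κ x) = x := by
  have h : (hom (AlgHom.id R _) (Sum.elim (fun i => Pi.single i 1) 0)).comp (inclBase R τ ι κ) =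
      AlgHom.id R _ := by
    refine kos_algHom_ext (fun j => ?_) fun i => ?_
    · rw [AlgHom.comp_apply, inclBase, incl_pol, hom_pol, MvPolynomial.rename_id]
      rfl
    · rw [AlgHom.comp_apply, inclBase, incl_gen]
      exact hom_gen_of_eq_single rfl
  rw [forget_eq_hom, ← AlgHom.comp_apply, h, AlgHom.id_apply]

lemma forget_mul_inclBase (x : Kos R τ (ι ⊕ κ)) (y : Kos R τ ι) :
    forget κ (x * inclBase R τ ι κ y) = forget κ x * y := by
  conv_rhs => rw [← forget_inclBase (κ := κ) y]
  rw [forget_eq_hom, forget_eq_hom x, forget_eq_hom, map_mul (hom _ _)]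

/-- The successive contractions with the generators in a list, each with a minus sign. -/
def foldContract : List κ → Kos R τ (ι ⊕ κ) →ₗ[R] Kos R τ (ι ⊕ κ)
  | [] => LinearMap.id
  | k :: l => -(foldContract l ∘ₗ contract (Sum.inr k))

lemma foldContract_cons (k : κ) (l : List κ) (x : Kos R τ (ι ⊕ κ)) :
    foldContract (k :: l) x = -foldContract l (contract (Sum.inr k) x) := by
  rw [foldContract, LinearMap.neg_apply, LinearMap.comp_apply]

lemma foldl_contract (l : List κ) (x : Kos R τ (ι ⊕ κ)) :
    l.foldl (fun w k => -contract (Sum.inr k) w) x = foldContract l x := by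
  induction l generalizing x with
  | nil => rfl
  | cons k l ih => rw [List.foldl_cons, ih, foldContract_cons, map_neg]

lemma foldContract_mul_inclBase (l : List κ) (x : Kos R τ (ι ⊕ κ)) (y : Kos R τ ι) :
    foldContract l (x * inclBase R τ ι κ y) = foldContract l x * inclBase R τ ι κ y := by
  induction l generalizing x with
  | nil => rfl
  | cons k l ih =>
    rw [foldContract_cons, foldContract_cons, contract_mul, inclBase,
      contract_incl_of_notMem _ _ _ (by simp), mul_zero, add_zero, ← inclBase, ih, kos_neg_mul]

lemma foldContract_boundary (l : List κ) (v : ι ⊕ κ → MvPolynomial τ R) (x : Kos R τ (ι ⊕ κ)) :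
    foldContract l (boundary v x) = (-1 : R) ^ l.length • boundary v (foldContract l x) := by
  induction l generalizing x with
  | nil => rw [List.length_nil, pow_zero, one_smul]; rfl
  | cons k l ih =>
    rw [foldContract_cons, foldContract_cons, ← boundary_single, boundary_anticomm, map_neg,
      neg_neg, ih, List.length_cons, pow_succ, mul_neg_one, kos_neg_smul, map_neg, kos_smul_neg,
      neg_neg]

lemma foldContract_parity (l : List κ) (x : Kos R τ (ι ⊕ κ)) :
    foldContract l (parity x) = (-1 : R) ^ l.length • parity (foldContract l x) := by
  induction l generalizing x with
  | nil => rw [List.length_nil, pow_zero, one_smul]; rfl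
  | cons k l ih =>
    rw [foldContract_cons, foldContract_cons, ← boundary_single, boundary_parity, map_neg,
      neg_neg, ih, List.length_cons, pow_succ, mul_neg_one, kos_neg_smul, map_neg, kos_smul_neg,
      neg_neg]

lemma foldContract_degProj (l : List κ) (r : ℕ) (x : Kos R τ (ι ⊕ κ)) :
    foldContract l (degProj (r + l.length) x) = degProj r (foldContract l x) := by
  induction l generalizing x with
  | nil => rfl
  | cons k l ih =>
    rw [foldContract_cons, foldContract_cons, List.length_cons, ← add_assoc, contract_degProj, ih,
      map_neg]

/-- Contractions anticommute and have square zero, so no `û` survives; hence `forget` loses nothing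
and the `û`-terms of a boundary drop out in `forget_boundary`. -/
lemma contract_foldContract {l : List κ} {k : κ} (hk : k ∈ l) (x : Kos R τ (ι ⊕ κ)) :
    contract (Sum.inr k) (foldContract l x) = 0 := by
  have h : ∀ (l : List κ) (x : Kos R τ (ι ⊕ κ)), contract (Sum.inr k) x = 0 →
      contract (Sum.inr k) (foldContract l x) = 0 := by
    intro l
    induction l with
    | nil => exact fun x hx => hx
    | cons j l ih =>
      intro x hx
      rw [foldContract_cons, map_neg, ih, neg_zero]
      rw [← boundary_single, ← boundary_single (Sum.inr j), boundary_anticomm, boundary_single,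
        boundary_single, hx, map_zero, neg_zero]
  induction l generalizing x with
  | nil => simp at hk
  | cons j l ih =>
    rw [foldContract_cons, map_neg]
    rcases List.mem_cons.mp hk with rfl | hk
    · rw [h, neg_zero]
      rw [← boundary_single, boundary_boundary]
    · rw [ih hk, neg_zero]

lemma forget_boundary {v : ι ⊕ κ → MvPolynomial τ R} {x : Kos R τ (ι ⊕ κ)}
    (hx : ∀ k, contract (Sum.inr k) x = 0) :
    forget κ (boundary v x) = boundary (fun i => v (Sum.inl i)) (forget κ x) := by
  have h1 : boundary v x = boundary (Sum.elim (fun i => v (Sum.inl i)) 0) x := by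
    rw [boundary_apply, boundary_apply, Fintype.sum_sum_type, Fintype.sum_sum_type]
    simp only [hx, mul_zero, Sum.elim_inl]
  rw [h1, forget_eq_hom, forget_eq_hom, boundary_hom (w := Sum.elim (fun i => v (Sum.inl i)) 0)]
  intro i
  cases i with
  | inl i =>
    rw [Finset.sum_eq_single i]
    · simp
    · intro j _ hj
      rw [Sum.elim_inl, Pi.single_eq_of_ne hj, zero_mul]
    · simp
  | inr k => simp

/-- Contraction with all generators of the second kind. -/
def fiberInt (n : ℕ) : Kos R τ (ι ⊕ Fin n) →ₗ[R] Kos R τ ι :=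
  forget (Fin n) ∘ₗ foldContract (List.finRange n)

lemma fiberInt_apply {n : ℕ} (x : Kos R τ (ι ⊕ Fin n)) :
    fiberInt n x = forget (Fin n) (foldContract (List.finRange n) x) := rfl

lemma fiberInt_mul_inclBase {n : ℕ} (x : Kos R τ (ι ⊕ Fin n)) (y : Kos R τ ι) :
    fiberInt n (x * inclBase R τ ι (Fin n) y) = fiberInt n x * y := by
  rw [fiberInt_apply, fiberInt_apply, foldContract_mul_inclBase, forget_mul_inclBase]

/-- Each of the `n` contractions anticommutes with the boundary, and afterwards the coefficients at
the `û` no longer matter. -/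
lemma fiberInt_boundary {n : ℕ} (v : ι ⊕ Fin n → MvPolynomial τ R) (x : Kos R τ (ι ⊕ Fin n)) :
    fiberInt n (boundary v x) = (-1 : R) ^ n • boundary (fun i => v (Sum.inl i)) (fiberInt n x) := by
  rw [fiberInt_apply, fiberInt_apply, foldContract_boundary, map_smul, List.length_finRange,
    forget_boundary fun k => contract_foldContract (List.mem_finRange k) x]

lemma fiberInt_parity {n : ℕ} (x : Kos R τ (ι ⊕ Fin n)) :
    fiberInt n (parity x) = (-1 : R) ^ n • parity (fiberInt n x) := by
  rw [fiberInt_apply, fiberInt_apply, foldContract_parity, map_smul, List.length_finRange,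
    forget_eq_hom, hom_parity, ← forget_eq_hom]

lemma fiberInt_degProj {n : ℕ} (r : ℕ) (x : Kos R τ (ι ⊕ Fin n)) :
    fiberInt n (degProj (r + n) x) = degProj r (fiberInt n x) := by
  have h := foldContract_degProj (List.finRange n) r x
  rw [List.length_finRange] at h
  rw [fiberInt_apply, fiberInt_apply, h, forget_eq_hom, ← degProj_hom, ← forget_eq_hom]

/-! ### Products of elements of degree one -/

/-- Moving `vec v` through the product next to its equal costs only signs, and `vec v` has square
zero. -/
lemma prod_vec_mul_eq_zero {l : List (ι → MvPolynomial σ R)} {v : ι → MvPolynomial σ R}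
    (hv : v ∈ l) : (l.map vec).prod * vec v = 0 := by
  rw [vec_mul_swap]
  have h : ∀ (l : List (ι → MvPolynomial σ R)), v ∈ l → ∀ x,
      vec v * ((l.map vec).prod * x) = 0 := by
    intro l
    induction l with
    | nil => simp
    | cons w l ih =>
      intro hv x
      rw [List.map_cons, List.prod_cons, mul_assoc, ← mul_assoc]
      rcases List.mem_cons.mp hv with rfl | hv
      · rw [vec_mul_self, zero_mul]
      · rw [vec_mul_vec, kos_neg_mul, mul_assoc, ih hv, mul_zero, neg_zero]
  have hp : ∀ (l : List (ι → MvPolynomial σ R)),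
      parity (l.map vec).prod = (-1 : R) ^ l.length • (l.map vec).prod := by
    intro l
    induction l with
    | nil => simp [parity_one]
    | cons w l ih =>
      rw [List.map_cons, List.prod_cons, parity_mul, parity_vec, ih, List.length_cons, pow_succ,
        mul_neg_one, kos_neg_smul, kos_neg_mul, mul_smul_comm]
  have h0 := h l hv 1
  rw [mul_one] at h0
  rw [hp, mul_smul_comm, h0, smul_zero]

lemma boundary_prod_vec {l : List (ι → MvPolynomial σ R)} {w : ι → MvPolynomial σ R}
    (hw : ∀ v ∈ l, boundary w (vec v) = 0) : boundary w (l.map vec).prod = 0 := by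
  induction l with
  | nil => exact boundary_one w
  | cons v l ih =>
    rw [List.map_cons, List.prod_cons, boundary_mul, hw v List.mem_cons_self, zero_mul,
      ih fun u hu => hw u (List.mem_cons_of_mem _ hu), mul_zero, add_zero]

lemma degProj_prod_vec (l : List (ι → MvPolynomial σ R)) :
    degProj l.length (l.map vec).prod = (l.map vec).prod := by
  induction l with
  | nil =>
    rw [List.map_nil, List.prod_nil, ← pol_one, List.length_nil, degProj_zero_pol]
  | cons v l ih =>
    rw [List.map_cons, List.prod_cons, List.length_cons, degProj_vec_mul, ih]

end Jacobian


/-! ### The difference Jacobian: cycle property and the basic homotopy. -/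

section JacobianHomotopy

set_option linter.unusedSectionVars false

variable {R : Type*} [CommRing R] {n s : ℕ}
variable {f : Fin s → MvPolynomial (Fin n) R}
  {D : Fin s → Fin n → MvPolynomial (Fin n ⊕ Fin n) R}

/-! ### The difference Jacobian -/

/-- The coefficients of the factors of the difference Jacobian. -/
def jacobianCoeff (D : Fin s → Fin n → MvPolynomial (Fin n ⊕ Fin n) R) (i : Fin s) :
    (Fin s ⊕ Fin s) ⊕ Fin n → MvPolynomial (Fin n ⊕ Fin n) R :=
  Sum.elim (Sum.elim (Pi.single i 1) (-Pi.single i 1)) (-D i)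

lemma vec_sum_elim {σ ι κ : Type} [Fintype ι] [DecidableEq ι] [Fintype κ] [DecidableEq κ]
    (v : ι → MvPolynomial σ R) (w : κ → MvPolynomial σ R) :
    vec (Sum.elim v w) =
      ∑ i, pol (v i) * gen (Sum.inl i) + ∑ k, pol (w k) * gen (Sum.inr k) := by
  rw [vec, Fintype.sum_sum_type]
  rfl

lemma vec_jacobianCoeff (D : Fin s → Fin n → MvPolynomial (Fin n ⊕ Fin n) R) (i : Fin s) :
    vec (jacobianCoeff D i) = gen (Sum.inl (Sum.inl i)) - gen (Sum.inl (Sum.inr i)) -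
      ∑ k, gen (Sum.inr k) * pol (D i k) := by
  have h : ∀ b : Fin s → Fin s ⊕ Fin s, ∑ j, pol ((Pi.single i 1 : Fin s → _) j) *
      (gen (Sum.inl (b j)) : Kos R (Fin n ⊕ Fin n) ((Fin s ⊕ Fin s) ⊕ Fin n)) =
        gen (Sum.inl (b i)) := by
    intro b
    rw [Finset.sum_eq_single i]
    · rw [Pi.single_eq_same, pol_one, one_mul]
    · intro j _ hj
      rw [Pi.single_eq_of_ne hj, pol_zero, zero_mul]
    · simp
  rw [jacobianCoeff, vec_sum_elim, Fintype.sum_sum_type]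
  simp only [Sum.elim_inl, Sum.elim_inr, Pi.neg_apply, pol_neg, kos_neg_mul]
  rw [h Sum.inl, Finset.sum_neg_distrib, Finset.sum_neg_distrib, h Sum.inr, sub_eq_add_neg,
    sub_eq_add_neg]
  simp only [pol_mul_comm]

lemma jacobianProd_eq (D : Fin s → Fin n → MvPolynomial (Fin n ⊕ Fin n) R) :
    jacobianProd D = ((List.ofFn (jacobianCoeff D)).map vec).prod := by
  rw [List.map_ofFn, jacobianProd]
  congr 2
  funext i
  exact (vec_jacobianCoeff D i).symm

/-- The coefficients of the boundary operator on the algebra in all the generators. -/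
def fullCoeff (f : Fin s → MvPolynomial (Fin n) R) :
    (Fin s ⊕ Fin s) ⊕ Fin n → MvPolynomial (Fin n ⊕ Fin n) R :=
  Sum.elim (sumCoeff f f) fun k => MvPolynomial.X (Sum.inl k) - MvPolynomial.X (Sum.inr k)

/-- This is where the difference gradient enters: each factor has boundary `f_i(x) - f_i(y) - ∑ (x_k
- y_k) D i k = 0`. -/
lemma boundary_jacobianProd (hD : IsDifferenceGradient f D) :
    boundary (fullCoeff f) (jacobianProd D) = 0 := by
  rw [jacobianProd_eq]
  refine boundary_prod_vec fun v hv => ?_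
  obtain ⟨i, rfl⟩ := (List.mem_ofFn' _ _).mp hv
  rw [boundary_vec, Fintype.sum_sum_type, Fintype.sum_sum_type]
  have h := hD i
  have h1 : ∀ w : Fin s → MvPolynomial (Fin n ⊕ Fin n) R,
      ∑ j, (Pi.single i 1 : Fin s → MvPolynomial (Fin n ⊕ Fin n) R) j * w j = w i := by
    intro w
    rw [Finset.sum_eq_single i]
    · rw [Pi.single_eq_same, one_mul]
    · intro j _ hj
      rw [Pi.single_eq_of_ne hj, zero_mul]
    · simp
  simp only [jacobianCoeff, fullCoeff, sumCoeff, Sum.elim_inl, Sum.elim_inr, Pi.neg_apply, neg_mul,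
    Finset.sum_neg_distrib]
  rw [h1, h1, ← pol_zero]
  simp only [mul_comm (D i _)]
  rw [h]
  congr 1
  ring

/-- Next to the product, `f̂_{i,y}` may therefore be replaced by `f̂_{i,x} - ∑ û_k D i k`. -/
lemma jacobianProd_mul_vec (i : Fin s) : jacobianProd D * vec (jacobianCoeff D i) = 0 := by
  rw [jacobianProd_eq]
  exact prod_vec_mul_eq_zero ((List.mem_ofFn' _ _).mpr ⟨i, rfl⟩)

lemma degProj_jacobianProd : degProj s (jacobianProd D) = jacobianProd D := by
  have h := degProj_prod_vec (List.ofFn (jacobianCoeff D))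
  rw [List.length_ofFn] at h
  rw [jacobianProd_eq, h]

lemma parity_jacobianProd : parity (jacobianProd D) = (-1 : R) ^ s • jacobianProd D := by
  rw [← degProj_jacobianProd, parity_degProj]

lemma jacobian_eq : jacobian D = fiberInt n (jacobianProd D) := by
  rw [jacobian, fiberInt_apply, foldl_contract]

lemma degProj_jacobian (hns : n ≤ s) : degProj (s - n) (jacobian D) = jacobian D := by
  have h := fiberInt_degProj (s - n) (jacobianProd D)
  rw [Nat.sub_add_cancel hns, degProj_jacobianProd] at h
  rw [jacobian_eq, ← h]

/-- The degree is `s - n`; writing the sign with `n + s` avoids truncated subtraction. -/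
lemma parity_jacobian : parity (jacobian D) = (-1 : R) ^ (n + s) • jacobian D := by
  have h := fiberInt_parity (jacobianProd D)
  rw [parity_jacobianProd, map_smul] at h
  rw [jacobian_eq, pow_add, mul_smul, h, smul_smul, ← mul_pow, neg_one_mul, neg_neg, one_pow,
    one_smul]

lemma boundary_jacobian (hD : IsDifferenceGradient f D) :
    boundary (sumCoeff f f) (jacobian D) = 0 := by
  have h := fiberInt_boundary (fullCoeff f) (jacobianProd D)
  rw [boundary_jacobianProd hD, map_zero] at h
  have h2 := congrArg ((-1 : R) ^ n • ·) h
  rw [smul_zero, smul_smul, ← mul_pow, neg_one_mul, neg_neg, one_pow, one_smul] at h2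
  rw [jacobian_eq]
  exact h2.symm

/-! ### The two embeddings, multiplied by the difference Jacobian, are homotopic -/

/-- The homomorphism with `x ↦ y` and `f̂ i ↦ f̂ i - ∑ k, û k D i k`. -/
def gradHom (D : Fin s → Fin n → MvPolynomial (Fin n ⊕ Fin n) R) :
    Kos R (Fin n) (Fin s) →ₐ[R] Kos R (Fin n ⊕ Fin n) (Fin s ⊕ Fin n) :=
  hom (MvPolynomial.rename Sum.inr) fun i => Sum.elim (Pi.single i 1) (-D i)

lemma gradHom_pol (p : MvPolynomial (Fin n) R) :
    gradHom D (pol p) = pol (MvPolynomial.rename Sum.inr p) := hom_pol _ _ _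

lemma gradHom_gen (i : Fin s) :
    gradHom D (gen i) = gen (Sum.inl i) - ∑ k, gen (Sum.inr k) * pol (D i k) := by
  rw [gradHom, hom_gen, vec_sum_elim, Finset.sum_eq_single i]
  · rw [Pi.single_eq_same, pol_one, one_mul]
    simp only [Pi.neg_apply, pol_neg, kos_neg_mul, Finset.sum_neg_distrib, pol_mul_comm]
    rw [sub_eq_add_neg]
  · intro j _ hj
    rw [Pi.single_eq_of_ne hj, pol_zero, zero_mul]
  · simp

lemma gradHom_parity (x : Kos R (Fin n) (Fin s)) :
    gradHom D (parity x) = parity (gradHom D x) := hom_parity _ _ _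

/-- The image of `f̂_i` has boundary `f_i(x) - ∑ (x_k - y_k) D i k = f_i(y)`. -/
lemma boundary_gradHom (hD : IsDifferenceGradient f D) (x : Kos R (Fin n) (Fin s)) :
    boundary (diagCoeff f) (gradHom D x) = gradHom D (boundary f x) := by
  refine boundary_hom (fun i => ?_) x
  rw [Fintype.sum_sum_type, Finset.sum_eq_single i]
  · simp only [Sum.elim_inl, Pi.single_eq_same, one_mul, diagCoeff, Sum.elim_inr, Pi.neg_apply,
      neg_mul, Finset.sum_neg_distrib, mul_comm (D i _)]
    rw [hD i]
    ring
  · intro j _ hj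
    rw [Sum.elim_inl, Pi.single_eq_of_ne hj, zero_mul]
  · simp

/-- Setting `y = x` and `û = 0` leads from `gradHom D x` to the first embedding;
`jacobianProd_mul_dropY_gradHom` identifies the other end of the homotopy with the second embedding.
-/
lemma diagHom_gradHom (x : Kos R (Fin n) (Fin s)) :
    diagHom R (Fin s) Finset.univ (gradHom D x) = inclX R _ _ _ _ x := by
  have h : (diagHom R (Fin s) Finset.univ).comp (gradHom D) =
      inclX R (Fin n) (Fin n) (Fin s) (Fin n) := by
    refine kos_algHom_ext (fun j => ?_) fun i => ?_
    · rw [AlgHom.comp_apply, gradHom_pol, MvPolynomial.rename_X, diagHom_X_inr,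
        if_pos (Finset.mem_univ j), inclX_pol, MvPolynomial.rename_X]
    · rw [AlgHom.comp_apply, gradHom_gen, map_sub, map_sum, diagHom_inl, inclX_gen,
        Finset.sum_eq_zero, sub_zero]
      intro k _
      rw [map_mul (diagHom R _ _), diagHom_inr, if_pos (Finset.mem_univ k), zero_mul]
  rw [← h, AlgHom.comp_apply]

variable (R n s) in
/-- The inclusion of the elements that do not contain the generators `f̂_y`. -/
def dropY : Kos R (Fin n ⊕ Fin n) (Fin s ⊕ Fin n) →ₐ[R]
    Kos R (Fin n ⊕ Fin n) ((Fin s ⊕ Fin s) ⊕ Fin n) :=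
  incl R id (Sum.map Sum.inl id)

lemma dropY_pol (p : MvPolynomial (Fin n ⊕ Fin n) R) : dropY R n s (pol p) = pol p := by
  rw [dropY, incl_pol, MvPolynomial.rename_id, AlgHom.id_apply]

lemma dropY_inl (i : Fin s) : dropY R n s (gen (Sum.inl i)) = gen (Sum.inl (Sum.inl i)) :=
  incl_gen _ _ _

lemma dropY_inr (k : Fin n) : dropY R n s (gen (Sum.inr k)) = gen (Sum.inr k) :=
  incl_gen _ _ _

lemma boundary_dropY (x : Kos R (Fin n ⊕ Fin n) (Fin s ⊕ Fin n)) :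
    boundary (fullCoeff f) (dropY R n s x) = dropY R n s (boundary (diagCoeff f) x) := by
  refine boundary_incl _ _ _ _ (fun i => ?_) x
  rw [MvPolynomial.rename_id]
  cases i <;> rfl

lemma dropY_inclX (x : Kos R (Fin n) (Fin s)) :
    dropY R n s (inclX R _ _ _ _ x) = inclBase R _ _ _ (inclX R _ _ _ _ x) := by
  have h : (dropY R n s).comp (inclX R (Fin n) (Fin n) (Fin s) (Fin n)) =
      (inclBase R _ _ _).comp (inclX R (Fin n) (Fin n) (Fin s) (Fin s)) := by
    refine kos_algHom_ext (fun j => ?_) fun i => ?_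
    · rw [AlgHom.comp_apply, AlgHom.comp_apply, inclX_pol, inclX_pol, dropY_pol, inclBase, incl_pol,
        MvPolynomial.rename_id, AlgHom.id_apply]
    · rw [AlgHom.comp_apply, AlgHom.comp_apply, inclX_gen, inclX_gen, dropY_inl, inclBase, incl_gen]
  exact DFunLike.congr_fun h x

/-- The images of `f̂_i` under the two maps differ by a factor of the product, which the product
annihilates. -/
lemma jacobianProd_mul_dropY_gradHom (x : Kos R (Fin n) (Fin s)) :
    jacobianProd D * dropY R n s (gradHom D x) =
      jacobianProd D * inclBase R _ _ _ (inclY R _ _ _ _ x) := by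
  rw [← sub_eq_zero, ← mul_sub]
  induction x using kos_induction with
  | h_pol p =>
    rw [gradHom_pol, dropY_pol, inclY_pol, inclBase, incl_pol, MvPolynomial.rename_id,
      AlgHom.id_apply, sub_self, mul_zero]
  | h_add x y hx hy =>
    rw [map_add, map_add, map_add, map_add, add_sub_add_comm, mul_add, hx, hy, add_zero]
  | h_gen i x hx =>
    have h1 : dropY R n s (gradHom D (gen i)) =
        vec (jacobianCoeff D i) + gen (Sum.inl (Sum.inr i)) := by
      rw [gradHom_gen, map_sub, map_sum, dropY_inl, vec_jacobianCoeff, sub_right_comm,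
        sub_add_cancel]
      congr 1
      refine Finset.sum_congr rfl fun k _ => ?_
      rw [map_mul (dropY R n s), dropY_inr, dropY_pol]
    have h2 : inclBase R _ _ (Fin n) (inclY R (Fin n) (Fin n) (Fin s) (Fin s) (gen i)) =
        gen (Sum.inl (Sum.inr i)) := by
      rw [inclY_gen, inclBase, incl_gen]
    rw [map_mul (gradHom D), map_mul (dropY R n s), map_mul (inclY R _ _ _ _),
      map_mul (inclBase R _ _ _), h1, h2, add_mul, add_sub_assoc, ← mul_sub, mul_add,
      ← mul_assoc, jacobianProd_mul_vec, zero_mul, zero_add, ← mul_assoc, mul_gen,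
      parity_jacobianProd, mul_smul_comm, smul_mul_assoc, mul_assoc, hx, mul_zero,
      smul_zero]

lemma jacobian_mul_inclX (x : Kos R (Fin n) (Fin s)) :
    jacobian D * inclX R _ _ _ _ x =
      fiberInt n (jacobianProd D * dropY R n s (inclX R _ _ _ _ x)) := by
  rw [dropY_inclX, fiberInt_mul_inclBase, jacobian_eq]

lemma jacobian_mul_inclY (x : Kos R (Fin n) (Fin s)) :
    jacobian D * inclY R _ _ _ _ x =
      fiberInt n (jacobianProd D * dropY R n s (gradHom D x)) := by
  rw [jacobianProd_mul_dropY_gradHom, fiberInt_mul_inclBase, jacobian_eq]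

lemma boundary_fiberInt_jacobianProd_mul (hD : IsDifferenceGradient f D)
    (x : Kos R (Fin n ⊕ Fin n) (Fin s ⊕ Fin n)) :
    fiberInt n (jacobianProd D * dropY R n s (boundary (diagCoeff f) x)) =
      (-1 : R) ^ (n + s) •
        boundary (sumCoeff f f) (fiberInt n (jacobianProd D * dropY R n s x)) := by
  have h := boundary_mul (fullCoeff f) (jacobianProd D) (dropY R n s x)
  rw [boundary_jacobianProd hD, zero_mul, zero_add, parity_jacobianProd, smul_mul_assoc,
    boundary_dropY] at h
  have h2 := fiberInt_boundary (fullCoeff f) (jacobianProd D * dropY R n s x)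
  rw [h, map_smul] at h2
  have h3 := congrArg ((-1 : R) ^ s • ·) h2
  rw [smul_smul, ← mul_pow, neg_one_mul, neg_neg, one_pow, one_smul, smul_smul, ← pow_add,
    add_comm s] at h3
  exact h3

lemma parity_fiberInt_jacobianProd_mul (x : Kos R (Fin n ⊕ Fin n) (Fin s ⊕ Fin n)) :
    parity (fiberInt n (jacobianProd D * dropY R n s x)) =
      (-1 : R) ^ (n + s) • fiberInt n (jacobianProd D * dropY R n s (parity x)) := by
  have h := fiberInt_parity (jacobianProd D * dropY R n s x)
  rw [parity_mul, parity_jacobianProd, smul_mul_assoc, map_smul, dropY, ← incl_parity,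
    ← dropY] at h
  rw [pow_add, mul_smul, h, smul_smul, ← mul_pow, neg_one_mul, neg_neg, one_pow, one_smul]

/-- The contraction onto the diagonal, applied to `gradHom D x`, multiplied by the product of the
factors and integrated over the fibre. The behaviour under `parity` is recorded because later signs
depend on it. -/
lemma exists_jacobian_mul_homotopy (hD : IsDifferenceGradient f D) :
    ∃ N : Kos R (Fin n) (Fin s) →ₗ[R] Kos R (Fin n ⊕ Fin n) (Fin s ⊕ Fin s),
      (∀ x, jacobian D * (inclX R _ _ _ _ x - inclY R _ _ _ _ x) =
        (-1 : R) ^ (n + s) • boundary (sumCoeff f f) (N x) + N (boundary f x)) ∧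
      ∀ x, parity (N x) = -((-1 : R) ^ (n + s) • N (parity x)) := by
  obtain ⟨η, h1, h2⟩ := exists_homotopy_diagHom f Finset.univ
  refine ⟨-(fiberInt n ∘ₗ LinearMap.mulLeft R (jacobianProd D) ∘ₗ (dropY R n s).toLinearMap ∘ₗ
    η ∘ₗ (gradHom D).toLinearMap), fun x => ?_, fun x => ?_⟩
  · simp only [LinearMap.neg_apply, LinearMap.comp_apply, LinearMap.mulLeft_apply,
      AlgHom.toLinearMap_apply]
    have h3 := h2 (gradHom D x)
    rw [diagHom_gradHom, boundary_gradHom hD] at h3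
    rw [mul_sub, jacobian_mul_inclX, jacobian_mul_inclY, ← map_sub, ← mul_sub, ← map_sub, ← neg_sub,
      h3, map_neg, kos_mul_neg, map_neg, map_add, mul_add, map_add,
      boundary_fiberInt_jacobianProd_mul hD, map_neg, kos_smul_neg, neg_add]
  · simp only [LinearMap.neg_apply, LinearMap.comp_apply, LinearMap.mulLeft_apply,
      AlgHom.toLinearMap_apply]
    rw [map_neg, parity_fiberInt_jacobianProd_mul, gradHom_parity, h1, map_neg, kos_mul_neg,
      map_neg, neg_neg]

lemma twist_twist (a b : ℕ) : (-1 : R) ^ (a + b) * (-1) ^ (a + b) = 1 := by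
  rw [← mul_pow, neg_one_mul, neg_neg, one_pow]

/-- Multiplication of the difference Jacobian by elements of the first and of the second set of
variables are homotopic. -/
theorem exists_mul_jacobian_homotopy (hD : IsDifferenceGradient f D) :
    ∃ h : Kos R (Fin n) (Fin s) →ₗ[R] Kos R (Fin n ⊕ Fin n) (Fin s ⊕ Fin s),
      (∀ x, (inclX R _ _ _ _ x - inclY R _ _ _ _ x) * jacobian D =
        boundary (sumCoeff f f) (h x) + h (boundary f x)) ∧
      ∀ x, parity (h x) = -((-1 : R) ^ (n + s) • h (parity x)) := by
  obtain ⟨N, h1, h2⟩ := exists_jacobian_mul_homotopy hD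
  set r : R := (-1) ^ (n + s) with hr
  have hrr : r * r = 1 := twist_twist n s
  -- Moving the Jacobian to the right side costs the sign `r` on odd elements. `T` applies this sign
  -- before embedding; since `∂` exchanges even and odd parts, `∂ T = r T ∂`.
  let T : Kos R (Fin n) (Fin s) →ₗ[R] Kos R (Fin n) (Fin s) := parityProj 0 + r • parityProj 1
  have hT : ∀ x, T x = parityProj 0 x + r • parityProj 1 x := fun x => rfl
  have hc : ∀ w : Kos R (Fin n ⊕ Fin n) (Fin s ⊕ Fin s),
      w * jacobian D = jacobian D * (parityProj 0 w + r • parityProj 1 w) := by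
    intro w
    conv_lhs => rw [← parityProj_add w]
    rw [add_mul, parityProj_zero_mul_comm, parityProj_one_mul_comm, parity_jacobian, ← hr, mul_add,
      mul_smul_comm, smul_mul_assoc]
  have hTX : ∀ x, inclX R (Fin n) (Fin n) (Fin s) (Fin s) (T x) =
      parityProj 0 (inclX R _ _ _ _ x) + r • parityProj 1 (inclX R _ _ _ _ x) := by
    intro x
    rw [hT, map_add, map_smul, inclX, incl, (hom_parityProj _ _ x).1, (hom_parityProj _ _ x).2]
  have hTY : ∀ x, inclY R (Fin n) (Fin n) (Fin s) (Fin s) (T x) =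
      parityProj 0 (inclY R _ _ _ _ x) + r • parityProj 1 (inclY R _ _ _ _ x) := by
    intro x
    rw [hT, map_add, map_smul, inclY, incl, (hom_parityProj _ _ x).1, (hom_parityProj _ _ x).2]
  have hTb : ∀ x, boundary f (T x) = r • T (boundary f x) := by
    intro x
    rw [hT, hT, map_add, map_smul, boundary_parityProj_zero, boundary_parityProj_one, smul_add,
      smul_smul, hrr, one_smul, add_comm]
  have hTp : ∀ x, T (parity x) = parity (T x) := by
    intro x
    rw [hT, hT, map_add, map_smul, parityProj_zero_parity, parityProj_one_parity,
      parity_parityProj_zero, parity_parityProj_one]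
  refine ⟨r • N ∘ₗ T, fun x => ?_, fun x => ?_⟩
  · simp only [LinearMap.smul_apply, LinearMap.comp_apply]
    rw [hc, map_sub, map_sub, smul_sub, sub_add_sub_comm, ← hTX, ← hTY, h1, hTb, map_smul,
      map_smul]
  · simp only [LinearMap.smul_apply, LinearMap.comp_apply]
    rw [map_smul, h2, hTp, kos_smul_neg]

end JacobianHomotopy


/-! ### Multiplication operators, contragredient operators and cocycles. -/

section Duality

set_option linter.unusedSectionVars false

variable {R : Type*} [CommRing R] {σ ι : Type} [Fintype ι] [DecidableEq ι]

/-! ### Multiplication operators and boundaries of operators -/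

/-- The operator `c ↦ c * t` on even and `c ↦ c * parity t` on odd elements. -/
def twistMul (t : Kos R σ ι) : Kos R σ ι →ₗ[R] Kos R σ ι :=
  LinearMap.mulRight R t ∘ₗ parityProj 0 + LinearMap.mulRight R (parity t) ∘ₗ parityProj 1

lemma twistMul_apply (t c : Kos R σ ι) :
    twistMul t c = parityProj 0 c * t + parityProj 1 c * parity t := rfl

lemma twistMul_one (c : Kos R σ ι) : twistMul 1 c = c := by
  rw [twistMul_apply, parity_one, mul_one, mul_one, parityProj_add]

lemma twistMul_add (t u c : Kos R σ ι) : twistMul (t + u) c = twistMul t c + twistMul u c := by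
  simp only [twistMul_apply, map_add, mul_add]
  abel

/-- The boundary of an operator on the Koszul complex. -/
def opBoundary (f : ι → MvPolynomial σ R) (a : Kos R σ ι →ₗ[R] Kos R σ ι) :
    Kos R σ ι →ₗ[R] Kos R σ ι :=
  homBoundary (boundary f) parity (boundary f) parity a

lemma opBoundary_apply (f : ι → MvPolynomial σ R) (a : Kos R σ ι →ₗ[R] Kos R σ ι) (c : Kos R σ ι) :
    opBoundary f a c = boundary f (a c) - parity (a (parity (boundary f c))) := rfl

/-- By graded commutativity `twistMul t` is multiplication by `t` from the left, so this is the
Leibniz rule `∂[t·] = (∂t)·`. It makes multiplication by a boundary null-homotopic. -/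
lemma opBoundary_twistMul (f : ι → MvPolynomial σ R) (t c : Kos R σ ι) :
    opBoundary f (twistMul t) c = twistMul (boundary f t) c := by
  rw [opBoundary_apply, twistMul_apply, twistMul_apply, twistMul_apply, map_add, map_add,
    boundary_mul, boundary_mul, boundary_parityProj_zero, boundary_parityProj_one,
    parityProj_zero_parity, parityProj_one_parity, parity_parityProj_zero, parity_parityProj_one,
    parity_mul, parity_mul, map_neg, parity_parityProj_zero, parity_parityProj_one, parity_parity,
    boundary_parity, neg_neg, kos_neg_mul, kos_mul_neg, neg_neg]
  abel

lemma opBoundary_add (f : ι → MvPolynomial σ R) (a b : Kos R σ ι →ₗ[R] Kos R σ ι) (c : Kos R σ ι) :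
    opBoundary f (a + b) c = opBoundary f a c + opBoundary f b c := by
  simp only [opBoundary_apply, LinearMap.add_apply, map_add]
  abel

lemma opBoundary_neg (f : ι → MvPolynomial σ R) (a : Kos R σ ι →ₗ[R] Kos R σ ι) (c : Kos R σ ι) :
    opBoundary f (-a) c = -opBoundary f a c := by
  simp only [opBoundary_apply, LinearMap.neg_apply, map_neg]
  abel

lemma opBoundary_of_cycle {f : ι → MvPolynomial σ R} (a : Kos R σ ι →ₗ[R] Kos R σ ι) {c : Kos R σ ι}
    (hc : boundary f c = 0) : opBoundary f a c = boundary f (a c) := by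
  rw [opBoundary_apply, hc, map_zero, map_zero, map_zero, sub_zero]

lemma contragredient_apply (a : Kos R σ ι →ₗ[R] Kos R σ ι) (c : Module.Dual R (Kos R σ ι))
    (x : Kos R σ ι) : contragredient a c x =
      c (parityProj 0 (a x)) + c (parityProj 1 (parity (a (parity x)))) := rfl

lemma dualBoundary_apply (f : ι → MvPolynomial σ R) (c : Module.Dual R (Kos R σ ι))
    (x : Kos R σ ι) : dualBoundary f c x = -c (parity (boundary f x)) := rfl

lemma dualParity_apply (c : Module.Dual R (Kos R σ ι)) (x : Kos R σ ι) :
    dualParity c x = c (parity x) := rfl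

lemma cap_apply (e : Module.Dual R (Kos R σ ι)) (c x : Kos R σ ι) : cap e c x = e (c * x) := rfl

lemma apply_parity_boundary {f : ι → MvPolynomial σ R} {e : Module.Dual R (Kos R σ ι)}
    (he : dualBoundary f e = 0) (x : Kos R σ ι) : e (parity (boundary f x)) = 0 := by
  have := LinearMap.congr_fun he x
  rwa [dualBoundary_apply, LinearMap.zero_apply, neg_eq_zero] at this

lemma apply_boundary {f : ι → MvPolynomial σ R} {e : Module.Dual R (Kos R σ ι)}
    (he : dualBoundary f e = 0) (x : Kos R σ ι) : e (boundary f x) = 0 := by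
  have := apply_parity_boundary he (parity x)
  rwa [boundary_parity, map_neg, parity_parity, map_neg, neg_eq_zero] at this

/-- A cocycle vanishes on boundaries, also on their even and odd parts, so the summand `∂ ∘ a`
contributes nothing; the other summand is the dual boundary. -/
lemma contragredient_opBoundary {f : ι → MvPolynomial σ R} {c : Module.Dual R (Kos R σ ι)}
    (hc : dualBoundary f c = 0) (a : Kos R σ ι →ₗ[R] Kos R σ ι) :
    contragredient (opBoundary f a) c = dualBoundary f (contragredient a c) := by
  refine LinearMap.ext fun x => ?_
  have h0 : ∀ y, c (parityProj 0 (boundary f y)) = 0 := fun y => by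
    rw [← boundary_parityProj_one, apply_boundary hc]
  have h1 : ∀ y, c (parityProj 1 (boundary f y)) = 0 := fun y => by
    rw [← boundary_parityProj_zero, apply_boundary hc]
  rw [dualBoundary_apply, contragredient_apply, contragredient_apply, opBoundary_apply,
    opBoundary_apply, parity_parity, boundary_parity]
  simp only [map_neg, map_sub, parityProj_zero_parity, parityProj_one_parity, parity_parity, h0, h1]
  abel

/-- The cocycle `e` vanishes on the boundary of `c * x`, which the Leibniz rule expands into the two
sides. -/
lemma cap_boundary {f : ι → MvPolynomial σ R} {e : Module.Dual R (Kos R σ ι)}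
    (he : dualBoundary f e = 0) (c : Kos R σ ι) :
    dualBoundary f (cap e c) = dualParity (cap e (parity (boundary f c))) := by
  refine LinearMap.ext fun x => ?_
  have h := apply_parity_boundary he (c * x)
  rw [boundary_mul, map_add, parity_mul, parity_mul, parity_parity, map_add] at h
  rw [dualBoundary_apply, dualParity_apply, cap_apply, cap_apply]
  exact (eq_neg_of_add_eq_zero_left h).symm

end Duality

section Linearity

set_option linter.unusedSectionVars false

variable {R : Type*} [CommRing R] {σ τ ι κ : Type}
variable [Fintype ι] [DecidableEq ι] [Fintype κ] [DecidableEq κ]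

lemma slantY_neg (g : Module.Dual R (Kos R τ κ)) (w : Kos R (σ ⊕ τ) (ι ⊕ κ)) :
    slantY (-g) w = -slantY g w := by
  induction w using kos_sum_induction with
  | h_add x y hx hy => rw [map_add, map_add, hx, hy, neg_add]
  | h_mul x y => rw [slantY_mul, slantY_mul, LinearMap.neg_apply, kos_neg_smul]

lemma slantY_zero (w : Kos R (σ ⊕ τ) (ι ⊕ κ)) :
    slantY (0 : Module.Dual R (Kos R τ κ)) w = 0 := by
  induction w using kos_sum_induction with
  | h_add x y hx hy => rw [map_add, hx, hy, add_zero]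
  | h_mul x y => rw [slantY_mul, LinearMap.zero_apply, zero_smul]

lemma slantX_zero (w : Kos R (σ ⊕ τ) (ι ⊕ κ)) :
    slantX (0 : Module.Dual R (Kos R σ ι)) w = 0 := by
  induction w using kos_sum_induction with
  | h_add x y hx hy => rw [map_add, hx, hy, add_zero]
  | h_mul x y => rw [slantX_mul, LinearMap.zero_apply, zero_smul]

lemma slantX_add (g g' : Module.Dual R (Kos R σ ι)) (w : Kos R (σ ⊕ τ) (ι ⊕ κ)) :
    slantX (g + g') w = slantX g w + slantX g' w := by
  induction w using kos_sum_induction with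
  | h_add x y hx hy => rw [map_add, map_add, map_add, hx, hy, add_add_add_comm]
  | h_mul x y => rw [slantX_mul, slantX_mul, slantX_mul, LinearMap.add_apply, add_smul]

end Linearity

/-! ### The two compositions of the `J`-map with multiplication by a cocycle. -/

section JacobianDuality

set_option linter.unusedSectionVars false

variable {R : Type*} [CommRing R] {n s : ℕ}
variable {f : Fin s → MvPolynomial (Fin n) R}
  {D : Fin s → Fin n → MvPolynomial (Fin n ⊕ Fin n) R}
  {e : Module.Dual R (Kos R (Fin n) (Fin s))}

/-! ### The `J`-map as a morphism -/

lemma comp_parity_parity (c : Module.Dual R (Kos R (Fin n) (Fin s))) :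
    (c ∘ₗ parity) ∘ₗ parity = c :=
  LinearMap.ext fun x => congrArg c (parity_parity x)

/-- The `J`-map shifts degrees by `s - n`, the total degree of the Jacobian. -/
lemma jMap_dualParity (c : Module.Dual R (Kos R (Fin n) (Fin s))) :
    jMap D (dualParity c) = (-1 : R) ^ (n + s) • parity (jMap D c) := by
  have h := slantY_parity (c ∘ₗ parity) (parity (jacobian D))
  rw [parity_parity, parity_jacobian, map_smul, map_smul] at h
  have h2 := slantY_parity (dualParity c ∘ₗ parity) (jacobian D)
  have h3 : (dualParity c ∘ₗ parity) ∘ₗ parity = c ∘ₗ parity := by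
    rw [comp_parity_parity]; rfl
  rw [h3, parity_jacobian, map_smul] at h2
  rw [jMap_apply, jMap_apply, ← h2, smul_smul, twist_twist, one_smul]

/-- The Jacobian is a cycle, so in `boundary_slantY` only the boundary acting on the functional
remains. -/
lemma boundary_jMap (hD : IsDifferenceGradient f D) (c : Module.Dual R (Kos R (Fin n) (Fin s))) :
    boundary f (jMap D c) = parity (jMap D (dualParity (dualBoundary f c))) := by
  have h : (c ∘ₗ parity) ∘ₗ boundary f = -(dualParity (dualBoundary f c) ∘ₗ parity) := by
    refine LinearMap.ext fun x => ?_
    simp only [LinearMap.neg_apply, LinearMap.comp_apply, dualParity_apply, dualBoundary_apply,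
      parity_parity, neg_neg]
  rw [jMap_apply, jMap_apply, boundary_slantY f f, boundary_jacobian hD, map_zero, zero_sub, h,
    slantY_neg, map_neg, neg_neg]

lemma jMap_dualBoundary (hD : IsDifferenceGradient f D)
    (c : Module.Dual R (Kos R (Fin n) (Fin s))) :
    jMap D (dualBoundary f c) = (-1 : R) ^ (n + s) • boundary f (jMap D c) := by
  rw [boundary_jMap hD, jMap_dualParity, map_smul, parity_parity, smul_smul, twist_twist, one_smul]

/-! ### The composition on the Koszul complex -/

lemma slantY_boundary_of_cocycle (he : dualBoundary f e = 0)
    (w : Kos R (Fin n ⊕ Fin n) (Fin s ⊕ Fin s)) :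
    slantY (e ∘ₗ parity) (boundary (sumCoeff f f) w) = boundary f (slantY (e ∘ₗ parity) w) := by
  have h : (e ∘ₗ parity) ∘ₗ boundary f = 0 := LinearMap.ext fun x => apply_parity_boundary he x
  rw [boundary_slantY f f, h, slantY_zero, map_zero, sub_zero]

/-- Passing from `e` to `e·c` amounts, up to signs, to multiplying the Jacobian by `c(y)`. -/
lemma jMap_cap (c : Kos R (Fin n) (Fin s)) :
    jMap D (cap e c) =
      slantY (e ∘ₗ parity) (inclY R _ _ _ _ (parityProj 0 c) * jacobian D) -
        parity (slantY (e ∘ₗ parity) (inclY R _ _ _ _ (parityProj 1 c) * jacobian D)) := by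
  have h0 : cap e (parityProj 0 c) ∘ₗ parity =
      (e ∘ₗ parity) ∘ₗ LinearMap.mulLeft R (parityProj 0 c) := by
    refine LinearMap.ext fun x => ?_
    simp only [LinearMap.comp_apply, cap_apply, LinearMap.mulLeft_apply, parity_mul,
      parity_parityProj_zero]
  have h1 : cap e (parityProj 1 c) ∘ₗ parity =
      -((e ∘ₗ parity) ∘ₗ LinearMap.mulLeft R (parityProj 1 c)) := by
    refine LinearMap.ext fun x => ?_
    simp only [LinearMap.neg_apply, LinearMap.comp_apply, cap_apply, LinearMap.mulLeft_apply,
      parity_mul, parity_parityProj_one, kos_neg_mul, map_neg, neg_neg]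
  rw [slantY_inclY_even_mul, slantY_inclY_odd_mul, parity_parity]
  conv_lhs => rw [← parityProj_add c]
  rw [map_add, map_add, jMap_apply, jMap_apply, h0, h1, slantY_neg, sub_eq_add_neg]

/-- By the basic homotopy `c(y)` may be replaced by `c(x)`, which comes out of the evaluation in `y`
and leaves `𝒥(e)` as the other factor. -/
theorem exists_jMap_cap_homotopy (hD : IsDifferenceGradient f D) (he : dualBoundary f e = 0) :
    ∃ H : Kos R (Fin n) (Fin s) →ₗ[R] Kos R (Fin n) (Fin s),
      ∀ c, jMap D (cap e c) = twistMul (jMap D e) c - opBoundary f H c := by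
  obtain ⟨h, h1, -⟩ := exists_mul_jacobian_homotopy hD
  set g := slantY (e ∘ₗ parity) ∘ₗ h with hg
  have h2 : ∀ c, slantY (e ∘ₗ parity) (inclY R _ _ _ _ c * jacobian D) =
      c * jMap D e - boundary f (g c) - g (boundary f c) := by
    intro c
    have h3 := congrArg (slantY (e ∘ₗ parity)) (h1 c)
    rw [sub_mul, map_sub, map_add, slantY_boundary_of_cocycle he, slantY_inclX_mul,
      ← jMap_apply] at h3
    rw [hg, LinearMap.comp_apply, LinearMap.comp_apply, sub_sub, ← h3, sub_sub_cancel]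
  -- The odd part of `c` enters `jMap_cap` through `parity`, so the homotopy has to carry `parity`
  -- there.
  refine ⟨g ∘ₗ parityProj 0 + parity ∘ₗ g ∘ₗ parityProj 1, fun c => ?_⟩
  rw [jMap_cap, h2, h2, twistMul_apply, opBoundary_apply]
  simp only [LinearMap.add_apply, LinearMap.comp_apply, map_add, map_sub, boundary_parityProj_zero,
    boundary_parityProj_one, parityProj_zero_parity, parityProj_one_parity, parity_mul,
    parity_parityProj_one, kos_neg_mul, boundary_parity, map_neg, parity_parity]
  abel

/-! ### The composition on the dual complex -/

lemma slantX_comp_parity (g : Module.Dual R (Kos R (Fin n) (Fin s)))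
    (w : Kos R (Fin n ⊕ Fin n) (Fin s ⊕ Fin s)) :
    slantX (g ∘ₗ parity) w = parity (slantX g (parity w)) := by
  rw [slantX_parity, parity_parity]

lemma slantX_boundary_of_cocycle (he : dualBoundary f e = 0)
    (w : Kos R (Fin n ⊕ Fin n) (Fin s ⊕ Fin s)) :
    slantX e (boundary (sumCoeff f f) w) = boundary f (slantX (e ∘ₗ parity) w) := by
  have h : e ∘ₗ boundary f = 0 := LinearMap.ext fun x => apply_boundary he x
  rw [slantX_boundary f f, h, slantX_zero, zero_add]

lemma cap_jMap_apply (c : Module.Dual R (Kos R (Fin n) (Fin s))) (b : Kos R (Fin n) (Fin s)) :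
    cap e (jMap D c) b = c (parity (slantX (e ∘ₗ LinearMap.mulRight R b) (jacobian D))) := by
  rw [cap_apply, jMap_apply, apply_slantY_mul]
  rfl

lemma slantX_mulRight (b : Kos R (Fin n) (Fin s)) :
    slantX (e ∘ₗ LinearMap.mulRight R b) (jacobian D) =
      slantX e (inclX R _ _ _ _ (parityProj 0 b) * jacobian D) +
        (-1 : R) ^ (n + s) •
          parity (slantX e (inclX R _ _ _ _ (parityProj 1 b) * jacobian D)) := by
  have h : e ∘ₗ LinearMap.mulRight R b = e ∘ₗ LinearMap.mulLeft R (parityProj 0 b) +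
      (e ∘ₗ LinearMap.mulLeft R (parityProj 1 b)) ∘ₗ parity := by
    refine LinearMap.ext fun x => ?_
    simp only [LinearMap.add_apply, LinearMap.comp_apply, LinearMap.mulLeft_apply,
      LinearMap.mulRight_apply]
    rw [parityProj_zero_mul_comm, parityProj_one_mul_comm, parity_parity, ← map_add, ← mul_add,
      parityProj_add]
  rw [h, slantX_add, slantX_comp_parity, slantX_inclX_mul, slantX_inclX_mul,
    parity_jacobian, map_smul, map_smul]

/-- By `apply_slantY_mul` the composition is contragredient to evaluating `e` in `x` on `b(x) J`.
The basic homotopy replaces `b(x)` by `b(y)`, which comes out of the evaluation and leaves `slantX e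
(jacobian D)`. -/
theorem exists_cap_jMap_homotopy (hD : IsDifferenceGradient f D) (he : dualBoundary f e = 0) :
    ∃ L : Kos R (Fin n) (Fin s) →ₗ[R] Kos R (Fin n) (Fin s),
      ∀ c, cap e (jMap D c) =
        contragredient (twistMul (slantX e (jacobian D)) - opBoundary f L) c := by
  obtain ⟨h, h1, h2⟩ := exists_mul_jacobian_homotopy hD
  set r : R := (-1) ^ (n + s) with hr
  have hrr : r * r = 1 := twist_twist n s
  set g := slantX e ∘ₗ h with hg
  set k := slantX e (jacobian D) with hk
  have hgp : ∀ c, slantX (e ∘ₗ parity) (h c) = -(r • parity (g (parity c))) := by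
    intro c
    rw [slantX_comp_parity, h2, map_neg, map_smul, map_neg, map_smul, hg, LinearMap.comp_apply]
  have h3 : ∀ c, slantX e (inclX R _ _ _ _ c * jacobian D) =
      slantX e (inclY R _ _ _ _ c * jacobian D) -
        r • boundary f (parity (g (parity c))) + g (boundary f c) := by
    intro c
    have h4 := congrArg (slantX e) (h1 c)
    rw [sub_mul, map_sub, map_add, slantX_boundary_of_cocycle he, hgp, map_neg, map_smul] at h4
    rw [hg, LinearMap.comp_apply, LinearMap.comp_apply] at *
    rw [sub_eq_iff_eq_add] at h4
    rw [h4]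
    abel
  have h5 : ∀ c, slantX e (inclY R _ _ _ _ (parityProj 0 c) * jacobian D) = parityProj 0 c * k :=
    fun c => slantX_inclY_even_mul _ _ _
  have h6 : ∀ c, slantX e (inclY R _ _ _ _ (parityProj 1 c) * jacobian D) =
      r • (parityProj 1 c * parity k) := by
    intro c
    rw [slantX_inclY_odd_mul, slantX_comp_parity, parity_jacobian, map_smul, map_smul,
      mul_smul_comm]
  have h7 : ∀ b, slantX e (inclX R _ _ _ _ (parityProj 0 b) * jacobian D) +
      r • slantX e (inclX R _ _ _ _ (parityProj 1 b) * jacobian D) =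
        (twistMul k - opBoundary f (parity ∘ₗ (r • g ∘ₗ parityProj 0 - g ∘ₗ parityProj 1))) b := by
    intro b
    rw [h3, h3, h5, h6, LinearMap.sub_apply, twistMul_apply, opBoundary_apply]
    simp only [LinearMap.sub_apply, LinearMap.smul_apply, LinearMap.comp_apply, map_sub, map_smul,
      smul_add, smul_sub, smul_smul, hrr, one_smul, boundary_parityProj_zero,
      boundary_parityProj_one, parityProj_zero_parity, parityProj_one_parity,
      parity_parityProj_zero, parity_parityProj_one, map_neg, parity_parity, boundary_parity,
      kos_smul_neg]
    abel
  refine ⟨parity ∘ₗ (r • g ∘ₗ parityProj 0 - g ∘ₗ parityProj 1), fun c =>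
    LinearMap.ext fun b => ?_⟩
  rw [cap_jMap_apply, contragredient_apply, ← h7, ← h7, slantX_mulRight, ← hr, ← map_add]
  congr 1
  simp only [parityProj_zero_parity, parityProj_one_parity, map_add, map_neg, map_smul,
    parity_parity, kos_neg_mul, kos_smul_neg]
  rw [parity_eq]
  generalize slantX e (inclX R _ _ _ _ (parityProj 0 b) * jacobian D) = A
  generalize slantX e (inclX R _ _ _ _ (parityProj 1 b) * jacobian D) = B
  conv_lhs => rw [← parityProj_add B]
  rw [smul_add]
  abel

end JacobianDuality


/-! ### Evaluating the cocycle in the other variables also gives a cycle homologous to one. -/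

section Parts

set_option linter.unusedSectionVars false

variable {R : Type*} [CommRing R] {σ ι : Type} [Fintype ι] [DecidableEq ι]

lemma parityProj_mul (x y : Kos R σ ι) :
    (parityProj 0 (parityProj 0 x * y) = parityProj 0 x * parityProj 0 y ∧
      parityProj 1 (parityProj 0 x * y) = parityProj 0 x * parityProj 1 y) ∧
    parityProj 0 (parityProj 1 x * y) = parityProj 1 x * parityProj 1 y ∧
      parityProj 1 (parityProj 1 x * y) = parityProj 1 x * parityProj 0 y := by
  induction x using kos_induction with
  | h_pol p =>
    simp only [parityProj_zero_pol, parityProj_one_pol, parityProj_pol_mul, zero_mul, map_zero,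
      and_self]
  | h_add x x' hx hx' =>
    simp only [map_add, add_mul, hx.1.1, hx.1.2, hx.2.1, hx.2.2, hx'.1.1, hx'.1.2, hx'.2.1,
      hx'.2.2, and_self]
  | h_gen i x hx =>
    simp only [parityProj_zero_gen_mul, parityProj_one_gen_mul, mul_assoc, hx.1.1, hx.1.2, hx.2.1,
      hx.2.2, and_self]

lemma contragredient_twistMul (e : Module.Dual R (Kos R σ ι)) (k : Kos R σ ι) :
    contragredient (twistMul k) e =
      cap e (parityProj 0 k) - dualParity (cap e (parityProj 1 k)) := by
  refine LinearMap.ext fun b => ?_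
  rw [contragredient_apply, LinearMap.sub_apply, dualParity_apply, cap_apply, cap_apply, ← map_add,
    ← map_sub]
  congr 1
  rw [parityProj_zero_mul_comm, parityProj_one_mul_comm, parity_parity, twistMul_apply,
    twistMul_apply, parityProj_one_parity, parityProj_one_parity, parityProj_zero_parity, map_add,
    map_add, (parityProj_mul b k).1.1, (parityProj_mul b k).1.2, kos_neg_mul, map_neg,
    (parityProj_mul b _).2.1, (parityProj_mul b _).2.2, parityProj_zero_parity,
    parityProj_one_parity, kos_mul_neg]
  conv_rhs => rw [← parityProj_add b]
  rw [add_mul, add_mul]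
  abel

lemma contragredient_sub (a b : Kos R σ ι →ₗ[R] Kos R σ ι) (c : Module.Dual R (Kos R σ ι)) :
    contragredient (a - b) c = contragredient a c - contragredient b c := by
  refine LinearMap.ext fun x => ?_
  simp only [contragredient_apply, LinearMap.sub_apply, map_sub]
  abel

lemma contragredient_twistMul_one (c : Module.Dual R (Kos R σ ι)) :
    contragredient (twistMul 1) c = c := by
  rw [contragredient_twistMul, parityProj_zero_one, parityProj_one_one, map_zero, map_zero,
    sub_zero]
  refine LinearMap.ext fun x => ?_
  rw [cap_apply, one_mul]

lemma dualParity_dualBoundary (f : ι → MvPolynomial σ R) (c : Module.Dual R (Kos R σ ι)) :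
    dualParity (dualBoundary f c) = -dualBoundary f (dualParity c) := by
  refine LinearMap.ext fun x => ?_
  rw [LinearMap.neg_apply, dualParity_apply, dualBoundary_apply, dualBoundary_apply,
    dualParity_apply, boundary_parity, map_neg, map_neg]

lemma cap_boundary_eq {f : ι → MvPolynomial σ R} {e : Module.Dual R (Kos R σ ι)}
    (he : dualBoundary f e = 0) (t : Kos R σ ι) :
    cap e (boundary f t) = dualBoundary f (dualParity (cap e (parity t))) := by
  have h := cap_boundary he (parity t)
  rw [boundary_parity, map_neg, parity_parity, map_neg, map_neg] at h
  have h2 := dualParity_dualBoundary f (cap e (parity t))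
  rw [h, map_neg] at h2
  rw [← neg_inj, ← h2, neg_inj]
  refine LinearMap.ext fun x => ?_
  rw [dualParity_apply, dualParity_apply, parity_parity]

end Parts

section Symmetry

set_option linter.unusedSectionVars false

variable {R : Type*} [CommRing R] {n s : ℕ}
variable {f : Fin s → MvPolynomial (Fin n) R}
  {D : Fin s → Fin n → MvPolynomial (Fin n ⊕ Fin n) R}
  {e : Module.Dual R (Kos R (Fin n) (Fin s))}

lemma boundary_slantX_jacobian (hD : IsDifferenceGradient f D) (he : dualBoundary f e = 0) :
    boundary f (slantX e (jacobian D)) = 0 := by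
  have h := slantX_boundary f f (e ∘ₗ parity) (jacobian D)
  have h0 : (e ∘ₗ parity) ∘ₗ boundary f = 0 := LinearMap.ext fun x => apply_parity_boundary he x
  rw [boundary_jacobian hD, map_zero, h0, slantX_zero, zero_add, comp_parity_parity] at h
  exact h.symm

lemma jMap_cap_sub_mem (hD : IsDifferenceGradient f D) (he : dualBoundary f e = 0)
    {t : Kos R (Fin n) (Fin s)} (ht : jMap D e = 1 + boundary f t)
    {z : Kos R (Fin n) (Fin s)} (hz : boundary f z = 0) :
    jMap D (cap e z) - z ∈ LinearMap.range (boundary f) := by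
  obtain ⟨H, hH⟩ := exists_jMap_cap_homotopy hD he
  refine ⟨twistMul t z - H z, ?_⟩
  rw [hH, ht, twistMul_add, twistMul_one, ← opBoundary_twistMul, opBoundary_of_cycle _ hz,
    opBoundary_of_cycle _ hz, map_sub]
  abel

/-- Let `k` be the element on the left. Up to coboundaries, `e·𝒥(e)` is `e·1` by hypothesis, and by
`exists_cap_jMap_homotopy` it is `e·k` up to a sign on the odd part. Apply `jMap D`, which inverts
`c ↦ e·c` on cycles up to boundaries. -/
lemma exists_slantX_jacobian_eq (hD : IsDifferenceGradient f D) (he : dualBoundary f e = 0)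
    {t : Kos R (Fin n) (Fin s)} (ht : jMap D e = 1 + boundary f t) :
    ∃ u, slantX e (jacobian D) = 1 + boundary f u := by
  obtain ⟨L, hL⟩ := exists_cap_jMap_homotopy hD he
  have hk := boundary_slantX_jacobian hD he
  set k := slantX e (jacobian D)
  set r : R := (-1) ^ (n + s) with hr
  have hrr : r * r = 1 := twist_twist n s
  let S := LinearMap.range (boundary (R := R) f)
  have hS : ∀ x, boundary f x ∈ S := fun x => ⟨x, rfl⟩
  have hk0 : boundary f (parityProj 0 k) = 0 := by rw [boundary_parityProj_zero, hk, map_zero]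
  have hk1 : boundary f (parityProj 1 k) = 0 := by rw [boundary_parityProj_one, hk, map_zero]
  have h1 := congrArg (jMap D) (hL e)
  rw [contragredient_sub, contragredient_twistMul, contragredient_opBoundary he, ht, map_add,
    cap_boundary_eq he, map_add, map_sub, map_sub, jMap_dualBoundary hD, jMap_dualBoundary hD,
    jMap_dualParity (cap e (parityProj 1 k)), ← hr] at h1
  have h2 : (1 : Kos R (Fin n) (Fin s)) - (parityProj 0 k + r • parityProj 1 k) ∈ S := by
    have ha := jMap_cap_sub_mem hD he ht hk0
    obtain ⟨v, hv⟩ := jMap_cap_sub_mem hD he ht hk1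
    have hb := jMap_cap_sub_mem hD he ht (boundary_one f)
    have hc : parity (jMap D (cap e (parityProj 1 k))) + parityProj 1 k ∈ S := by
      refine ⟨-parity v, ?_⟩
      rw [map_neg, boundary_parity, hv, neg_neg, map_sub, parity_parityProj_one, sub_neg_eq_add]
    have hd := S.sub_mem (S.sub_mem ha (S.smul_mem r hc)) hb
    have hd' := S.sub_mem hd (S.smul_mem r (hS (jMap D (contragredient L e))))
    have hf := S.sub_mem hd' (S.smul_mem r (hS (jMap D (dualParity (cap e (parity t))))))
    rw [← eq_sub_iff_add_eq] at h1
    rw [h1] at hf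
    convert hf using 1
    rw [smul_add]
    abel
  -- The odd part of `k` appears with the sign `r`. Separating parities shows that `1 - k_even` and
  -- `r k_odd` are boundaries individually, so the sign is harmless.
  obtain ⟨v, hv⟩ := h2
  have h3 : boundary f (parityProj 1 v) = 1 - parityProj 0 k := by
    rw [boundary_parityProj_one, hv]
    simp only [map_sub, map_add, map_smul, parityProj_zero_one, parityProj_zero_zero,
      parityProj_zero_one', smul_zero, add_zero]
  have h4 : boundary f (parityProj 0 v) = -(r • parityProj 1 k) := by
    rw [boundary_parityProj_zero, hv]
    simp only [map_sub, map_add, map_smul, parityProj_one_one, parityProj_one_zero,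
      parityProj_one_one', zero_add, zero_sub]
  refine ⟨-parityProj 1 v - r • parityProj 0 v, ?_⟩
  rw [map_sub, map_neg, map_smul, h3, h4, kos_smul_neg, smul_smul, hrr, one_smul]
  conv_lhs => rw [← parityProj_add k]
  abel

end Symmetry

/-! ### Homology modules as quotients of `R[x]/(f)`. -/

section Finiteness

set_option linter.unusedSectionVars false

variable {R : Type*} [CommRing R] {σ ι : Type} [Fintype ι] [DecidableEq ι]

lemma exists_degProj_zero_eq_pol (x : Kos R σ ι) : ∃ p, degProj 0 x = pol p := by
  induction x using kos_induction with
  | h_pol p => exact ⟨p, degProj_zero_pol p⟩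
  | h_add x y hx hy =>
    obtain ⟨p, hp⟩ := hx
    obtain ⟨q, hq⟩ := hy
    exact ⟨p + q, by rw [map_add, hp, hq, pol_add]⟩
  | h_gen i x _ => exact ⟨0, by rw [degProj_zero_gen_mul, pol_zero]⟩

lemma exists_boundary_eq_pol {f : ι → MvPolynomial σ R} {p : MvPolynomial σ R}
    (hp : p ∈ Ideal.span (Set.range f)) : ∃ x : Kos R σ ι, boundary f x = pol p := by
  obtain ⟨c, rfl⟩ := (Ideal.mem_span_range_iff_exists_fun).mp hp
  exact ⟨vec c, by rw [boundary_vec]⟩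

lemma finite_of_surjective {f : ι → MvPolynomial σ R}
    (hfin : Module.Finite R (MvPolynomial σ R ⧸ Ideal.span (Set.range f)))
    {M : Type*} [AddCommGroup M] [Module R M] (φ : MvPolynomial σ R →ₗ[R] M)
    (hφ : ∀ p ∈ Ideal.span (Set.range f), φ p = 0) (hs : Function.Surjective φ) :
    Module.Finite R M := by
  let I := (Ideal.span (Set.range f)).restrictScalars R
  let e : (MvPolynomial σ R ⧸ I) ≃ₗ[R] MvPolynomial σ R ⧸ Ideal.span (Set.range f) :=
    Submodule.Quotient.restrictScalarsEquiv R _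
  have : Module.Finite R (MvPolynomial σ R ⧸ I) := Module.Finite.equiv e.symm
  refine Module.Finite.of_surjective (I.liftQ φ hφ) fun m => ?_
  obtain ⟨p, rfl⟩ := hs m
  exact ⟨Submodule.Quotient.mk p, rfl⟩

/-- The hypotheses say that `φ` induces a surjection from `R[x]/(f)` onto the homology. -/
lemma finite_homology_of_surjective {f : ι → MvPolynomial σ R}
    (hfin : Module.Finite R (MvPolynomial σ R ⧸ Ideal.span (Set.range f)))
    {M : Type*} [AddCommGroup M] [Module R M] {d : M →ₗ[R] M} {G : Submodule R M}
    (φ : MvPolynomial σ R →ₗ[R] M) (hφ : ∀ p, φ p ∈ LinearMap.ker d ⊓ G)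
    (hf : ∀ p ∈ Ideal.span (Set.range f), φ p ∈ LinearMap.range d)
    (hs : ∀ m ∈ LinearMap.ker d ⊓ G, ∃ p, m - φ p ∈ LinearMap.range d) :
    Module.Finite R (Homology d G) := by
  refine finite_of_surjective hfin (Submodule.mkQ _ ∘ₗ φ.codRestrict _ hφ) (fun p hp => ?_)
    fun z => ?_
  · exact (Submodule.Quotient.mk_eq_zero _).mpr (hf p hp)
  · obtain ⟨m, rfl⟩ := Submodule.mkQ_surjective _ z
    obtain ⟨p, hp⟩ := hs m.1 m.2
    exact ⟨p, ((Submodule.Quotient.eq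
      (Submodule.comap (LinearMap.ker d ⊓ G).subtype (LinearMap.range d))).mpr hp).symm⟩

lemma finite_homology_zero {f : ι → MvPolynomial σ R}
    (hfin : Module.Finite R (MvPolynomial σ R ⧸ Ideal.span (Set.range f))) :
    Module.Finite R (Homology (boundary f) (degreePart R σ ι 0)) := by
  refine finite_homology_of_surjective hfin (polHom R σ ι).toLinearMap (fun p => ⟨?_, ?_⟩)
    (fun p hp => ?_) fun m hm => ?_
  · exact boundary_pol f p
  · have := degProj_mem 0 (pol p : Kos R σ ι)
    rwa [degProj_zero_pol] at this
  · exact exists_boundary_eq_pol hp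
  · obtain ⟨p, hp⟩ := exists_degProj_zero_eq_pol m
    rw [degProj_of_mem hm.2, if_pos rfl] at hp
    refine ⟨p, 0, ?_⟩
    rw [map_zero, hp]
    exact (sub_self _).symm

/-- Homogeneous components of coboundaries are coboundaries. This allows taking components in a
homotopy identity whose homotopy is not homogeneous. -/
lemma dualBoundary_comp_degProj (f : ι → MvPolynomial σ R) (u : Module.Dual R (Kos R σ ι)) (m : ℕ) :
    ∃ v, dualBoundary f u ∘ₗ degProj m = dualBoundary f v := by
  cases m with
  | zero =>
    refine ⟨0, LinearMap.ext fun x => ?_⟩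
    obtain ⟨p, hp⟩ := exists_degProj_zero_eq_pol x
    rw [LinearMap.comp_apply, hp, dualBoundary_apply, boundary_pol, map_zero, map_zero, neg_zero,
      map_zero, LinearMap.zero_apply]
  | succ r =>
    refine ⟨u ∘ₗ degProj r, LinearMap.ext fun x => ?_⟩
    rw [LinearMap.comp_apply, dualBoundary_apply, dualBoundary_apply, boundary_degProj,
      LinearMap.comp_apply, degProj_parity, parity_degProj]

end Finiteness

/-! ### Assembling the duality. -/

section Main

set_option linter.unusedSectionVars false

variable {R : Type*} [CommRing R] {n s : ℕ}
variable {f : Fin s → MvPolynomial (Fin n) R}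
  {D : Fin s → Fin n → MvPolynomial (Fin n ⊕ Fin n) R}
  {e : Module.Dual R (Kos R (Fin n) (Fin s))}

/-- The Jacobian has total degree `s - n`; a functional that uses up all of it in `y` leaves degree
zero in `x`. -/
lemma exists_jMap_eq_pol (hns : n ≤ s) {c : Module.Dual R (Kos R (Fin n) (Fin s))}
    (hc : c ∈ dualDegreePart R (Fin n) (Fin s) (s - n)) : ∃ p, jMap D c = pol p := by
  have h : c ∘ₗ parity = (c ∘ₗ parity) ∘ₗ degProj (s - n) := by
    refine LinearMap.ext fun x => ?_
    rw [LinearMap.comp_apply, LinearMap.comp_apply, LinearMap.comp_apply, parity_degProj,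
      ← degProj_parity, apply_degProj_of_mem hc]
  have h2 := slantY_degProj (c ∘ₗ parity) (s - n) (jacobian D)
  rw [← h, degProj_jacobian hns, ← jMap_apply] at h2
  rw [h2]
  exact exists_degProj_zero_eq_pol _

theorem isDuality (hns : n ≤ s)
    (hfin : Module.Finite R (MvPolynomial (Fin n) R ⧸ Ideal.span (Set.range f)))
    (hD : IsDifferenceGradient f D) (he : dualBoundary f e = 0)
    {t : Kos R (Fin n) (Fin s)} (ht : jMap D e = 1 + boundary f t) : IsDuality f D e := by
  have hr : ∃ L : Kos R (Fin n) (Fin s) →ₗ[R] Kos R (Fin n) (Fin s),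
      ∀ c, c - cap e (jMap D c) = contragredient (opBoundary f L) c := by
    obtain ⟨L, hL⟩ := exists_cap_jMap_homotopy hD he
    obtain ⟨u, hu⟩ := exists_slantX_jacobian_eq hD he ht
    -- With `k = 1 + ∂u`, multiplication by `k` differs from the identity by `∂[u·]`.
    refine ⟨L - twistMul u, fun c => ?_⟩
    rw [hL]
    nth_rw 1 [← contragredient_twistMul_one c]
    rw [← contragredient_sub]
    refine LinearMap.congr_fun (congrArg contragredient (LinearMap.ext fun x => ?_)) c
    rw [sub_eq_add_neg L, opBoundary_add, opBoundary_neg, opBoundary_twistMul,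
      LinearMap.sub_apply, LinearMap.sub_apply, hu, twistMul_add]
    abel
  refine ⟨?_, ?_, ?_, ?_, finite_homology_zero hfin, ?_⟩
  · refine LinearMap.ext fun c => ?_
    exact sub_eq_zero.mpr (boundary_jMap hD c)
  · refine LinearMap.ext fun c => ?_
    exact sub_eq_zero.mpr (cap_boundary he c)
  · obtain ⟨H, hH⟩ := exists_jMap_cap_homotopy hD he
    have h : ∀ c, c - jMap D (cap e c) = opBoundary f (H - twistMul t) c := by
      intro c
      rw [hH, ht, twistMul_add, twistMul_one, sub_eq_add_neg H, opBoundary_add, opBoundary_neg,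
        opBoundary_twistMul]
      abel
    exact ⟨H - twistMul t, h, fun c hc => (h c).trans (opBoundary_of_cycle _ hc)⟩
  · obtain ⟨L, hL⟩ := hr
    exact ⟨L, hL, fun c hc => (hL c).trans (contragredient_opBoundary hc L)⟩
  · obtain ⟨L, hL⟩ := hr
    -- `e` need not be homogeneous, so `e·p` may leave the degree in question. Its component of
    -- degree `-(s - n)` is again a cocycle and replaces `e`.
    have he' : dualBoundary f (e ∘ₗ degProj (s - n)) = 0 := by
      refine LinearMap.ext fun x => ?_
      rw [dualBoundary_apply, LinearMap.comp_apply, degProj_parity, map_smul, ← boundary_degProj,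
        apply_boundary he, smul_zero, neg_zero, LinearMap.zero_apply]
    have hcap : ∀ p, cap (e ∘ₗ degProj (s - n)) (pol p) = cap e (pol p) ∘ₗ degProj (s - n) := by
      intro p
      refine LinearMap.ext fun x => ?_
      rw [cap_apply, LinearMap.comp_apply, LinearMap.comp_apply, cap_apply, degProj_pol_mul]
    refine finite_homology_of_surjective hfin
      (cap (e ∘ₗ degProj (s - n)) ∘ₗ (polHom R (Fin n) (Fin s)).toLinearMap)
      (fun p => ⟨?_, ?_⟩) (fun p hp => ?_) fun c hc => ?_
    · change dualBoundary f (cap _ (pol p)) = 0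
      rw [cap_boundary he', boundary_pol, map_zero, map_zero, map_zero]
    · change cap _ (pol p) ∈ _
      rw [hcap]
      exact comp_degProj_mem _ _
    · change cap _ (pol p) ∈ _
      obtain ⟨y, hy⟩ := exists_boundary_eq_pol hp
      rw [← hy, cap_boundary_eq he']
      exact ⟨_, rfl⟩
    · obtain ⟨p, hp⟩ := exists_jMap_eq_pol (D := D) hns hc.2
      refine ⟨p, ?_⟩
      change c - cap _ (pol p) ∈ _
      have h1 : c ∘ₗ degProj (s - n) = c :=
        LinearMap.ext fun x => apply_degProj_of_mem hc.2 x
      have h2 := hL c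
      rw [contragredient_opBoundary hc.1, hp] at h2
      obtain ⟨v, hv⟩ := dualBoundary_comp_degProj f (contragredient L c) (s - n)
      refine ⟨v, ?_⟩
      rw [← hv, ← h2, LinearMap.sub_comp, h1, hcap]

end Main


/-! ### One-variable difference quotients and the residue of monic polynomials. -/

section Residue

variable {R : Type*} [CommRing R] {σ τ : Type}

/-! ### Difference quotients of polynomials in one variable -/

/-- The quotient is ordered by powers of `y`; the coefficient of `y ^ b` is the truncation `p_{b+1}
+ p_{b+2} x + ⋯`. For monic `p` of degree `d > 0` the coefficient of `y ^ (d - 1)` is `1`, the only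
one that `topCoeff` will select. -/
lemma aeval_sub_aeval_of_natDegree_le {S : Type*} [CommRing S] [Algebra R S] (x y : S) (d : ℕ)
    (p : Polynomial R) (hp : p.natDegree ≤ d) :
    Polynomial.aeval x p - Polynomial.aeval y p =
      (x - y) * ∑ b ∈ Finset.range d, y ^ b * Polynomial.aeval x (Polynomial.divX^[b + 1] p) := by
  induction d generalizing p with
  | zero =>
    rw [Polynomial.eq_C_of_natDegree_eq_zero (Nat.le_zero.mp hp)]
    simp
  | succ d ih =>
    have h := ih p.divX (by rw [Polynomial.natDegree_divX_eq_natDegree_tsub_one]; omega)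
    have hx : ∀ z : S, Polynomial.aeval z p =
        Polynomial.aeval z p.divX * z + algebraMap R S (p.coeff 0) := by
      intro z
      conv_lhs => rw [← Polynomial.divX_mul_X_add p]
      simp
    rw [Finset.sum_range_succ', mul_add, hx, hx]
    have h2 : ∑ b ∈ Finset.range d,
        y ^ (b + 1) * Polynomial.aeval x (Polynomial.divX^[b + 1 + 1] p) =
          y * ∑ b ∈ Finset.range d,
            y ^ b * Polynomial.aeval x (Polynomial.divX^[b + 1] p.divX) := by
      rw [Finset.mul_sum]
      refine Finset.sum_congr rfl fun b _ => ?_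
      rw [Function.iterate_succ_apply, pow_succ]
      ring
    rw [h2, mul_left_comm, ← h, Function.iterate_one]
    ring

lemma coeff_iterate_divX (p : Polynomial R) (b j : ℕ) :
    (Polynomial.divX^[b] p).coeff j = p.coeff (j + b) := by
  induction b generalizing j with
  | zero => rfl
  | succ b ih => rw [Function.iterate_succ_apply', Polynomial.coeff_divX, ih, add_right_comm,
      add_assoc]

lemma iterate_divX_natDegree {p : Polynomial R} (hp : p.Monic) :
    Polynomial.divX^[p.natDegree] p = 1 := by
  ext j
  rw [coeff_iterate_divX, Polynomial.coeff_one]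
  split_ifs with h
  · rw [h, zero_add, hp.coeff_natDegree]
  · exact Polynomial.coeff_eq_zero_of_natDegree_lt (by omega)

/-! ### The residue functional of monic polynomials -/

/-- The leading coefficient of the remainder modulo `p`. -/
def topCoeff (p : Polynomial R) : Polynomial R →ₗ[R] R :=
  Polynomial.lcoeff R (p.natDegree - 1) ∘ₗ Polynomial.modByMonicHom p

lemma topCoeff_apply (p q : Polynomial R) :
    topCoeff p q = (q %ₘ p).coeff (p.natDegree - 1) := rfl

lemma topCoeff_self_mul {p : Polynomial R} (hp : p.Monic) (q : Polynomial R) :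
    topCoeff p (p * q) = 0 := by
  rw [topCoeff_apply, Polynomial.self_mul_modByMonic hp, Polynomial.coeff_zero]

lemma topCoeff_X_pow [Nontrivial R] {p : Polynomial R} (hp : p.Monic) {b : ℕ}
    (hb : b < p.natDegree) :
    topCoeff p (Polynomial.X ^ b) = if b + 1 = p.natDegree then 1 else 0 := by
  rw [topCoeff_apply, (Polynomial.modByMonic_eq_self_iff hp).mpr, Polynomial.coeff_X_pow]
  · congr 1
    exact propext ⟨fun h => by omega, fun h => by omega⟩
  · rw [Polynomial.degree_X_pow, Polynomial.degree_eq_natDegree hp.ne_zero]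
    exact_mod_cast hb

variable [Fintype σ]

/-- The product of the functionals `topCoeff (p k)` in the variables `X k`. -/
def residue (p : σ → Polynomial R) : Module.Dual R (MvPolynomial σ R) :=
  (MvPolynomial.basisMonomials σ R).constr R
    fun m => ∏ k, topCoeff (p k) (Polynomial.X ^ m k)

lemma residue_monomial (p : σ → Polynomial R) (m : σ →₀ ℕ) :
    residue p (MvPolynomial.monomial m 1) = ∏ k, topCoeff (p k) (Polynomial.X ^ m k) := by
  have h := (MvPolynomial.basisMonomials σ R).constr_basis R
    (fun m => ∏ k, topCoeff (p k) (Polynomial.X ^ m k)) m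
  rwa [MvPolynomial.coe_basisMonomials] at h

lemma residue_prod_X_pow (p : σ → Polynomial R) (m : σ → ℕ) :
    residue p (∏ k, MvPolynomial.X k ^ m k) = ∏ k, topCoeff (p k) (Polynomial.X ^ m k) := by
  have h := residue_monomial p (Finsupp.equivFunOnFinite.symm m)
  rw [MvPolynomial.monomial_eq, MvPolynomial.C_1, one_mul,
    Finsupp.prod_fintype _ _ fun _ => pow_zero _] at h
  exact h

lemma residue_aeval_mul_monomial [DecidableEq σ] (p : σ → Polynomial R) (k : σ) (m : σ →₀ ℕ)
    (u : Polynomial R) :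
    residue p (Polynomial.aeval (MvPolynomial.X k) u * MvPolynomial.monomial m 1) =
      topCoeff (p k) (u * Polynomial.X ^ m k) *
        ∏ l ∈ Finset.univ.erase k, topCoeff (p l) (Polynomial.X ^ m l) := by
  induction u using Polynomial.induction_on' with
  | add u v hu hv => rw [map_add, add_mul, map_add, hu, hv, add_mul, map_add, add_mul]
  | monomial j c =>
    have h1 : Polynomial.aeval (MvPolynomial.X k) (Polynomial.monomial j c) *
        MvPolynomial.monomial m 1 =
          c • MvPolynomial.monomial (Finsupp.single k j + m) (1 : R) := by
      rw [Polynomial.aeval_monomial, MvPolynomial.X_pow_eq_monomial, mul_assoc,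
        MvPolynomial.monomial_mul, one_mul, Algebra.smul_def]
    have h2 : Polynomial.monomial j c * Polynomial.X ^ m k =
        c • (Polynomial.X ^ (j + m k) : Polynomial R) := by
      rw [← Polynomial.C_mul_X_pow_eq_monomial, mul_assoc, ← pow_add, Polynomial.smul_eq_C_mul]
    rw [h1, h2, map_smul, map_smul, residue_monomial, ← Finset.mul_prod_erase _ _
      (Finset.mem_univ k), smul_mul_assoc, Finsupp.add_apply, Finsupp.single_eq_same]
    congr 2
    refine Finset.prod_congr rfl fun l hl => ?_
    rw [Finsupp.add_apply, Finsupp.single_eq_of_ne (Finset.ne_of_mem_erase hl), zero_add]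

/-- On monomials the functional is a product over the variables, and the factor for `X k` vanishes
on multiples of `p k`. -/
lemma residue_aeval_mul {p : σ → Polynomial R} {k : σ} (hp : (p k).Monic)
    (q : MvPolynomial σ R) :
    residue p (Polynomial.aeval (MvPolynomial.X k) (p k) * q) = 0 := by
  classical
  have h : residue p ∘ₗ LinearMap.mulLeft R (Polynomial.aeval (MvPolynomial.X k) (p k)) = 0 := by
    refine (MvPolynomial.basisMonomials σ R).ext fun m => ?_
    rw [MvPolynomial.coe_basisMonomials, LinearMap.comp_apply, LinearMap.mulLeft_apply,
      residue_aeval_mul_monomial, topCoeff_self_mul hp, zero_mul, LinearMap.zero_apply]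
  exact LinearMap.congr_fun h q

end Residue

/-! ### Iterated contractions and comparison of products. -/

section ContractList

set_option linter.unusedSectionVars false

variable {R : Type*} [CommRing R] {σ τ ι κ : Type}
variable [Fintype ι] [DecidableEq ι] [Fintype κ] [DecidableEq κ]

/-! ### Successive contractions -/

/-- The successive contractions with the generators in a list. -/
def contractList : List ι → Kos R σ ι →ₗ[R] Kos R σ ι
  | [] => LinearMap.id
  | i :: l => contractList l ∘ₗ contract i

lemma contractList_nil (x : Kos R σ ι) : contractList [] x = x := rfl

lemma contractList_cons (i : ι) (l : List ι) (x : Kos R σ ι) :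
    contractList (i :: l) x = contractList l (contract i x) := rfl

lemma contract_contract_swap (i j : ι) (x : Kos R σ ι) :
    contract i (contract j x) = -contract j (contract i x) := by
  rw [← boundary_single, ← boundary_single, boundary_anticomm]

lemma contractList_pol_mul (l : List ι) (p : MvPolynomial σ R) (x : Kos R σ ι) :
    contractList l (pol p * x) = pol p * contractList l x := by
  induction l generalizing x with
  | nil => rfl
  | cons i l ih => rw [contractList_cons, contract_pol_mul, ih, contractList_cons]

lemma contractList_contract {l : List ι} {i : ι} (hi : i ∈ l) (x : Kos R σ ι) :
    contractList l (contract i x) = 0 := by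
  induction l generalizing x with
  | nil => simp at hi
  | cons j l ih =>
    rw [contractList_cons]
    rcases List.mem_cons.mp hi with rfl | hi
    · rw [← boundary_single, boundary_boundary, map_zero]
    · rw [contract_contract_swap, map_neg, ih hi, neg_zero]

/-- A boundary is a combination of contractions, and contracting twice with the same generator gives
zero: boundaries have no top exterior component. -/
lemma contractList_boundary {l : List ι} (hl : ∀ i, i ∈ l) (f : ι → MvPolynomial σ R)
    (x : Kos R σ ι) : contractList l (boundary f x) = 0 := by
  rw [boundary_apply, map_sum]
  refine Finset.sum_eq_zero fun i _ => ?_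
  rw [contractList_pol_mul, contractList_contract (hl i), mul_zero]

lemma contract_prod_mul {l : List κ} {v : κ → Kos R σ ι} {i : ι}
    (h : ∀ k ∈ l, contract i (v k) = 0) {z : Kos R σ ι} (hz : contract i z = 0) :
    contract i ((l.map v).prod * z) = 0 := by
  induction l with
  | nil => rw [List.map_nil, List.prod_nil, one_mul, hz]
  | cons k l ih =>
    rw [List.map_cons, List.prod_cons, mul_assoc, contract_mul, h k List.mem_cons_self, zero_mul,
      ih fun j hj => h j (List.mem_cons_of_mem _ hj), mul_zero, add_zero]

/-- Each contraction sees only its own factor of the product, so it removes that factor and leaves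
the coefficient. -/
lemma contractList_prod_mul {l : List κ} (hl : l.Nodup) {b : κ → ι} {v : κ → Kos R σ ι}
    {p : κ → MvPolynomial σ R}
    (h : ∀ k j, contract (b k) (v j) = if k = j then pol (p j) else 0)
    {z : Kos R σ ι} (hz : ∀ k, contract (b k) z = 0) :
    contractList (l.map b) ((l.map v).prod * z) = pol (l.map p).prod * z := by
  induction l with
  | nil => rw [List.map_nil, List.map_nil, List.map_nil, List.prod_nil, List.prod_nil, pol_one,
      contractList_nil]
  | cons k l ih =>
    have hk : k ∉ l := (List.nodup_cons.mp hl).1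
    have h0 : contract (b k) ((l.map v).prod * z) = 0 := contract_prod_mul
      (fun j hj => by rw [h, if_neg (by rintro rfl; exact hk hj)]) (hz k)
    rw [List.map_cons, List.map_cons, List.map_cons, List.prod_cons, List.prod_cons, mul_assoc,
      contractList_cons, contract_mul, h0, mul_zero, add_zero, h, if_pos rfl,
      contractList_pol_mul, ih (List.nodup_cons.mp hl).2, pol_mul, mul_assoc]

lemma foldContract_eq_contractList (l : List κ) (x : Kos R τ (ι ⊕ κ)) :
    foldContract l x = (-1 : R) ^ l.length • contractList (l.map Sum.inr) x := by
  induction l generalizing x with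
  | nil => rw [List.length_nil, pow_zero, one_smul]; rfl
  | cons k l ih =>
    rw [foldContract_cons, ih, List.length_cons, pow_succ, mul_neg_one, kos_neg_smul,
      List.map_cons, contractList_cons]

lemma fiberInt_contract {n : ℕ} (i : ι) (x : Kos R τ (ι ⊕ Fin n)) :
    fiberInt n (contract (Sum.inl i) x) = (-1 : R) ^ n • contract i (fiberInt n x) := by
  rw [← boundary_single, fiberInt_boundary, ← boundary_single]
  congr 3
  funext j
  simp [Pi.single_apply]

lemma exists_contractList_fiberInt {n : ℕ} (l : List ι) :
    ∃ r : R, r * r = 1 ∧ ∀ x : Kos R τ (ι ⊕ Fin n),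
      contractList l (fiberInt n x) = r • fiberInt n (contractList (l.map Sum.inl) x) := by
  induction l with
  | nil => exact ⟨1, one_mul 1, fun x => (one_smul _ _).symm⟩
  | cons i l ih =>
    obtain ⟨r, hr, h⟩ := ih
    refine ⟨(-1) ^ n * r, ?_, fun x => ?_⟩
    · rw [mul_mul_mul_comm, hr, mul_one, ← mul_pow, neg_one_mul, neg_neg, one_pow]
    · have h2 := congrArg ((-1 : R) ^ n • ·) (h (contract (Sum.inl i) x))
      simp only [fiberInt_contract, map_smul, smul_smul] at h2
      rw [← mul_pow, neg_one_mul, neg_neg, one_pow, one_smul] at h2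
      rw [contractList_cons, h2, List.map_cons, contractList_cons]

lemma slantY_comp_contractList (g : Module.Dual R (Kos R τ κ)) (l : List κ)
    (w : Kos R (σ ⊕ τ) (ι ⊕ κ)) :
    slantY (g ∘ₗ contractList l) w =
      parity^[l.length] (slantY g (contractList (l.map Sum.inr) w)) := by
  induction l generalizing w with
  | nil => rfl
  | cons i l ih =>
    rw [List.length_cons, Function.iterate_succ_apply', List.map_cons, contractList_cons, ← ih,
      contractList, ← LinearMap.comp_assoc, slantY_comp_contract]

lemma fiberInt_pol_mul {n : ℕ} (p : MvPolynomial τ R) (x : Kos R τ (ι ⊕ Fin n)) :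
    fiberInt n (pol p * x) = pol p * fiberInt n x := by
  rw [fiberInt_apply, fiberInt_apply, foldContract_eq_contractList, foldContract_eq_contractList,
    contractList_pol_mul, map_smul, map_smul, forget_eq_hom, map_mul (hom _ _), hom_pol,
    ← forget_eq_hom, AlgHom.id_apply, mul_smul_comm]

/-! ### Functionals on polynomials -/

/-- The functional on the Koszul algebra that is `g` in degree zero. -/
def degreeZeroDual (ι : Type) (g : Module.Dual R (MvPolynomial σ R)) :
    Module.Dual R (Kos R σ ι) :=
  LinearMap.mul' R R ∘ₗ TensorProduct.map g ExteriorAlgebra.algebraMapInv.toLinearMap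

lemma degreeZeroDual_pol (g : Module.Dual R (MvPolynomial σ R)) (p : MvPolynomial σ R) :
    degreeZeroDual ι g (pol p) = g p := by
  rw [degreeZeroDual, pol, LinearMap.comp_apply, TensorProduct.map_tmul, LinearMap.mul'_apply,
    AlgHom.toLinearMap_apply, map_one, mul_one]

lemma degreeZeroDual_pol_mul {g : Module.Dual R (MvPolynomial σ R)} {p : MvPolynomial σ R}
    (h : ∀ q, g (p * q) = 0) (x : Kos R σ ι) : degreeZeroDual ι g (pol p * x) = 0 := by
  induction x using TensorProduct.induction_on with
  | zero => simp
  | add x y hx hy => rw [mul_add, map_add, hx, hy, add_zero]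
  | tmul q a =>
    rw [pol_mul_tmul, degreeZeroDual, LinearMap.comp_apply, TensorProduct.map_tmul,
      LinearMap.mul'_apply, h, zero_mul]

/-! ### Comparison of products -/

/-- Write `vV - v'V' = (v - v')V + v'(V - V')` and apply the Leibniz rule to `v - v' = ∂u` and to
the boundary part of `V - V'`. The corrections contain `∂V` or some `p k`, hence lie in the left
ideal `I`. -/
lemma prod_sub_prod_mem {w : ι → MvPolynomial σ R} {v v' : κ → Kos R σ ι}
    {p : κ → MvPolynomial σ R} (hv : ∀ k, boundary w (v k) = pol (p k))
    (hv' : ∀ k, boundary w (v' k) = pol (p k))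
    (h : ∀ k, v k - v' k ∈ LinearMap.range (boundary w)) {I : Submodule R (Kos R σ ι)}
    (hI : ∀ k x, pol (p k) * x ∈ I) (hI' : ∀ x y, y ∈ I → x * y ∈ I) (l : List κ) :
    boundary w (l.map v).prod ∈ I ∧
      (l.map v).prod - (l.map v').prod ∈ LinearMap.range (boundary w) ⊔ I := by
  induction l with
  | nil =>
    rw [List.map_nil, List.map_nil, List.prod_nil, boundary_one, sub_self]
    exact ⟨I.zero_mem, Submodule.zero_mem _⟩
  | cons k l ih =>
    obtain ⟨h1, h2⟩ := ih
    rw [List.map_cons, List.map_cons, List.prod_cons, List.prod_cons]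
    refine ⟨?_, ?_⟩
    · rw [boundary_mul, hv]
      exact I.add_mem (hI _ _) (hI' _ _ h1)
    · obtain ⟨u, hu⟩ := h k
      obtain ⟨a, ⟨b, rfl⟩, c, hc, habc⟩ := Submodule.mem_sup.mp h2
      have h3 : v k * (l.map v).prod - v' k * (l.map v').prod =
          boundary w (u * (l.map v).prod + parity (v' k) * b) +
            (pol (p k) * b + v' k * c - parity u * boundary w (l.map v).prod) := by
        rw [← sub_add_sub_cancel _ (v' k * (l.map v).prod), ← sub_mul, ← mul_sub, ← habc, ← hu,
          map_add, boundary_mul, boundary_mul, boundary_parity, hv', parity_pol, parity_parity,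
          kos_neg_mul, mul_add]
        abel
      rw [h3]
      exact Submodule.add_mem_sup ⟨_, rfl⟩
        (I.sub_mem (I.add_mem (hI _ _) (hI' _ _ hc)) (hI' _ _ h1))

end ContractList


/-! ### Construction of a cocycle whose image is homologous to one. -/

section Existence

set_option linter.unusedSectionVars false

variable {R : Type*} [CommRing R] {n s : ℕ}
variable {f : Fin s → MvPolynomial (Fin n) R}
  {D : Fin s → Fin n → MvPolynomial (Fin n ⊕ Fin n) R}

/-! ### A cocycle with invertible image -/

lemma exists_monic_aeval_eq [Nontrivial R]
    (hfin : Module.Finite R (MvPolynomial (Fin n) R ⧸ Ideal.span (Set.range f))) (k : Fin n) :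
    ∃ p : Polynomial R, p.Monic ∧ 0 < p.natDegree ∧
      ∃ a : Fin s → MvPolynomial (Fin n) R,
        ∑ i, a i * f i = Polynomial.aeval (MvPolynomial.X k) p := by
  have := Algebra.IsIntegral.of_finite R (MvPolynomial (Fin n) R ⧸ Ideal.span (Set.range f))
  obtain ⟨p, hp, h⟩ := this.isIntegral (Ideal.Quotient.mk _ (MvPolynomial.X k))
  -- The integral equation may have degree zero if the quotient ring is trivial; the factor `X`
  -- makes the degree positive, as `natDegree - 1` in `topCoeff` requires.
  refine ⟨Polynomial.X * p, Polynomial.monic_X.mul hp, ?_, ?_⟩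
  · rw [Polynomial.natDegree_X_mul hp.ne_zero]
    exact Nat.succ_pos _
  · refine Ideal.mem_span_range_iff_exists_fun.mp ?_
    rw [map_mul]
    refine Ideal.mul_mem_left _ _ ?_
    rw [← Ideal.Quotient.eq_zero_iff_mem]
    have h2 := Polynomial.aeval_algHom_apply
      (Ideal.Quotient.mkₐ R (Ideal.span (Set.range f))) (MvPolynomial.X k) p
    exact h2.symm.trans h

/-- Multiplication by the difference Jacobian, followed by fibre integration, after forgetting the
variables `y` by means of a functional. -/
def traceMap (g : Module.Dual R (MvPolynomial (Fin n) R)) :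
    Kos R (Fin n ⊕ Fin n) (Fin s ⊕ Fin n) →ₗ[R] Kos R (Fin n) (Fin s) :=
  slantY (degreeZeroDual (Fin s) g) ∘ₗ fiberInt n ∘ₗ (dropY R n s).toLinearMap

lemma traceMap_apply (g : Module.Dual R (MvPolynomial (Fin n) R))
    (z : Kos R (Fin n ⊕ Fin n) (Fin s ⊕ Fin n)) :
    traceMap g z = slantY (degreeZeroDual (Fin s) g) (fiberInt n (dropY R n s z)) := rfl

/-- The image of `dropY` contains no `f̂_y`, so the boundary coefficients there are free. With the
value zero, any functional vanishes on the boundaries in `y`. -/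
lemma traceMap_boundary_mem (g : Module.Dual R (MvPolynomial (Fin n) R))
    (z : Kos R (Fin n ⊕ Fin n) (Fin s ⊕ Fin n)) :
    traceMap g (boundary (diagCoeff f) z) ∈ LinearMap.range (boundary f) := by
  let v : (Fin s ⊕ Fin s) ⊕ Fin n → MvPolynomial (Fin n ⊕ Fin n) R :=
    Sum.elim (sumCoeff f 0) fun k => MvPolynomial.X (Sum.inl k) - MvPolynomial.X (Sum.inr k)
  have h1 : boundary v (dropY R n s z) = dropY R n s (boundary (diagCoeff f) z) := by
    refine boundary_incl _ _ _ _ (fun i => ?_) z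
    rw [MvPolynomial.rename_id]
    cases i <;> rfl
  have h2 : degreeZeroDual (Fin s) g ∘ₗ boundary 0 = 0 :=
    LinearMap.ext fun x => by
      rw [LinearMap.comp_apply, boundary_zero_left, map_zero, LinearMap.zero_apply]
  have h3 := boundary_slantY f 0 (degreeZeroDual (Fin s) g) (fiberInt n (dropY R n s z))
  rw [h2, slantY_zero, map_zero, sub_zero] at h3
  rw [traceMap_apply, ← h1, fiberInt_boundary, map_smul]
  exact Submodule.smul_mem _ _ ⟨_, h3⟩

lemma traceMap_pol_mul {g : Module.Dual R (MvPolynomial (Fin n) R)} {p : MvPolynomial (Fin n) R}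
    (h : ∀ q, g (p * q) = 0) (z : Kos R (Fin n ⊕ Fin n) (Fin s ⊕ Fin n)) :
    traceMap g (pol (MvPolynomial.rename Sum.inr p) * z) = 0 := by
  have h1 : degreeZeroDual (Fin s) g ∘ₗ LinearMap.mulLeft R (parityProj 0 (pol p)) = 0 :=
    LinearMap.ext fun x => by
      rw [parityProj_zero_pol]
      exact degreeZeroDual_pol_mul h x
  have h2 := slantY_inclY_even_mul (degreeZeroDual (Fin s) g) (pol p)
    (fiberInt n (dropY R n s z))
  rw [h1, slantY_zero, parityProj_zero_pol, inclY_pol] at h2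
  rw [traceMap_apply, map_mul (dropY R n s), dropY_pol, fiberInt_pol_mul, h2]

lemma contract_jacobianCoeff (i j : Fin s) :
    contract (Sum.inl (Sum.inr i)) (vec (jacobianCoeff D j)) = if i = j then pol (-1) else 0 := by
  rw [← boundary_single, boundary_vec, Finset.sum_eq_single (Sum.inl (Sum.inr i)),
    Pi.single_eq_same, mul_one, jacobianCoeff, Sum.elim_inl, Sum.elim_inr, Pi.neg_apply,
    Pi.single_apply]
  · split_ifs
    · rfl
    · rw [neg_zero, pol_zero]
  · intro b _ hb
    rw [Pi.single_eq_of_ne hb, mul_zero]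
  · simp

/-- The generators `f̂_y` occur only in the Jacobian factors, each with coefficient `-1`. -/
lemma exists_contractList_jacobianProd_mul :
    ∃ r : R, r * r = 1 ∧ ∀ z : Kos R (Fin n ⊕ Fin n) (Fin s ⊕ Fin n),
      contractList ((List.finRange s).map fun i => Sum.inl (Sum.inr i))
        (jacobianProd D * dropY R n s z) = r • dropY R n s z := by
  refine ⟨(-1) ^ s, by rw [← mul_pow, neg_one_mul, neg_neg, one_pow], fun z => ?_⟩
  have h := contractList_prod_mul (List.nodup_finRange s) (b := fun i => Sum.inl (Sum.inr i))
    (v := fun i => vec (jacobianCoeff D i)) (p := fun _ => -1) contract_jacobianCoeff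
    (z := dropY R n s z) fun k => contract_incl_of_notMem _ _ _ (by
      intro i
      cases i <;> simp) z
  have hpow : (List.map (fun _ => (-1 : MvPolynomial (Fin n ⊕ Fin n) R)) (List.finRange s)).prod =
      MvPolynomial.C ((-1 : R) ^ s) := by
    simp
  rw [hpow] at h
  rw [jacobianProd_eq, List.ofFn_eq_map, List.map_map]
  refine h.trans ?_
  rw [← mul_one (MvPolynomial.C _), ← MvPolynomial.smul_eq_C_mul, pol_smul, pol_one, smul_mul_assoc,
    one_mul]

/-- The functional `c ↦ g(b)`, where `b` is the coefficient of `parity c * w` at the product of all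
generators. -/
def topDual (g : Module.Dual R (MvPolynomial (Fin n) R)) (w : Kos R (Fin n) (Fin s)) :
    Module.Dual R (Kos R (Fin n) (Fin s)) :=
  ((degreeZeroDual (Fin s) g ∘ₗ contractList (List.finRange s)) ∘ₗ LinearMap.mulRight R w) ∘ₗ parity

/-- The boundary of `c w` has no top component, so up to sign only `c ∂w` is evaluated, and this is
killed by hypothesis. -/
lemma dualBoundary_topDual {g : Module.Dual R (MvPolynomial (Fin n) R)}
    {w : Kos R (Fin n) (Fin s)}
    (hw : ∀ c, degreeZeroDual (Fin s) g (contractList (List.finRange s) (c * boundary f w)) = 0) :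
    dualBoundary f (topDual g w) = 0 := by
  refine LinearMap.ext fun c => ?_
  rw [dualBoundary_apply]
  simp only [topDual, LinearMap.comp_apply, LinearMap.mulRight_apply]
  have h := boundary_mul f c w
  rw [← sub_eq_iff_eq_add] at h
  rw [parity_parity, ← h, map_sub, map_sub, hw, contractList_boundary List.mem_finRange, map_zero,
    sub_zero, neg_zero, LinearMap.zero_apply]

/-- The factor `w` is absorbed as `w(y)` next to the Jacobian and becomes `gradHom D w` under the
fibre integral; the top contraction in `f̂_y` then removes the product of the Jacobian factors. Only
`r * r = 1` is kept, since the sign is later absorbed into the cocycle. -/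
lemma exists_jMap_topDual (g : Module.Dual R (MvPolynomial (Fin n) R))
    (w : Kos R (Fin n) (Fin s)) :
    ∃ r : R, r * r = 1 ∧ jMap D (topDual g w) = r • parity^[s] (traceMap g (gradHom D w)) := by
  obtain ⟨r, hr, h⟩ := exists_contractList_fiberInt (R := R) (n := n) (τ := Fin n ⊕ Fin n)
    ((List.finRange s).map (Sum.inr : Fin s → Fin s ⊕ Fin s))
  obtain ⟨r', hr', h'⟩ := exists_contractList_jacobianProd_mul (R := R) (D := D)
  refine ⟨r * r', by rw [mul_mul_mul_comm, hr, hr', one_mul], ?_⟩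
  have hpar : ∀ (a : R) (k : ℕ) (x : Kos R (Fin n) (Fin s)),
      parity^[k] (a • x) = a • parity^[k] x := by
    intro a k x
    induction k with
    | zero => rfl
    | succ k ih => rw [Function.iterate_succ_apply', ih, map_smul, Function.iterate_succ_apply']
  rw [jMap_apply, topDual, comp_parity_parity, ← slantY_mul_inclY, jacobian_mul_inclY,
    slantY_comp_contractList, List.length_finRange, h, List.map_map, traceMap_apply]
  have h2 := h' (gradHom D w)
  rw [show (Sum.inl ∘ Sum.inr : Fin s → (Fin s ⊕ Fin s) ⊕ Fin n) =
    fun i => Sum.inl (Sum.inr i) from rfl, h2, map_smul, map_smul, map_smul, hpar, hpar, smul_smul]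

lemma inclX_diagHom (S : Finset (Fin n)) (x : Kos R (Fin n) (Fin s)) :
    diagHom R (Fin s) S (inclX R _ _ _ _ x) = inclX R _ _ _ _ x := by
  have h : (diagHom R (Fin s) S).comp (inclX R (Fin n) (Fin n) (Fin s) (Fin n)) =
      inclX R (Fin n) (Fin n) (Fin s) (Fin n) := by
    refine kos_algHom_ext (fun j => ?_) fun i => ?_
    · rw [AlgHom.comp_apply, inclX_pol, MvPolynomial.rename_X, diagHom_X_inl]
    · rw [AlgHom.comp_apply, inclX_gen, diagHom_inl]
  exact DFunLike.congr_fun h x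

lemma rename_aeval_X {σ τ : Type} (a : σ → τ) (k : σ) (p : Polynomial R) :
    MvPolynomial.rename a (Polynomial.aeval (MvPolynomial.X k : MvPolynomial σ R) p) =
      Polynomial.aeval (MvPolynomial.X (a k)) p := by
  rw [← Polynomial.aeval_algHom_apply, MvPolynomial.rename_X]

/-- The difference quotient of `p`, in the variables `x k` and `y k`. -/
def diffQuot (p : Polynomial R) (k : Fin n) : MvPolynomial (Fin n ⊕ Fin n) R :=
  ∑ b ∈ Finset.range p.natDegree, MvPolynomial.X (Sum.inr k) ^ b *
    MvPolynomial.rename Sum.inl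
      (Polynomial.aeval (MvPolynomial.X k) (Polynomial.divX^[b + 1] p))

lemma sub_mul_diffQuot (p : Polynomial R) (k : Fin n) :
    (MvPolynomial.X (Sum.inl k) - MvPolynomial.X (Sum.inr k)) * diffQuot p k =
      MvPolynomial.rename Sum.inl (Polynomial.aeval (MvPolynomial.X k) p) -
        MvPolynomial.rename Sum.inr (Polynomial.aeval (MvPolynomial.X k) p) := by
  rw [rename_aeval_X, rename_aeval_X, aeval_sub_aeval_of_natDegree_le _ _ _ p le_rfl, diffQuot]
  simp only [rename_aeval_X]

/-- Product and functional both factor over the variables, which reduces the claim to one monic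
polynomial. -/
lemma slantY_prod_diffQuot [Nontrivial R] {p : Fin n → Polynomial R} (hp : ∀ k, (p k).Monic)
    (hd : ∀ k, 0 < (p k).natDegree) :
    slantY (degreeZeroDual (Fin s) (residue p)) (pol (∏ k, diffQuot (p k) k)) =
      (1 : Kos R (Fin n) (Fin s)) := by
  have h0 : ∀ a b : MvPolynomial (Fin n) R,
      slantY (degreeZeroDual (Fin s) (residue p))
        (pol (MvPolynomial.rename Sum.inr b * MvPolynomial.rename Sum.inl a)) =
      (pol (residue p b • a) : Kos R (Fin n) (Fin s)) := by
    intro a b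
    rw [mul_comm, pol_mul, ← inclX_pol, ← inclY_pol, slantY_mul, degreeZeroDual_pol, pol_smul]
  have h1 : (∏ k, diffQuot (p k) k) =
      ∑ β ∈ Fintype.piFinset fun k => Finset.range (p k).natDegree,
        MvPolynomial.rename Sum.inr (∏ k, MvPolynomial.X k ^ β k) *
          MvPolynomial.rename Sum.inl
            (∏ k, Polynomial.aeval (MvPolynomial.X k) (Polynomial.divX^[β k + 1] (p k))) := by
    simp only [diffQuot]
    rw [Finset.prod_univ_sum]
    refine Finset.sum_congr rfl fun β _ => ?_
    rw [Finset.prod_mul_distrib, map_prod, map_prod]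
    simp only [map_pow, MvPolynomial.rename_X]
  rw [h1, pol_sum, map_sum, Finset.sum_congr rfl fun β _ => h0 _ _, ← pol_sum, ← pol_one]
  congr 1
  have h2 : ∀ β : Fin n → ℕ, residue p (∏ k, MvPolynomial.X k ^ β k) •
      (∏ k, Polynomial.aeval (MvPolynomial.X k : MvPolynomial (Fin n) R)
        (Polynomial.divX^[β k + 1] (p k))) =
      ∏ k, topCoeff (p k) (Polynomial.X ^ β k) •
        Polynomial.aeval (MvPolynomial.X k) (Polynomial.divX^[β k + 1] (p k)) := by
    intro β
    rw [residue_prod_X_pow]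
    simp only [MvPolynomial.smul_eq_C_mul]
    rw [map_prod, Finset.prod_mul_distrib]
  rw [Finset.sum_congr rfl fun β _ => h2 β]
  have h3 := (Finset.prod_univ_sum (fun k => Finset.range (p k).natDegree) fun k b =>
    topCoeff (p k) (Polynomial.X ^ b) •
      Polynomial.aeval (MvPolynomial.X k : MvPolynomial (Fin n) R)
        (Polynomial.divX^[b + 1] (p k))).symm
  rw [h3]
  refine Finset.prod_eq_one fun k _ => ?_
  -- Below the degree of `p k`, `topCoeff` detects only the power `natDegree - 1`, whose coefficient
  -- in the difference quotient is the leading coefficient `1`.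
  rw [Finset.sum_eq_single ((p k).natDegree - 1)]
  · have := hd k
    rw [topCoeff_X_pow (hp k) (by omega), if_pos (by omega), one_smul, Nat.sub_add_cancel this,
      iterate_divX_natDegree (hp k), map_one]
  · intro b hb hb'
    have := Finset.mem_range.mp hb
    rw [topCoeff_X_pow (hp k) this, if_neg (by omega), zero_smul]
  · intro h
    have := hd k
    exact absurd (Finset.mem_range.mpr (by omega)) h

end Existence


section Existence

set_option linter.unusedSectionVars false

variable {R : Type*} [CommRing R] {n s : ℕ}
variable {f : Fin s → MvPolynomial (Fin n) R}
  {D : Fin s → Fin n → MvPolynomial (Fin n ⊕ Fin n) R}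

/-- The largest left ideal on which a linear map vanishes. -/
def leftKernel {σ ι : Type} {M : Type*} [AddCommGroup M] [Module R M] (g : Kos R σ ι →ₗ[R] M) :
    Submodule R (Kos R σ ι) :=
  ⨅ c, LinearMap.ker (g ∘ₗ LinearMap.mulLeft R c)

lemma mem_leftKernel {σ ι : Type} {M : Type*} [AddCommGroup M] [Module R M]
    {g : Kos R σ ι →ₗ[R] M} {y : Kos R σ ι} : y ∈ leftKernel g ↔ ∀ c, g (c * y) = 0 := by
  simp only [leftKernel, Submodule.mem_iInf, LinearMap.mem_ker, LinearMap.comp_apply,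
    LinearMap.mulLeft_apply]

lemma mul_mem_leftKernel {σ ι : Type} {M : Type*} [AddCommGroup M] [Module R M]
    {g : Kos R σ ι →ₗ[R] M} (x : Kos R σ ι) {y : Kos R σ ι} (hy : y ∈ leftKernel g) :
    x * y ∈ leftKernel g := by
  refine mem_leftKernel.mpr fun c => ?_
  rw [← mul_assoc]
  exact mem_leftKernel.mp hy _

lemma pol_mul_mem_leftKernel {σ ι : Type} [Fintype ι] [DecidableEq ι] {M : Type*} [AddCommGroup M]
    [Module R M] {g : Kos R σ ι →ₗ[R] M} {p : MvPolynomial σ R} (h : ∀ x, g (pol p * x) = 0)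
    (x : Kos R σ ι) : pol p * x ∈ leftKernel g := by
  refine mem_leftKernel.mpr fun c => ?_
  rw [pol_mul_left_comm, h]

/-- An element with the same boundary as `gradHom D (vec a)`, for `vec a` of boundary `p(x k)`. -/
def diagLift (a : Fin s → MvPolynomial (Fin n) R) (p : Polynomial R) (k : Fin n) :
    Kos R (Fin n ⊕ Fin n) (Fin s ⊕ Fin n) :=
  inclX R _ _ _ _ (vec a) - gen (Sum.inr k) * pol (diffQuot p k)

lemma boundary_diagLift {a : Fin s → MvPolynomial (Fin n) R} {p : Polynomial R} {k : Fin n}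
    (ha : ∑ i, a i * f i = Polynomial.aeval (MvPolynomial.X k) p) :
    boundary (diagCoeff f) (diagLift a p k) =
      pol (MvPolynomial.rename Sum.inr (Polynomial.aeval (MvPolynomial.X k) p)) := by
  have h1 : boundary (diagCoeff f) (inclX R (Fin n) (Fin n) (Fin s) (Fin n) (vec a)) =
      inclX R _ _ _ _ (boundary f (vec a)) :=
    boundary_incl Sum.inl Sum.inl (diagCoeff f) f (fun _ => rfl) _
  rw [diagLift, map_sub, h1, boundary_vec, ha, inclX_pol, boundary_gen_mul, boundary_pol, mul_zero,
    sub_zero, diagCoeff, Sum.elim_inr, ← pol_mul, sub_mul_diffQuot, pol_sub, sub_sub_cancel]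

/-- The two elements have the same boundary `p(y_k)` and the same restriction to the diagonal, so
the contraction onto the diagonal exhibits their difference as a boundary. -/
lemma gradHom_sub_diagLift_mem (hD : IsDifferenceGradient f D) {a : Fin s → MvPolynomial (Fin n) R}
    {p : Polynomial R} {k : Fin n}
    (ha : ∑ i, a i * f i = Polynomial.aeval (MvPolynomial.X k) p) :
    gradHom D (vec a) - diagLift a p k ∈ LinearMap.range (boundary (diagCoeff f)) := by
  obtain ⟨η, -, h⟩ := exists_homotopy_diagHom f Finset.univ
  have h1 := h (gradHom D (vec a) - diagLift a p k)
  have h2 : diagHom R (Fin s) Finset.univ (diagLift a p k) = inclX R _ _ _ _ (vec a) := by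
    rw [diagLift, map_sub, inclX_diagHom, map_mul (diagHom R _ _), diagHom_inr,
      if_pos (Finset.mem_univ k), zero_mul, sub_zero]
  rw [map_sub (diagHom R _ _), diagHom_gradHom, h2, sub_self, sub_zero, map_sub (boundary _),
    boundary_gradHom hD, boundary_vec, ha, gradHom_pol, boundary_diagLift ha, sub_self, map_zero,
    add_zero] at h1
  exact ⟨_, h1.symm⟩

lemma contract_diagLift (a : Fin n → Fin s → MvPolynomial (Fin n) R) (p : Fin n → Polynomial R)
    (k j : Fin n) :
    contract (Sum.inr k) (dropY R n s (diagLift (a j) (p j) j)) =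
      if k = j then pol (-diffQuot (p j) j) else 0 := by
  have h1 : contract (Sum.inr k) (dropY R n s (diagLift (a j) (p j) j)) =
      dropY R n s (contract (Sum.inr k) (diagLift (a j) (p j) j)) :=
    contract_incl id (Sum.map Sum.inl id)
      (Sum.map_injective.mpr ⟨Sum.inl_injective, Function.injective_id⟩) (Sum.inr k) _
  rw [h1, diagLift, map_sub, inclX, contract_incl_of_notMem _ _ _ (by simp), contract_gen_mul,
    contract_pol, mul_zero, sub_zero, zero_sub]
  by_cases h : k = j
  · subst h
    rw [if_pos rfl, if_pos rfl, map_neg, dropY_pol, pol_neg]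
  · rw [if_neg (by simpa using h), if_neg h, neg_zero, map_zero]

/-- Fibre integration needs every `û_k`, and `û_k` occurs only in the `k`-th factor with coefficient
`-diffQuot (p k) k`. The two signs `(-1) ^ n` cancel, and the residue of the product is one. -/
lemma traceMap_prod_diagLift [Nontrivial R] (a : Fin n → Fin s → MvPolynomial (Fin n) R)
    {p : Fin n → Polynomial R} (hp : ∀ k, (p k).Monic) (hd : ∀ k, 0 < (p k).natDegree) :
    traceMap (residue p) ((List.finRange n).map fun k => diagLift (a k) (p k) k).prod =
      (1 : Kos R (Fin n) (Fin s)) := by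
  have h := contractList_prod_mul (List.nodup_finRange n) (b := Sum.inr)
    (v := fun k => dropY R n s (diagLift (a k) (p k) k)) (p := fun k => -diffQuot (p k) k)
    (contract_diagLift a p) (z := 1) fun k => by rw [← boundary_single, boundary_one]
  have hN : ((List.finRange n).map fun k => -diffQuot (p k) k).prod =
      (-1 : R) ^ n • ∏ k, diffQuot (p k) k := by
    rw [← Fin.prod_univ_def, Finset.prod_neg, Finset.card_univ, Fintype.card_fin,
      MvPolynomial.smul_eq_C_mul, map_pow, map_neg, map_one]
  rw [mul_one, mul_one, hN, pol_smul] at h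
  rw [traceMap_apply, fiberInt_apply, foldContract_eq_contractList, map_list_prod, List.map_map,
    List.length_finRange]
  refine Eq.trans ?_ (slantY_prod_diffQuot hp hd)
  congr 1
  refine (congrArg (fun z => forget (Fin n) ((-1 : R) ^ n • z)) h).trans ?_
  rw [smul_smul, ← mul_pow, neg_one_mul, neg_neg, one_pow, one_smul, forget_eq_hom, hom_pol,
    AlgHom.id_apply]

theorem exists_cocycle_jMap_eq
    (hfin : Module.Finite R (MvPolynomial (Fin n) R ⧸ Ideal.span (Set.range f)))
    (hD : IsDifferenceGradient f D) :
    ∃ e : Module.Dual R (Kos R (Fin n) (Fin s)), dualBoundary f e = 0 ∧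
      ∃ t, jMap D e = 1 + boundary f t := by
  -- Degrees of monic polynomials behave as expected only over a nontrivial ring.
  rcases subsingleton_or_nontrivial R with hR | hR
  · have := Module.subsingleton R (Kos R (Fin n) (Fin s))
    exact ⟨0, map_zero _, 0, Subsingleton.elim _ _⟩
  choose p hp hd a ha using exists_monic_aeval_eq hfin
  set w : Kos R (Fin n) (Fin s) := ((List.finRange n).map fun k => vec (a k)).prod with hw
  have hres : ∀ k q, residue p (Polynomial.aeval (MvPolynomial.X k) (p k) * q) = 0 :=
    fun k q => residue_aeval_mul (hp k) q
  have hcocycle : dualBoundary f (topDual (residue p) w) = 0 := by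
    refine dualBoundary_topDual (mem_leftKernel (g := degreeZeroDual (Fin s) (residue p) ∘ₗ
      contractList (List.finRange s)).mp ?_)
    -- Only the first half is needed, that `∂w` lies in the left ideal, so both families are the
    -- same.
    refine (prod_sub_prod_mem (v' := fun k => vec (a k))
      (fun k => by rw [boundary_vec, ha k]) (fun k => by rw [boundary_vec, ha k])
      (fun k => by rw [sub_self]; exact Submodule.zero_mem _)
      (I := leftKernel (degreeZeroDual (Fin s) (residue p) ∘ₗ contractList (List.finRange s)))
      (fun k => pol_mul_mem_leftKernel fun x => ?_)
      (fun x y hy => mul_mem_leftKernel x hy) (List.finRange n)).1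
    rw [LinearMap.comp_apply, contractList_pol_mul]
    exact degreeZeroDual_pol_mul (hres k) _
  have htrace : ∃ t, traceMap (residue p) (gradHom D w) = 1 + boundary f t := by
    have h := (prod_sub_prod_mem (v := fun k => gradHom D (vec (a k)))
      (v' := fun k => diagLift (a k) (p k) k)
      (fun k => by rw [boundary_gradHom hD, boundary_vec, ha k, gradHom_pol])
      (fun k => boundary_diagLift (ha k)) (fun k => gradHom_sub_diagLift_mem hD (ha k))
      (I := leftKernel (traceMap (s := s) (residue p)))
      (fun k => pol_mul_mem_leftKernel fun x => traceMap_pol_mul (hres k) x)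
      (fun x y hy => mul_mem_leftKernel x hy) (List.finRange n)).2
    obtain ⟨y, ⟨u, rfl⟩, z, hz, hyz⟩ := Submodule.mem_sup.mp h
    have h1 := congrArg (traceMap (s := s) (residue p)) hyz
    have h2 := mem_leftKernel.mp hz 1
    obtain ⟨t, ht⟩ := traceMap_boundary_mem (f := f) (residue p) u
    rw [one_mul] at h2
    rw [map_add, map_sub, h2, add_zero, ← ht, traceMap_prod_diagLift a hp hd] at h1
    refine ⟨t, ?_⟩
    rw [h1, hw, map_list_prod, List.map_map]
    exact (add_sub_cancel _ _).symm
  have hpar : ∀ k : ℕ, ∃ t, parity^[k] (traceMap (residue p) (gradHom D w)) =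
      1 + boundary f t := by
    intro k
    induction k with
    | zero => exact htrace
    | succ k ih =>
      obtain ⟨t, ht⟩ := ih
      refine ⟨-parity t, ?_⟩
      rw [Function.iterate_succ_apply', ht, map_add, parity_one, map_neg, boundary_parity, neg_neg]
  obtain ⟨r, hr, h⟩ := exists_jMap_topDual (D := D) (residue p) w
  obtain ⟨t, ht⟩ := hpar s
  -- Rescaling by `r` cancels the sign in `h`, as `r * r = 1`.
  refine ⟨r • topDual (residue p) w, by rw [map_smul, hcocycle, smul_zero], t, ?_⟩
  rw [map_smul, h, smul_smul, hr, one_smul, ht]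

end Existence

end KoszulDuality

end

theorem theorem4 {R : Type*} [CommRing R] {n s : ℕ} (hns : n ≤ s)
    (f : Fin s → MvPolynomial (Fin n) R)
    (hfin : Module.Finite R (MvPolynomial (Fin n) R ⧸ Ideal.span (Set.range f)))
    (D : Fin s → Fin n → MvPolynomial (Fin n ⊕ Fin n) R)
    (hD : KoszulDuality.IsDifferenceGradient f D) :
    (∃ e : Module.Dual R (KoszulDuality.Kos R (Fin n) (Fin s)),
      KoszulDuality.dualBoundary f e = 0 ∧
      ∃ t : KoszulDuality.Kos R (Fin n) (Fin s),
        KoszulDuality.jMap D e = 1 + KoszulDuality.boundary f t) ∧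
    (∀ e : Module.Dual R (KoszulDuality.Kos R (Fin n) (Fin s)),
      KoszulDuality.dualBoundary f e = 0 →
      (∃ t : KoszulDuality.Kos R (Fin n) (Fin s),
        KoszulDuality.jMap D e = 1 + KoszulDuality.boundary f t) →
      KoszulDuality.IsDuality f D e) := by
  refine ⟨KoszulDuality.exists_cocycle_jMap_eq hfin hD, fun e he ⟨t, ht⟩ => ?_⟩
  exact KoszulDuality.isDuality hns hfin hD he ht
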